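/- Let $F$ be an algebraically closed field of characteristic $p>0$, let $B$ be a semiabelian variety over $F$, let $i:Y\hookrightarrow B$ be an irreducible reduced closed subscheme, and let $\Lambda\subseteq B(F)$ be a subgroup such that $\Lambda\otimes_{\mathbb Z}\mathbb Z_{(p)}$ is a finitely generated $\mathbb Z_{(p)}$-module. Let $F'$ be an algebraically closed field extension of $F$, let $Y_{F'}\hookrightarrow B_{F'}$ be the base change of $Y\hookrightarrow B$, and let $\Lambda_{F'}\subseteq B_{F'}(F')$ be the image of $\Lambda$. Let $\mathrm{Stab}(Y)$ be the translation stabilizer of $Y$, that is, the closed subgroup scheme of $B$ such that a morphism $b:S\to B$ of $F$-schemes factors through $\mathrm{Stab}(Y)$ if and only if translation by $b$ on $B\times_F S$ maps $Y\times_F S$ to itself. Put $C=\mathrm{Stab}(Y)^{\mathrm{red}}$, let $B/C$ be the quotient group scheme, and let $Y/C\subseteq B/C$ be the (scheme-theoretic) image of $Y$. Let $\mathrm{C}(Y,B,F)$ be the following assertion: there are - a semiabelian variety $B'$ over $F$; - a homomorphism with finite kernel $h:B'\to B/C$; - a model $\mathbf B'$ of $B'$ over a finite subfield $\kappa\subset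 F$ (a semiabelian variety over $\kappa$ with an isomorphism $\mathbf B'\times_\kappa F\cong B'$ of group schemes over $F$); - an irreducible reduced closed subscheme $\mathbf Y'\hookrightarrow\mathbf B'$; - a point $b\in(B/C)(F)$ such that $Y/C=b+h_*(\mathbf Y'\times_\kappa F)$, where $h_*$ denotes the scheme-theoretic image under $h$. Let $\mathrm{C}(Y_{F'},B_{F'},F')$ be the same assertion for $Y_{F'}\hookrightarrow B_{F'}$ over $F'$, with $C$ replaced by $\mathrm{Stab}(Y_{F'})^{\mathrm{red}}$. Then: 1. the implication "if $Y\cap\Lambda$ is Zariski dense in $Y$, then $\mathrm{C}(Y,B,F)$" holds if and only if the implication "if $Y_{F'}\cap\Lambda_{F'}$ is Zariski dense in $Y_{F'}$, then $\mathrm{C}(Y_{F'},B_{F'},F')$" holds; 2. $\mathrm{C}(Y,B,F)$ holds if and only if $\mathrm{C}(Y_{F'},B_{F'},F')$ holds. -/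

import Mathlib

open CategoryTheory Limits MonoidalCategory CartesianMonoidalCategory MonObj AlgebraicGeometry
open scoped TensorProduct

universe u

namespace MordellLang

noncomputable section

/-! ### Base change of schemes and of group schemes along an extension of fields

Schemes over a field `k` are objects of `Over (Spec (.of k))`, and a group scheme over `k` is such an
object `G` with a `GrpObj G` structure. Group laws are written multiplicatively. For schemes `S`, `G`
over `k` the set `S ⟶ G` of `S`-valued points of a group scheme is a group; the group `G(k)` is
`𝟙_ _ ⟶ G`, because `𝟙_ _` is `Spec k`. -/

/-- The base change functor `X ↦ X_{k'}`, from schemes over `k` to schemes over `k'`. -/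
abbrev baseChange (k k' : Type u) [Field k] [Field k'] [Algebra k k'] :
    Over (Spec (.of k)) ⥤ Over (Spec (.of k')) :=
  Over.pullback (Spec.map (CommRingCat.ofHom (algebraMap k k')))

/-- The base change of a group scheme, with the group law obtained by base change. -/
instance baseChangeGrpObj (k k' : Type u) [Field k] [Field k'] [Algebra k k']
    (G : Over (Spec (.of k))) [GrpObj G] : GrpObj ((baseChange k k').obj G) :=
  Functor.grpObjObj

/-- The homomorphism `G(k) → G_{k'}(k')` of groups of points. -/
def pointsBaseChange (k k' : Type u) [Field k] [Field k'] [Algebra k k']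
    (G : Over (Spec (.of k))) [GrpObj G] :
    (𝟙_ (Over (Spec (.of k))) ⟶ G) →* (𝟙_ (Over (Spec (.of k'))) ⟶ (baseChange k k').obj G) where
  toFun x := Functor.LaxMonoidal.ε (baseChange k k') ≫ (baseChange k k').map x
  map_one' := by rw [Functor.map_one, Hom.one_def, Hom.one_def]; simp
  map_mul' x y := by rw [Functor.map_mul, comp_mul]

section Field

variable {k : Type u} [Field k]

/-! ### Exactness in the fppf topology -/

/-- `π : G ⟶ Q` is a homomorphism of group schemes which is an epimorphism for the fppf topology
(faithfully flat and locally of finite presentation) and whose kernel is the subscheme `j : H ⟶ G`.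
In other words `Q` is the quotient `G/H`, that is `Q` represents the fppf quotient sheaf of `G`
by `H`. -/
structure IsQuotient {H G Q : Over (Spec (.of k))} [GrpObj G] [GrpObj Q]
    (j : H ⟶ G) (π : G ⟶ Q) : Prop where
  isMonHom : IsMonHom π
  flat : Flat π.left
  surjective : Surjective π.left
  locallyOfFinitePresentation : LocallyOfFinitePresentation π.left
  isKernel : IsPullback j (toUnit H) π η[Q]

/-! ### Tori, abelian varieties, semiabelian varieties -/

/-- `T` is isomorphic to a power `𝔾ₘⁿ` of the multiplicative group: there are isomorphisms of groups
`T(S) ≃ (Γ(S, 𝒪_S)ˣ)ⁿ`, functorial in the scheme `S` over `k`. -/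
def IsSplitTorus (T : Over (Spec (.of k))) [GrpObj T] : Prop :=
  ∃ (n : ℕ) (e : ∀ S : Over (Spec (.of k)), (S ⟶ T) ≃* (Fin n → Γ(S.left, ⊤)ˣ)),
    ∀ (S S' : Over (Spec (.of k))) (f : S' ⟶ S) (x : S ⟶ T),
      e S' (f ≫ x) = fun a ↦ Units.map f.left.appTop.hom.toMonoidHom (e S x a)

/-- `T` is a torus over `k`: it becomes isomorphic to some `𝔾ₘⁿ` over an algebraic closure of `k`. -/
def IsTorus (T : Over (Spec (.of k))) [GrpObj T] : Prop :=
  IsSplitTorus ((baseChange k (AlgebraicClosure k)).obj T)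

/-- The group scheme `A` is an abelian variety over `k`: it is proper and geometrically integral. -/
structure IsAbelianVariety (A : Over (Spec (.of k))) [GrpObj A] : Prop where
  isProper : IsProper A.hom
  geometricallyIntegral : GeometricallyIntegral A.hom

/-- The group scheme `G` is a semiabelian variety over `k`: it is commutative, and there is an
exact sequence `1 → T → G → A → 1` with a torus `T` and an abelian variety `A` over `k`. -/
class IsSemiabelian (G : Over (Spec (.of k))) [GrpObj G] : Prop extends IsCommMonObj G where
  exists_extension : ∃ (T A : Over (Spec (.of k))) (_ : GrpObj T) (_ : GrpObj A)
    (j : T ⟶ G) (π : G ⟶ A),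
      IsTorus T ∧ IsAbelianVariety A ∧ IsMonHom j ∧ IsQuotient j π

/-! ### Stabilizers -/

/-- Translation by an `S`-valued point `b` of `G`, the automorphism `(x, s) ↦ (b(s) x, s)`
of `G × S`. -/
def translation {G S : Over (Spec (.of k))} [GrpObj G] (b : S ⟶ G) : G ⊗ S ⟶ G ⊗ S :=
  lift ((snd G S ≫ b) * fst G S) (snd G S)

/-- Translation by a rational point `b` of `G`, the automorphism `x ↦ b x` of `G`. -/
def translationBy {G : Over (Spec (.of k))} [GrpObj G] (b : 𝟙_ (Over (Spec (.of k))) ⟶ G) : G ⟶ G :=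
  (toUnit G ≫ b) * 𝟙 G

/-- Translation by the `S`-valued point `b` maps the subscheme `Y × S` of `G × S` to itself. -/
def Stabilizes {G Y S : Over (Spec (.of k))} [GrpObj G] (i : Y ⟶ G) (b : S ⟶ G) : Prop :=
  ∃ e : Y ⊗ S ≅ Y ⊗ S, (i ▷ S) ≫ translation b = e.hom ≫ (i ▷ S)

/-- The closed subscheme `s : St ⟶ G` is the translation stabilizer of `i : Y ⟶ G`: an `S`-valued
point `b` of `G` factors through `St` if and only if translation by `b` maps `Y × S` to itself. -/
structure IsStabilizer {G Y St : Over (Spec (.of k))} [GrpObj G] (i : Y ⟶ G) (s : St ⟶ G) :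
    Prop where
  isClosedImmersion : IsClosedImmersion s.left
  factors_iff : ∀ (S : Over (Spec (.of k))) (b : S ⟶ G),
    (∃ c : S ⟶ St, c ≫ s = b) ↔ Stabilizes i b

/-- `r : C ⟶ X` is the reduced closed subscheme of `X` with the same underlying space as `X`. -/
structure IsReduction {C X : Over (Spec (.of k))} (r : C ⟶ X) : Prop where
  isClosedImmersion : IsClosedImmersion r.left
  surjective : Surjective r.left
  isReduced : IsReduced C.left

/-- `π : G ⟶ Q` is the quotient of `G` by the reduced stabilizer `C = Stab(Y)^red` of the
subscheme `i : Y ⟶ G`. -/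
def IsQuotientByStabilizer {G Y Q : Over (Spec (.of k))} [GrpObj G] [GrpObj Q]
    (i : Y ⟶ G) (π : G ⟶ Q) : Prop :=
  ∃ (St C : Over (Spec (.of k))) (s : St ⟶ G) (r : C ⟶ St),
    IsStabilizer i s ∧ IsReduction r ∧ IsQuotient (r ≫ s) π

/-! ### The hypotheses and the conclusion of the Mordell-Lang statement -/

/-- The scheme-theoretic image of a morphism, as a closed subscheme (an ideal sheaf) of the target. -/
def schemeImage {X Z : Over (Spec (.of k))} (f : X ⟶ Z) : Z.left.IdealSheafData :=
  f.left.ker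

/-- `f` has a finite kernel: the fibre of `f` over the unit section is finite over `k`. -/
def HasFiniteKernel {G Q : Over (Spec (.of k))} [GrpObj Q] (f : G ⟶ Q) : Prop :=
  IsFinite (pullback.snd f.left η[Q].left)

instance isPrime_span (p : ℕ) [Fact p.Prime] : (Ideal.span {(p : ℤ)}).IsPrime :=
  (Ideal.span_singleton_prime (by exact_mod_cast (Fact.out : p.Prime).ne_zero)).2
    (Nat.prime_iff_prime_int.1 Fact.out)

/-- `Λ ⊗ ℤ_(p)` is a finitely generated `ℤ_(p)`-module. -/
def IsFGAt (p : ℕ) [Fact p.Prime] (Λ : Type*) [CommGroup Λ] : Prop :=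
  Module.Finite (Localization.AtPrime (Ideal.span {(p : ℤ)}))
    (Localization.AtPrime (Ideal.span {(p : ℤ)}) ⊗[ℤ] Additive Λ)

/-- `Y ∩ Λ` is Zariski dense in `Y`, for a subgroup `Λ` of the group of rational points of `G`. -/
def DenseIntersection {G Y : Over (Spec (.of k))} [GrpObj G] (i : Y ⟶ G)
    (Λ : Subgroup (𝟙_ (Over (Spec (.of k))) ⟶ G)) : Prop :=
  Dense {z : Y.left | ∃ y : 𝟙_ (Over (Spec (.of k))) ⟶ Y, y ≫ i ∈ Λ ∧ z ∈ Set.range y.left}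

/-- The conclusion of the Mordell-Lang statement for `i : Y ⟶ B`, where `π : B ⟶ Q` is the quotient of
`B` by the reduced stabilizer of `Y`. There are a semiabelian variety `B'`, a homomorphism `h : B' ⟶ Q`
with finite kernel, a model `M` of `B'` over a finite subfield `κ` of the ground field (a semiabelian
variety over `κ` with an isomorphism `e : M_k ≅ B'` of group schemes), an irreducible reduced closed
subscheme `m : Y' ⟶ M`, and a rational point `b` of `Q`, such that the image of `Y` in `Q` is the
translate by `b` of the scheme-theoretic image of `Y'_k` under `h`. -/
def Conclusion {B Y Q : Over (Spec (.of k))} [GrpObj B] [GrpObj Q]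
    (i : Y ⟶ B) (π : B ⟶ Q) : Prop :=
  ∃ (B' : Over (Spec (.of k))) (_ : GrpObj B') (h : B' ⟶ Q)
    (κ : Subfield k) (M : Over (Spec (.of κ))) (_ : GrpObj M)
    (e : (baseChange κ k).obj M ≅ B')
    (Y' : Over (Spec (.of κ))) (m : Y' ⟶ M)
    (b : 𝟙_ (Over (Spec (.of k))) ⟶ Q),
    IsSemiabelian B' ∧ IsMonHom h ∧ HasFiniteKernel h ∧
    Finite κ ∧ IsSemiabelian M ∧ IsMonHom e.hom ∧
    IsIntegral Y'.left ∧ IsClosedImmersion m.left ∧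
    schemeImage (i ≫ π) =
      (schemeImage ((baseChange κ k).map m ≫ e.hom ≫ h)).map (translationBy b).left

end Field

end

end MordellLang

/-! # Isotriviality of subvarieties of semiabelian varieties over extension fields

Base change along `F ⊆ F'` commutes with all the constructions in the statement. The stabilizer does
so because it is described by its points, its reduction because reduced schemes over the perfect
field `F` are geometrically reduced (`isReduced_baseChange`), and the quotient because it is
determined by faithful flatness and by its kernel (`IsQuotientByStabilizer.baseChange`). Hence the
given quotient `Q'` of `B_{F'}` is isomorphic to `Q_{F'}` (`IsQuotientByStabilizer.exists_iso`),
compatibly with the images of `Y_{F'}`. The points of `Y_{F'} ∩ Λ_{F'}` come from points of `Y ∩ Λ`,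
so that both intersections are dense or neither is (`denseIntersection_baseChange_iff`). It remains
to compare the two conclusions, which are restated in terms of closed sets: the image `Z` of `Y` is
"isotrivial", that is, the closure of a translate of the image of a subvariety defined over a finite
field (`conclusion_iff`).

If `Z` is isotrivial then so is `Z_{F'}`, by base change of the homomorphism and of the translating
point (`IsIsotrivial.baseChange`).

Conversely, let `Z_{F'}` be the closure of `b + h(W_{F'})`, for a subvariety `W` of a semiabelian
variety `M` over a finite field `κ`. The field `κ` lies in `F`, since `F` is algebraically closed,
so that `M` and `W` are defined over `F`; but `h` and `b` need not be. They are defined over a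
finitely generated `F`-algebra `A ⊆ F'` (`exists_family`, `exists_prod_hom_eq`), which uses that `Q`
is locally of finite type over `F` (`IsQuotient.locallyOfFiniteType`). At every point `r` of `Spec
A` with values in `F` they specialize to a homomorphism `h_r` and a point `b_r` over `F`. After
inverting an element of `A`, the kernel of `h_r` is always finite (`exists_hasFiniteKernel`).
Moreover the image of `W × Spec A` under `b + h` is constructible and its closure is `Z × Spec A`,
so it contains a nonempty open subset of `Z × Spec A`; if `r` is the image of a rational point of
that subset, then the image of `b_r + h_r` is dense in `Z`, as `Z` is irreducible
(`exists_point_closure_range_eq`). So `h_r` and `b_r` show that `Z` is isotrivial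
(`IsIsotrivial.of_baseChange`). -/

namespace MordellLang

noncomputable section

/-! ### Points of a base change -/

section Points

variable (k k' : Type u) [Field k] [Field k'] [Algebra k k']

/-- The functor that regards a scheme over `k'` as a scheme over the subfield `k`, the left adjoint
of base change. -/
abbrev restrictScalars : Over (Spec (.of k')) ⥤ Over (Spec (.of k)) :=
  Over.map (Spec.map (CommRingCat.ofHom (algebraMap k k')))

variable {k k'}

/-- For a scheme `S` over `k'` and a group scheme `G` over `k`, the group `G_{k'}(S)` is `G(S)`. -/
def pointsEquiv (S : Over (Spec (.of k'))) (G : Over (Spec (.of k))) [GrpObj G] :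
    ((restrictScalars k k').obj S ⟶ G) ≃* (S ⟶ (baseChange k k').obj G) where
  toEquiv := (Over.mapPullbackAdj _).homEquiv S G
  map_mul' x y := by
    simp only [Equiv.toFun_as_coe, Adjunction.homEquiv_unit]
    exact (congrArg _ (Functor.map_mul (baseChange k k') x y)).trans (comp_mul _ _ _)

lemma homEquiv_left_fst {S : Over (Spec (.of k'))} {X : Over (Spec (.of k))}
    (x : (restrictScalars k k').obj S ⟶ X) :
    ((Over.mapPullbackAdj _).homEquiv S X x).left ≫ pullback.fst _ _ = x.left := by
  simp only [Over.mapPullbackAdj, Adjunction.mkOfHomEquiv_homEquiv, Equiv.coe_fn_mk,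
      Over.homMk_left]
  exact pullback.lift_fst _ _ _

lemma pointsEquiv_left_fst {S : Over (Spec (.of k'))} {G : Over (Spec (.of k))} [GrpObj G]
    (x : (restrictScalars k k').obj S ⟶ G) :
    (pointsEquiv S G x).left ≫ pullback.fst _ _ = x.left :=
  homEquiv_left_fst x

lemma pointsEquiv_comp {S S' : Over (Spec (.of k'))} {G : Over (Spec (.of k))} [GrpObj G]
    (t : S' ⟶ S) (x : (restrictScalars k k').obj S ⟶ G) :
    pointsEquiv S' G ((restrictScalars k k').map t ≫ x) = t ≫ pointsEquiv S G x :=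
  (Over.mapPullbackAdj _).homEquiv_naturality_left _ _

lemma pointsEquiv_comp_map {S : Over (Spec (.of k'))} {G H : Over (Spec (.of k))} [GrpObj G]
    [GrpObj H] (x : (restrictScalars k k').obj S ⟶ G) (f : G ⟶ H) :
    pointsEquiv S H (x ≫ f) = pointsEquiv S G x ≫ (baseChange k k').map f :=
  (Over.mapPullbackAdj _).homEquiv_naturality_right _ _

end Points

/-- A morphism of schemes over `k` into a group scheme is a homomorphism if it is one on points. -/
lemma isMonHom_of_points {k : Type u} [Field k] {G H : Over (Spec (.of k))} [GrpObj G] [GrpObj H]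
    (f : G ⟶ H) (hf : ∀ (S : Over (Spec (.of k))) (x y : S ⟶ G),
      (x * y) ≫ f = (x ≫ f) * (y ≫ f)) : IsMonHom f := by
  have hmul : μ[G] ≫ f = (f ⊗ₘ f) ≫ μ[H] := by
    have := hf _ (fst G G) (snd G G)
    rw [← mul_eq_mul] at this
    rw [this, Hom.mul_def]
    congr 1
  refine ⟨?_, hmul⟩
  have h1 := hf _ (1 : 𝟙_ _ ⟶ G) 1
  rw [_root_.one_mul, left_eq_mul] at h1
  rw [one_eq_one, one_eq_one, h1]

/-! ### Transitivity of base change -/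

section Tower

/-- The functor `Over.map` is compatible with composition, with identity underlying morphisms. -/
def mapTower {C : Type*} [Category* C] {X Y Z : C} {f : X ⟶ Y} {g : Y ⟶ Z} {h : X ⟶ Z}
    (hfg : f ≫ g = h) (S : Over X) :
    (Over.map h).obj S ≅ (Over.map g).obj ((Over.map f).obj S) :=
  Over.isoMk (Iso.refl _) (by simp [← hfg])

variable (k k' k'' : Type u) [Field k] [Field k'] [Field k''] [Algebra k k'] [Algebra k' k'']
  [Algebra k k''] [IsScalarTower k k' k'']

lemma specMap_comp_of_isScalarTower :
    Spec.map (CommRingCat.ofHom (algebraMap k' k'')) ≫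
      Spec.map (CommRingCat.ofHom (algebraMap k k')) =
    Spec.map (CommRingCat.ofHom (algebraMap k k'')) := by
  rw [← Spec.map_comp, ← CommRingCat.ofHom_comp, ← IsScalarTower.algebraMap_eq]

lemma isPullback_baseChange_baseChange (X : Over (Spec (.of k))) :
    IsPullback (pullback.fst ((baseChange k k').obj X).hom
        (Spec.map (CommRingCat.ofHom (algebraMap k' k''))) ≫ pullback.fst X.hom _)
      ((baseChange k' k'').obj ((baseChange k k').obj X)).hom
      X.hom (Spec.map (CommRingCat.ofHom (algebraMap k k''))) := by
  rw [← specMap_comp_of_isScalarTower k k' k'']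
  exact (IsPullback.of_hasPullback _ _).paste_horiz (IsPullback.of_hasPullback _ _)

/-- Base change is transitive: `(X_{k'})_{k''} ≅ X_{k''}`. -/
def baseChangeTower (X : Over (Spec (.of k))) :
    (baseChange k' k'').obj ((baseChange k k').obj X) ≅ (baseChange k k'').obj X :=
  Over.isoMk (isPullback_baseChange_baseChange k k' k'' X).isoPullback
    (IsPullback.isoPullback_hom_snd _)

lemma baseChangeTower_hom_left_fst (X : Over (Spec (.of k))) :
    (baseChangeTower k k' k'' X).hom.left ≫ pullback.fst _ _ =
      pullback.fst _ _ ≫ pullback.fst _ _ :=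
  IsPullback.isoPullback_hom_fst _

variable {k k'} in
lemma baseChange_hom_ext {S : Over (Spec (.of k'))} {X : Over (Spec (.of k))}
    {x y : S ⟶ (baseChange k k').obj X}
    (h : x.left ≫ pullback.fst _ _ = y.left ≫ pullback.fst _ _) : x = y := by
  ext1
  refine pullback.hom_ext h ?_
  exact (Over.w x).trans (Over.w y).symm

variable {k k'} in
lemma baseChange_map_left_fst {X Y : Over (Spec (.of k))} (f : X ⟶ Y) :
    ((baseChange k k').map f).left ≫ pullback.fst _ _ = pullback.fst _ _ ≫ f.left :=
  pullback.lift_fst _ _ _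

lemma baseChangeTower_hom_naturality {X Y : Over (Spec (.of k))} (f : X ⟶ Y) :
    (baseChange k' k'').map ((baseChange k k').map f) ≫ (baseChangeTower k k' k'' Y).hom =
      (baseChangeTower k k' k'' X).hom ≫ (baseChange k k'').map f := by
  apply baseChange_hom_ext
  rw [Over.comp_left, Over.comp_left, Category.assoc, Category.assoc, baseChangeTower_hom_left_fst,
    baseChange_map_left_fst, reassoc_of% baseChangeTower_hom_left_fst k k' k'' X,
    reassoc_of% baseChange_map_left_fst ((baseChange k k').map f), baseChange_map_left_fst]

/-- Restriction of scalars is transitive. -/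
def restrictScalarsTower (S : Over (Spec (.of k''))) :
    (restrictScalars k k'').obj S ≅ (restrictScalars k k').obj ((restrictScalars k' k'').obj S) :=
  mapTower (specMap_comp_of_isScalarTower k k' k'') S

lemma pointsEquiv_comp_baseChangeTower {S : Over (Spec (.of k''))} {G : Over (Spec (.of k))}
    [GrpObj G] (x : (restrictScalars k k').obj ((restrictScalars k' k'').obj S) ⟶ G) :
    pointsEquiv S _ (pointsEquiv _ G x) ≫ (baseChangeTower k k' k'' G).hom =
      pointsEquiv S G ((restrictScalarsTower k k' k'' S).hom ≫ x) := by
  apply baseChange_hom_ext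
  rw [Over.comp_left, Category.assoc, baseChangeTower_hom_left_fst,
    reassoc_of% pointsEquiv_left_fst (pointsEquiv _ G x), pointsEquiv_left_fst,
    pointsEquiv_left_fst, Over.comp_left]
  exact (Category.id_comp _).symm

instance isMonHom_baseChangeTower (G : Over (Spec (.of k))) [GrpObj G] :
    IsMonHom (baseChangeTower k k' k'' G).hom := by
  refine isMonHom_of_points _ fun S x y ↦ ?_
  obtain ⟨x, rfl⟩ := (pointsEquiv S ((baseChange k k').obj G)).surjective x
  obtain ⟨y, rfl⟩ := (pointsEquiv S ((baseChange k k').obj G)).surjective y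
  obtain ⟨x, rfl⟩ := (pointsEquiv _ G).surjective x
  obtain ⟨y, rfl⟩ := (pointsEquiv _ G).surjective y
  rw [← map_mul, ← map_mul, pointsEquiv_comp_baseChangeTower, pointsEquiv_comp_baseChangeTower,
    pointsEquiv_comp_baseChangeTower, comp_mul, map_mul]

end Tower

/-! ### Base change of tori, quotients and semiabelian varieties -/

section BaseChangeOfStructures

variable {k K : Type u} [Field k] [Field K] [Algebra k K]

lemma IsSplitTorus.baseChange {T : Over (Spec (.of k))} [GrpObj T] (hT : IsSplitTorus T) :
    IsSplitTorus ((MordellLang.baseChange k K).obj T) := by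
  obtain ⟨n, e, he⟩ := hT
  refine ⟨n, fun S ↦ (pointsEquiv S T).symm.trans (e _), fun S S' f x ↦ ?_⟩
  obtain ⟨x, rfl⟩ := (pointsEquiv S T).surjective x
  rw [← pointsEquiv_comp]
  simp only [MulEquiv.trans_apply, MulEquiv.symm_apply_apply]
  exact he _ _ _ _

lemma IsSplitTorus.of_iso {T T' : Over (Spec (.of k))} [GrpObj T] [GrpObj T']
    (hT : IsSplitTorus T) (i : T ≅ T') [IsMonHom i.hom] : IsSplitTorus T' := by
  obtain ⟨n, e, he⟩ := hT
  refine ⟨n, fun S ↦ (Hom.mulEquivCongrRight i S).symm.trans (e _), fun S S' f x ↦ ?_⟩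
  have := he _ _ f ((Hom.mulEquivCongrRight i S).symm x)
  refine Eq.trans (congrArg (e S') ?_) this
  exact Category.assoc f x i.inv

lemma IsTorus.baseChange {T : Over (Spec (.of k))} [GrpObj T] (hT : IsTorus T) :
    IsTorus ((MordellLang.baseChange k K).obj T) := by
  let φ : AlgebraicClosure k →ₐ[k] AlgebraicClosure K := IsAlgClosed.lift
  let := φ.toRingHom.toAlgebra
  have : IsScalarTower k (AlgebraicClosure k) (AlgebraicClosure K) :=
    .of_algebraMap_eq fun x ↦ (φ.commutes x).symm
  have h1 : IsSplitTorus ((MordellLang.baseChange (AlgebraicClosure k) (AlgebraicClosure K)).obj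
    ((MordellLang.baseChange k (AlgebraicClosure k)).obj T)) := IsSplitTorus.baseChange hT
  have : IsMonHom (baseChangeTower k K (AlgebraicClosure K) T).symm.hom :=
    inferInstanceAs (IsMonHom (baseChangeTower k K (AlgebraicClosure K) T).inv)
  exact (h1.of_iso (baseChangeTower _ _ _ T)).of_iso
    (baseChangeTower k K (AlgebraicClosure K) T).symm

/-- A monomorphism `j` is the kernel of `π` if and only if it is so on `S`-valued points. -/
lemma isPullback_one_iff {H G Q : Over (Spec (.of k))} [GrpObj Q] (j : H ⟶ G) (π : G ⟶ Q) :
    IsPullback j (toUnit H) π η[Q] ↔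
      Mono j ∧ ∀ (S : Over (Spec (.of k))) (x : S ⟶ G), (∃ c, c ≫ j = x) ↔ x ≫ π = 1 := by
  constructor
  · intro h
    have hm : Mono j := ⟨fun a b hab ↦ h.hom_ext hab (toUnit_unique _ _)⟩
    refine ⟨hm, fun S x ↦ ⟨?_, fun hx ↦ ?_⟩⟩
    · rintro ⟨c, rfl⟩
      rw [Category.assoc, h.w, Hom.one_def, ← Category.assoc, toUnit_unique (c ≫ _) (toUnit S)]
    · exact ⟨h.lift x (toUnit S) (by rw [hx, Hom.one_def]), h.lift_fst _ _ _⟩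
  · rintro ⟨hm, h⟩
    have hw : j ≫ π = toUnit H ≫ η[Q] := by
      rw [← Hom.one_def]
      exact (h H j).1 ⟨𝟙 _, Category.id_comp _⟩
    have hs (s : PullbackCone π η[Q]) : s.fst ≫ π = 1 := by
      rw [s.condition, Hom.one_def, toUnit_unique s.snd (toUnit _)]
    refine ⟨⟨hw⟩, ⟨PullbackCone.IsLimit.mk _ (fun s ↦ ((h _ s.fst).2 (hs s)).choose) (fun s ↦ ?_)
      (fun s ↦ toUnit_unique _ _) fun s m hm _ ↦ ?_⟩⟩
    · exact ((h _ s.fst).2 (hs s)).choose_spec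
    · rw [← cancel_mono j, hm]
      exact ((h _ s.fst).2 (hs s)).choose_spec.symm

/-- A point of `G_K` factors through `H_K` if and only if the corresponding point of `G` factors
through `H`. -/
lemma exists_comp_baseChange_map_iff {S : Over (Spec (.of K))} {H G : Over (Spec (.of k))}
    (j : H ⟶ G) (x : (restrictScalars k K).obj S ⟶ G) :
    (∃ c, c ≫ (baseChange k K).map j = (Over.mapPullbackAdj _).homEquiv S G x) ↔
      ∃ c, c ≫ j = x := by
  constructor
  · rintro ⟨c, hc⟩
    obtain ⟨c, rfl⟩ := ((Over.mapPullbackAdj _).homEquiv S H).surjective c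
    refine ⟨c, ((Over.mapPullbackAdj _).homEquiv S G).injective ?_⟩
    rw [← hc]
    exact (Over.mapPullbackAdj _).homEquiv_naturality_right _ _
  · rintro ⟨c, rfl⟩
    exact ⟨(Over.mapPullbackAdj _).homEquiv S H c,
      ((Over.mapPullbackAdj _).homEquiv_naturality_right _ _).symm⟩

/-- The morphism `f_K` is the base change of `f` along the projection `Y_K ⟶ Y`. -/
lemma isPullback_baseChange_map_left {X Y : Over (Spec (.of k))} (f : X ⟶ Y) :
    IsPullback ((baseChange k K).map f).left (pullback.fst X.hom _)
      (pullback.fst Y.hom _) f.left := by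
  refine IsPullback.of_right (h₁₂ := ((baseChange k K).obj Y).hom) (h₂₂ := Y.hom)
    (v₁₃ := Spec.map (CommRingCat.ofHom (algebraMap k K))) ?_ (baseChange_map_left_fst f)
    (IsPullback.of_hasPullback Y.hom _).flip
  rw [Over.w, Over.w]
  exact (IsPullback.of_hasPullback X.hom _).flip

end BaseChangeOfStructures

section

variable {k K : Type u} [Field k] [Field K] [Algebra k K]

/-- The formation of kernels commutes with base change. -/
lemma isPullback_one_baseChange {H G Q : Over (Spec (.of k))} [GrpObj G] [GrpObj Q]
    {j : H ⟶ G} {π : G ⟶ Q} (h : IsPullback j (toUnit H) π η[Q]) :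
    IsPullback ((baseChange k K).map j) (toUnit _) ((baseChange k K).map π) η[_] := by
  obtain ⟨hm, hk⟩ := (isPullback_one_iff j π).1 h
  refine (isPullback_one_iff _ _).2 ⟨inferInstance, fun S x ↦ ?_⟩
  obtain ⟨x, rfl⟩ := (pointsEquiv S G).surjective x
  refine (exists_comp_baseChange_map_iff j x).trans ?_
  rw [hk, ← pointsEquiv_comp_map]
  exact (map_eq_one_iff _ (pointsEquiv S Q).injective).symm

lemma IsQuotient.baseChange {H G Q : Over (Spec (.of k))} [GrpObj G] [GrpObj Q]
    {j : H ⟶ G} {π : G ⟶ Q} (h : IsQuotient j π) :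
    IsQuotient ((baseChange k K).map j) ((baseChange k K).map π) := by
  have := h.isMonHom
  have := h.flat
  have := h.surjective
  have := h.locallyOfFinitePresentation
  have hp := isPullback_baseChange_map_left (K := K) π
  exact ⟨inferInstance, MorphismProperty.of_isPullback hp.flip ‹_›,
    MorphismProperty.of_isPullback hp.flip ‹_›, MorphismProperty.of_isPullback hp.flip ‹_›,
    isPullback_one_baseChange h.isKernel⟩

lemma IsAbelianVariety.baseChange {A : Over (Spec (.of k))} [GrpObj A] (hA : IsAbelianVariety A) :
    IsAbelianVariety ((MordellLang.baseChange k K).obj A) := by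
  have := hA.isProper
  have := hA.geometricallyIntegral
  have hp := IsPullback.of_hasPullback A.hom (Spec.map (CommRingCat.ofHom (algebraMap k K)))
  exact ⟨MorphismProperty.of_isPullback hp ‹_›, MorphismProperty.of_isPullback hp ‹_›⟩

/-- The base change of a semiabelian variety is a semiabelian variety. -/
instance isSemiabelian_baseChange (G : Over (Spec (.of k))) [GrpObj G] [hG : IsSemiabelian G] :
    IsSemiabelian ((baseChange k K).obj G) := by
  have : IsCommMonObj ((baseChange k K).obj G) := inferInstance
  obtain ⟨T, A, _, _, j, π, hT, hA, hj, hπ⟩ := hG.exists_extension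
  exact { this with
    exists_extension := ⟨_, _, _, _, (baseChange k K).map j, (baseChange k K).map π,
      hT.baseChange, hA.baseChange, inferInstance, hπ.baseChange⟩ }

/-! ### Separatedness and finiteness of group schemes -/

/-- A group scheme over a field is separated: its diagonal is the fibre of `(x, y) ↦ x⁻¹ y` over the
unit section, which is a closed immersion. -/
lemma isSeparated_of_grpObj (G : Over (Spec (.of k))) [GrpObj G] : IsSeparated G.hom := by
  have hp : IsPullback (lift (𝟙 G) (𝟙 G)) (toUnit G) ((fst G G)⁻¹ * snd G G) η[G] := by
    refine (isPullback_one_iff _ _).2 ⟨?_, fun S x ↦ ?_⟩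
    · have : Mono (lift (𝟙 G) (𝟙 G) ≫ fst G G) := by rw [lift_fst]; infer_instance
      exact mono_of_mono _ (fst G G)
    · rw [comp_mul, GrpObj.comp_inv, inv_mul_eq_one]
      constructor
      · rintro ⟨c, rfl⟩
        simp
      · intro h
        refine ⟨x ≫ fst _ _, ?_⟩
        ext1
        · simp
        · simpa using h
  have hp' := hp.map (Over.forget _)
  have : IsClosedImmersion (lift (𝟙 G) (𝟙 G)).left :=
    MorphismProperty.of_isPullback hp'.flip (inferInstanceAs (IsClosedImmersion η[G].left))
  refine ⟨?_⟩
  have h : pullback.diagonal G.hom = (lift (𝟙 G) (𝟙 G)).left := by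
    refine pullback.hom_ext ?_ ?_
    · rw [pullback.diagonal_fst]
      exact congrArg Over.Hom.left (lift_fst (𝟙 G) (𝟙 G)).symm
    · rw [pullback.diagonal_snd]
      exact congrArg Over.Hom.left (lift_snd (𝟙 G) (𝟙 G)).symm
  rw [h]
  exact this

lemma isPullback_tensor_left (X Y : Over (Spec (.of k))) :
    IsPullback (fst X Y).left (snd X Y).left X.hom Y.hom :=
  IsPullback.of_hasPullback X.hom Y.hom

/-- A split torus receives a morphism from the spectrum of a localization of a polynomial ring
which every point with values in a field factors through. -/
lemma IsSplitTorus.exists_affine_cover {T : Over (Spec (.of k))} [GrpObj T] (hT : IsSplitTorus T) :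
    ∃ (R : Type u) (_ : CommRing R) (_ : Algebra k R)
      (x : Over.mk (Spec.map (CommRingCat.ofHom (algebraMap k R))) ⟶ T),
      ∀ (κ : Type u) [Field κ] [Algebra k κ]
        (t : Over.mk (Spec.map (CommRingCat.ofHom (algebraMap k κ))) ⟶ T), ∃ f, f ≫ x = t := by
  obtain ⟨n, e, he⟩ := hT
  let P := MvPolynomial (Fin n) k
  let m : P := ∏ a, MvPolynomial.X a
  let R := Localization.Away m
  have hX (a : Fin n) : IsUnit (algebraMap P R (MvPolynomial.X a)) :=
    isUnit_of_dvd_unit (map_dvd _ (Finset.dvd_prod_of_mem _ (Finset.mem_univ a)))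
      (IsLocalization.Away.algebraMap_isUnit (S := R) m)
  refine ⟨R, inferInstance, inferInstance, (e _).symm fun a ↦
    Units.map (Scheme.ΓSpecIso (.of R)).inv.hom.toMonoidHom (hX a).unit, fun κ _ _ t ↦ ?_⟩
  let v (a : Fin n) : κˣ := Units.map (Scheme.ΓSpecIso (.of κ)).hom.hom.toMonoidHom (e _ t a)
  let ψ₀ : P →ₐ[k] κ := MvPolynomial.aeval fun a ↦ (v a : κ)
  have hv (a : Fin n) : ψ₀ (MvPolynomial.X a) = v a := MvPolynomial.aeval_X _ _
  have hψ₀ : IsUnit (ψ₀ m) := by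
    simp only [m, map_prod, hv]
    exact IsUnit.prod_univ_iff.2 fun a ↦ (v a).isUnit
  let ψ : R →+* κ := IsLocalization.Away.lift m (g := ψ₀.toRingHom) hψ₀
  have hψ : ψ.comp (algebraMap k R) = algebraMap k κ := by
    rw [IsScalarTower.algebraMap_eq k P R, ← RingHom.comp_assoc, IsLocalization.Away.lift_comp]
    exact ψ₀.comp_algebraMap
  have hψX (a : Fin n) : ψ (algebraMap P R (MvPolynomial.X a)) = v a :=
    (IsLocalization.Away.lift_eq m (g := ψ₀.toRingHom) hψ₀ _).trans (hv a)
  refine ⟨Over.homMk (Spec.map (CommRingCat.ofHom ψ)) ?_, ?_⟩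
  · simp only [Over.mk_left, Over.mk_hom]
    rw [← Spec.map_comp, ← CommRingCat.ofHom_comp, hψ]
  · apply (e _).injective
    rw [he]
    ext a
    rw [MulEquiv.apply_symm_apply]
    have := ConcreteCategory.congr_hom (Scheme.ΓSpecIso_inv_naturality (CommRingCat.ofHom ψ))
      (algebraMap P R (MvPolynomial.X a))
    refine this.symm.trans ?_
    rw [CommRingCat.comp_apply]
    refine (congrArg (Scheme.ΓSpecIso (.of κ)).inv.hom (hψX a)).trans ?_
    exact (Scheme.ΓSpecIso (.of κ)).commRingCatIsoToRingEquiv.symm_apply_apply _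

lemma IsSplitTorus.compactSpace {T : Over (Spec (.of k))} [GrpObj T] (hT : IsSplitTorus T) :
    CompactSpace T.left := by
  obtain ⟨R, _, _, x, hx⟩ := hT.exists_affine_cover
  suffices Surjective x.left from
    have : CompactSpace (Over.mk (Spec.map (CommRingCat.ofHom (algebraMap k R)))).left :=
      inferInstanceAs (CompactSpace (Spec (.of R)))
    x.left.surjective.compactSpace x.left.continuous
  refine ⟨fun t ↦ ?_⟩
  let κ : Type u := T.left.residueField t
  let : Field κ := inferInstanceAs (Field (T.left.residueField t))
  let i : Spec (.of κ) ⟶ T.left := T.left.fromSpecResidueField t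
  obtain ⟨φ, hφ⟩ := Spec.map_surjective (i ≫ T.hom)
  let := φ.hom.toAlgebra
  obtain ⟨f, hf⟩ := hx κ (Over.homMk i hφ.symm)
  refine ⟨f.left (IsLocalRing.closedPoint κ), ?_⟩
  exact (congrArg (fun g ↦ g.left (IsLocalRing.closedPoint κ)) hf).trans
    (Scheme.fromSpecResidueField_apply _ _)

lemma IsTorus.compactSpace {T : Over (Spec (.of k))} [GrpObj T] (hT : IsTorus T) :
    CompactSpace T.left := by
  have : CompactSpace (pullback T.hom
      (Spec.map (CommRingCat.ofHom (algebraMap k (AlgebraicClosure k)))) :) :=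
    IsSplitTorus.compactSpace hT
  let f := pullback.fst T.hom (Spec.map (CommRingCat.ofHom (algebraMap k (AlgebraicClosure k))))
  have : Surjective f := inferInstance
  exact f.surjective.compactSpace f.continuous

lemma compactSpace_tensor (X Y : Over (Spec (.of k))) [CompactSpace X.left] [CompactSpace Y.left] :
    CompactSpace (X ⊗ Y).left := by
  have : QuasiCompact Y.hom := (quasiCompact_iff_compactSpace _).2 ‹_›
  have : QuasiCompact (fst X Y).left :=
    MorphismProperty.of_isPullback (isPullback_tensor_left X Y).flip this
  exact QuasiCompact.compactSpace_of_compactSpace (fst X Y).left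

/-- An extension of quasi-compact group schemes is quasi-compact: if the quasi-compact open
subscheme `U` of `G` surjects onto `Q`, then `U × H` surjects onto `G`. -/
lemma IsQuotient.compactSpace {H G Q : Over (Spec (.of k))} [GrpObj G] [GrpObj Q]
    {j : H ⟶ G} {π : G ⟶ Q} (h : IsQuotient j π) [CompactSpace H.left] [CompactSpace Q.left] :
    CompactSpace G.left := by
  have := h.isMonHom
  have := h.flat
  have := h.surjective
  have := h.locallyOfFinitePresentation
  obtain ⟨U, hU, hUs⟩ : ∃ U : G.left.Opens, IsCompact (U : Set G.left) ∧
      π.left '' U = Set.univ := by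
    obtain ⟨s, hs⟩ := isCompact_univ.elim_finite_subcover
      (fun V : G.left.affineOpens ↦ π.left '' V.1)
      (fun V ↦ π.left.isOpenMap _ V.1.2) (fun q _ ↦ by
        obtain ⟨g, rfl⟩ := π.left.surjective q
        obtain ⟨V, hV, hgV, -⟩ := TopologicalSpace.Opens.isBasis_iff_nbhd.1
            G.left.isBasis_affineOpens
          (TopologicalSpace.Opens.mem_top g)
        exact Set.mem_iUnion.2 ⟨⟨V, hV⟩, g, hgV, rfl⟩)
    refine ⟨⨆ V ∈ s, V.1, ?_, ?_⟩
    · simp only [TopologicalSpace.Opens.coe_iSup]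
      exact s.isCompact_biUnion fun V _ ↦ V.2.isCompact
    · refine Set.eq_univ_of_univ_subset (hs.trans ?_)
      simp only [TopologicalSpace.Opens.coe_iSup, Set.image_iUnion]
      exact subset_rfl
  let U' : Over (Spec (.of k)) := Over.mk (U.ι ≫ G.hom)
  have : CompactSpace U'.left := isCompact_iff_compactSpace.1 hU
  let a : U' ⟶ G := Over.homMk U.ι
  let m : U' ⊗ H ⟶ G := (fst U' H ≫ a) * (snd U' H ≫ j)
  have := compactSpace_tensor U' H
  suffices Function.Surjective m.left from this.compactSpace m.left.continuous
  intro z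
  obtain ⟨u, hu, huz⟩ := hUs.ge (Set.mem_univ (π.left z))
  obtain ⟨w, hw1, hw2⟩ := Scheme.Pullback.exists_preimage_pullback (f := U.ι ≫ π.left)
    (g := π.left) (⟨u, hu⟩ : U) z huz
  let P : Over (Spec (.of k)) := Over.mk (pullback.snd (U.ι ≫ π.left) π.left ≫ G.hom)
  let p₁ : P ⟶ U' := Over.homMk (pullback.fst (U.ι ≫ π.left) π.left) (by
    have := pullback.condition (f := U.ι ≫ π.left) (g := π.left) =≫ Q.hom
    simpa [P, U'] using this)
  let p₂ : P ⟶ G := Over.homMk (pullback.snd (U.ι ≫ π.left) π.left)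
  have hp : (p₁ ≫ a) ≫ π = p₂ ≫ π := by
    ext1
    simpa [p₁, p₂, a] using pullback.condition (f := U.ι ≫ π.left) (g := π.left)
  obtain ⟨c, hc⟩ := (((isPullback_one_iff j π).1 h.isKernel).2 P ((p₁ ≫ a)⁻¹ * p₂)).2 (by
    rw [mul_comp, GrpObj.inv_comp, hp, inv_mul_cancel])
  have hm : lift p₁ c ≫ m = p₂ := by
    rw [comp_mul, lift_fst_assoc, lift_snd_assoc, hc, mul_inv_cancel_left]
  exact ⟨(lift p₁ c).left w, (congrArg (fun g ↦ g.left w) hm).trans hw2⟩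

variable (G : Over (Spec (.of k))) [GrpObj G] [hG : IsSemiabelian G]

/-- The definition of a torus only mentions isomorphisms of groups of points, so the
quasi-compactness of tori, and from it that of semiabelian varieties, requires an argument. -/
lemma IsSemiabelian.compactSpace : CompactSpace G.left := by
  obtain ⟨T, A, _, _, j, π, hT, hA, hj, hπ⟩ := hG.exists_extension
  have := hT.compactSpace
  have := hA.isProper
  have : CompactSpace A.left := QuasiCompact.compactSpace_of_compactSpace A.hom
  exact hπ.compactSpace

lemma IsSemiabelian.locallyOfFiniteType : LocallyOfFiniteType G.hom := by
  obtain ⟨T, A, _, _, j, π, hT, hA, hj, hπ⟩ := hG.exists_extension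
  have := hA.isProper
  have := hπ.locallyOfFinitePresentation
  rw [← Over.w π]
  infer_instance

end

/-! ### Reducedness over perfect fields -/

/-- The tensor product of two reduced algebras over a perfect field of characteristic `p` is
reduced: if `f = ∑ aᵢ ⊗ bᵢ` for a basis `bᵢ`, then the `bᵢᵖ` are again linearly independent, so that
`fᵖ = ∑ aᵢᵖ ⊗ bᵢᵖ = 0` forces `aᵢᵖ = 0`. -/
lemma isReduced_tensorProduct (p : ℕ) [hp : Fact p.Prime] (k A B : Type*) [Field k] [CharP k p]
    [PerfectRing k p] [CommRing A] [CommRing B] [Algebra k A] [Algebra k B] [IsReduced A]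
    [IsReduced B] : IsReduced (A ⊗[k] B) := by
  rcases subsingleton_or_nontrivial (A ⊗[k] B) with hs | hs
  · exact ⟨fun x _ ↦ Subsingleton.elim _ _⟩
  have := hp.out.one_lt
  have : Nontrivial B := by
    by_contra h
    rw [not_nontrivial_iff_subsingleton] at h
    exact false_of_nontrivial_of_subsingleton (A ⊗[k] B)
  have : CharP (A ⊗[k] B) p := charP_of_injective_algebraMap (algebraMap k _).injective p
  have : CharP B p := charP_of_injective_algebraMap (algebraMap k B).injective p
  rw [isReduced_iff_pow_one_lt p hp.out.one_lt]
  intro f hf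
  let b := Module.Free.chooseBasis k B
  have hb : LinearIndependent k fun i ↦ b i ^ p := by
    rw [linearIndependent_iff']
    intro s g hg i hi
    choose d hd using fun i ↦ surjective_frobenius k p (g i)
    have h : (∑ i ∈ s, d i • b i) ^ p = 0 := by
      rw [sum_pow_char p, ← hg]
      refine Finset.sum_congr rfl fun j _ ↦ ?_
      rw [smul_pow, ← hd j, frobenius_def]
    have := linearIndependent_iff'.1 b.linearIndependent s d (pow_eq_zero_iff hp.out.ne_zero |>.1
        h) i hi
    rw [← hd i, this, map_zero]
  have hb' := Module.Flat.linearIndependent_one_tmul (S := A) hb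
  let c := Algebra.TensorProduct.basis A b
  have hc : f = ∑ i ∈ (c.repr f).support, c.repr f i • c i := (c.linearCombination_repr f).symm
  have h0 : ∑ i ∈ (c.repr f).support, (c.repr f i) ^ p • ((1 : A) ⊗ₜ[k] (b i ^ p)) = 0 := by
    rw [← hf]
    conv_rhs => rw [hc]
    rw [sum_pow_char p]
    refine Finset.sum_congr rfl fun j _ ↦ ?_
    rw [smul_pow, Algebra.TensorProduct.basis_apply, Algebra.TensorProduct.tmul_pow, one_pow]
  have h1 := linearIndependent_iff'.1 hb' _ _ h0
  rw [hc]
  refine Finset.sum_eq_zero fun i hi ↦ ?_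
  rw [(pow_eq_zero_iff hp.out.ne_zero).1 (h1 i hi), zero_smul]

/-- Base change along an extension of a perfect field of characteristic `p` preserves
reducedness. -/
lemma isReduced_baseChange (p : ℕ) [Fact p.Prime] {k K : Type u} [Field k] [Field K] [Algebra k K]
    [CharP k p] [PerfectRing k p] (X : Over (Spec (.of k))) [IsReduced X.left] :
    IsReduced ((baseChange k K).obj X).left := by
  have h (R : CommRingCat.{u}) (j : Spec R ⟶ X.left) [IsOpenImmersion j] :
      IsReduced (pullback (j ≫ X.hom) (Spec.map (CommRingCat.ofHom (algebraMap k K)))) := by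
    obtain ⟨φ, hφ⟩ := Spec.map_surjective (j ≫ X.hom)
    have : _root_.IsReduced R := (affine_isReduced_iff R).1 (isReduced_of_isOpenImmersion j)
    let := φ.hom.toAlgebra
    have := isReduced_tensorProduct p k R K
    have h := (affine_isReduced_iff (.of (R ⊗[k] K))).2 this
    rw [← hφ]
    exact isReduced_of_isOpenImmersion (pullbackSpecIso k R K).hom
  let 𝒱 := Scheme.Pullback.openCoverOfLeft X.left.affineCover X.hom
    (Spec.map (CommRingCat.ofHom (algebraMap k K)))
  have (i : 𝒱.I₀) : IsReduced (𝒱.X i) := by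
    have hi : IsOpenImmersion (X.left.affineCover.f i) := X.left.affineCover.map_prop i
    exact @h _ (X.left.affineCover.f i) hi
  exact IsReduced.of_openCover (X := pullback _ _) 𝒱

/-! ### Base change of the reduced stabilizer and of the quotient by it -/

section

variable {k : Type u} [Field k]

/-- A point `b` stabilizes `Y` if and only if translation by `b` and translation by `b⁻¹` map
points of `Y` to points of `Y`. -/
lemma stabilizes_iff {G Y S : Over (Spec (.of k))} [GrpObj G] (i : Y ⟶ G) [Mono i] (b : S ⟶ G) :
    Stabilizes i b ↔ ∀ (T : Over (Spec (.of k))) (t : T ⟶ S) (y : T ⟶ Y),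
      (∃ c, c ≫ i = (t ≫ b) * (y ≫ i)) ∧ ∃ c, c ≫ i = (t ≫ b)⁻¹ * (y ≫ i) := by
  constructor
  · rintro ⟨e, he⟩ T t y
    constructor
    · refine ⟨lift y t ≫ e.hom ≫ fst _ _, ?_⟩
      have := congr(lift y t ≫ $he ≫ fst _ _)
      simpa [translation, comp_mul] using this.symm
    · refine ⟨lift y t ≫ e.inv ≫ fst _ _, ?_⟩
      have h1 : e.inv ≫ (i ▷ S) ≫ translation b = i ▷ S := by rw [he, e.inv_hom_id_assoc]
      have h2 := congr(lift y t ≫ $h1 ≫ fst _ _)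
      have h3 := congr(lift y t ≫ $h1 ≫ snd _ _)
      simp [translation, comp_mul] at h2 h3
      have h4 : lift y t ≫ e.inv ≫ snd Y S ≫ b = t ≫ b := by simpa using congr($h3 ≫ b)
      rw [eq_inv_mul_iff_mul_eq, ← h2, h4]
      simp
  · intro h
    obtain ⟨⟨c, hc⟩, -⟩ := h (Y ⊗ S) (snd _ _) (fst _ _)
    obtain ⟨-, ⟨d, hd⟩⟩ := h (Y ⊗ S) (snd _ _) (fst _ _)
    refine ⟨⟨lift c (snd _ _), lift d (snd _ _), ?_, ?_⟩, ?_⟩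
    · ext1
      · rw [← cancel_mono i]
        simp [hd, hc, comp_mul, GrpObj.comp_inv]
      · simp
    · ext1
      · rw [← cancel_mono i]
        simp [hd, hc, comp_mul]
      · simp
    · ext1
      · simp [translation, hc, comp_mul]
      · simp [translation]

variable {K : Type u} [Field K] [Algebra k K]

lemma stabilizes_baseChange_iff {G Y : Over (Spec (.of k))} [GrpObj G] (i : Y ⟶ G) [Mono i]
    {S : Over (Spec (.of K))} (b : (restrictScalars k K).obj S ⟶ G) :
    Stabilizes ((baseChange k K).map i) (pointsEquiv S G b) ↔ Stabilizes i b := by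
  rw [stabilizes_iff, stabilizes_iff]
  have key {T : Over (Spec (.of K))} (t : T ⟶ S) (y : (restrictScalars k K).obj T ⟶ Y) :
      ((∃ c, c ≫ (baseChange k K).map i = (t ≫ pointsEquiv S G b) *
          ((Over.mapPullbackAdj _).homEquiv T Y y ≫ (baseChange k K).map i)) ∧
        ∃ c, c ≫ (baseChange k K).map i = (t ≫ pointsEquiv S G b)⁻¹ *
          ((Over.mapPullbackAdj _).homEquiv T Y y ≫ (baseChange k K).map i)) ↔
      ((∃ c, c ≫ i = ((restrictScalars k K).map t ≫ b) * (y ≫ i)) ∧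
        ∃ c, c ≫ i = ((restrictScalars k K).map t ≫ b)⁻¹ * (y ≫ i)) := by
    have h : (Over.mapPullbackAdj _).homEquiv T Y y ≫ (baseChange k K).map i =
        pointsEquiv T G (y ≫ i) := ((Over.mapPullbackAdj _).homEquiv_naturality_right _ _).symm
    rw [h, ← pointsEquiv_comp, ← map_mul, ← map_inv, ← map_mul]
    exact and_congr (exists_comp_baseChange_map_iff i _) (exists_comp_baseChange_map_iff i _)
  constructor
  · intro h T t y
    -- a scheme over `S` is defined over `K`
    let T' : Over (Spec (.of K)) := Over.mk (t.left ≫ S.hom)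
    let t' : T' ⟶ S := Over.homMk t.left
    let e : (restrictScalars k K).obj T' ≅ T := Over.isoMk (Iso.refl _) (by
      have := Over.w t
      simp only [Over.map_obj_hom] at this
      simpa [T'] using this.symm)
    have he : (restrictScalars k K).map t' = e.hom ≫ t := by
      ext1
      simp [t', e]
    obtain ⟨⟨c, hc⟩, d, hd⟩ := (key t' (e.hom ≫ y)).1 (h _ t' _)
    refine ⟨⟨e.inv ≫ c, ?_⟩, e.inv ≫ d, ?_⟩
    · rw [Category.assoc, hc, he, comp_mul]
      simp
    · rw [Category.assoc, hd, he, comp_mul, GrpObj.comp_inv]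
      simp
  · intro h T t y
    obtain ⟨y, rfl⟩ := ((Over.mapPullbackAdj _).homEquiv T Y).surjective y
    exact (key t y).2 (h _ _ _)

lemma mono_of_isClosedImmersion_left {X Y : Over (Spec (.of k))} (f : X ⟶ Y)
    [IsClosedImmersion f.left] : Mono f :=
  Over.mono_of_mono_left f

lemma isClosedImmersion_baseChange_map {X Y : Over (Spec (.of k))} (f : X ⟶ Y)
    [IsClosedImmersion f.left] : IsClosedImmersion ((baseChange k K).map f).left :=
  MorphismProperty.of_isPullback (isPullback_baseChange_map_left f).flip ‹_›

/-- The formation of the stabilizer commutes with base change. -/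
lemma IsStabilizer.baseChange {G Y St : Over (Spec (.of k))} [GrpObj G] {i : Y ⟶ G} [Mono i]
    {s : St ⟶ G} (h : IsStabilizer i s) :
    IsStabilizer ((MordellLang.baseChange k K).map i) ((MordellLang.baseChange k K).map s) := by
  have := h.isClosedImmersion
  refine ⟨isClosedImmersion_baseChange_map s, fun S b ↦ ?_⟩
  obtain ⟨b, rfl⟩ := (pointsEquiv S G).surjective b
  rw [stabilizes_baseChange_iff, ← h.factors_iff]
  exact exists_comp_baseChange_map_iff s b

/-- This fails over imperfect fields, where reduced schemes need not be geometrically reduced. -/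
lemma IsReduction.baseChange (p : ℕ) [Fact p.Prime] [CharP k p] [PerfectRing k p]
    {C X : Over (Spec (.of k))} {r : C ⟶ X} (h : IsReduction r) :
    IsReduction ((MordellLang.baseChange k K).map r) := by
  have := h.isClosedImmersion
  have := h.surjective
  have := h.isReduced
  exact ⟨isClosedImmersion_baseChange_map r,
    MorphismProperty.of_isPullback (isPullback_baseChange_map_left r).flip ‹_›,
    isReduced_baseChange p C⟩

/-- The quotient by the reduced stabilizer commutes with base change from a perfect field. -/
lemma IsQuotientByStabilizer.baseChange (p : ℕ) [Fact p.Prime] [CharP k p] [PerfectRing k p]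
    {G Y Q : Over (Spec (.of k))} [GrpObj G] [GrpObj Q] {i : Y ⟶ G} [Mono i] {π : G ⟶ Q}
    (h : IsQuotientByStabilizer i π) :
    IsQuotientByStabilizer ((MordellLang.baseChange k K).map i)
      ((MordellLang.baseChange k K).map π) := by
  obtain ⟨St, C, s, r, hs, hr, hq⟩ := h
  refine ⟨_, _, _, _, hs.baseChange, hr.baseChange p, ?_⟩
  rw [← Functor.map_comp]
  exact hq.baseChange

/-- A quotient `G ⟶ Q` by `H` is universal: a homomorphism with kernel `H` factors through it,
because a faithfully flat morphism locally of finite presentation is an effective epimorphism. -/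
lemma IsQuotient.exists_desc {H G Q Q' : Over (Spec (.of k))} [GrpObj G] [GrpObj Q] [GrpObj Q']
    {j : H ⟶ G} {π : G ⟶ Q} {π' : G ⟶ Q'} (h : IsQuotient j π) (h' : IsQuotient j π') :
    ∃ θ : Q ⟶ Q', π ≫ θ = π' := by
  have := h.isMonHom
  have := h'.isMonHom
  have := h.flat
  have := h.surjective
  have := h.locallyOfFinitePresentation
  have hk := ((isPullback_one_iff j π).1 h.isKernel).2
  have hk' := ((isPullback_one_iff j π').1 h'.isKernel).2
  have hE : EffectiveEpi π.left := inferInstance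
  have hd {Z : Scheme.{u}} (g₁ g₂ : Z ⟶ G.left) (hg : g₁ ≫ π.left = g₂ ≫ π.left) :
      g₁ ≫ π'.left = g₂ ≫ π'.left := by
    let P : Over (Spec (.of k)) := Over.mk (g₁ ≫ G.hom)
    let p₁ : P ⟶ G := Over.homMk g₁
    let p₂ : P ⟶ G := Over.homMk g₂ (by
      rw [← Over.w π, reassoc_of% hg.symm, Over.w π]; rfl)
    have hp : p₁ ≫ π = p₂ ≫ π := by
      ext1
      simpa [p₁, p₂] using hg
    have h1 : (p₁⁻¹ * p₂) ≫ π' = 1 := by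
      rw [← hk', hk, mul_comp, GrpObj.inv_comp, hp, inv_mul_cancel]
    rw [mul_comp, GrpObj.inv_comp, inv_mul_eq_one] at h1
    simpa [p₁, p₂] using congr(($h1).left)
  refine ⟨Over.homMk (EffectiveEpi.desc π.left π'.left hd) ?_, ?_⟩
  · rw [← cancel_epi π.left, EffectiveEpi.fac_assoc, Over.w, Over.w]
  · ext1
    exact EffectiveEpi.fac π.left π'.left hd

lemma IsQuotient.epi {H G Q : Over (Spec (.of k))} [GrpObj G] [GrpObj Q]
    {j : H ⟶ G} {π : G ⟶ Q} (h : IsQuotient j π) : Epi π := by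
  have := h.flat
  have := h.surjective
  have := h.locallyOfFinitePresentation
  have : Epi π.left := inferInstance
  exact Over.epi_of_epi_left π

/-- A point of the quotient lifts to a point of the group after a faithfully flat base change. -/
lemma IsQuotient.exists_lift {H G Q S : Over (Spec (.of k))} [GrpObj G] [GrpObj Q]
    {j : H ⟶ G} {π : G ⟶ Q} (h : IsQuotient j π) (x : S ⟶ Q) :
    ∃ (S' : Over (Spec (.of k))) (e : S' ⟶ S) (_ : Epi e) (x' : S' ⟶ G), x' ≫ π = e ≫ x := by
  have := h.flat
  have := h.surjective
  have := h.locallyOfFinitePresentation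
  let e : Over.mk (pullback.fst x.left π.left ≫ S.hom) ⟶ S := Over.homMk
      (pullback.fst x.left π.left)
  have he : Epi e.left := inferInstanceAs (Epi (pullback.fst x.left π.left))
  refine ⟨_, e, Over.epi_of_epi_left e, Over.homMk (pullback.snd x.left π.left) ?_, ?_⟩
  · have := pullback.condition (f := x.left) (g := π.left) =≫ Q.hom
    simpa using this.symm
  · ext1
    simpa [e] using pullback.condition.symm

/-- Two quotients of a group scheme by the same subgroup scheme are isomorphic. -/
lemma IsQuotient.exists_iso {H G Q Q' : Over (Spec (.of k))} [GrpObj G] [GrpObj Q] [GrpObj Q']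
    {j : H ⟶ G} {π : G ⟶ Q} {π' : G ⟶ Q'} (h : IsQuotient j π) (h' : IsQuotient j π') :
    ∃ θ : Q ≅ Q', π ≫ θ.hom = π' ∧ IsMonHom θ.hom := by
  obtain ⟨θ, hθ⟩ := h.exists_desc h'
  obtain ⟨θ', hθ'⟩ := h'.exists_desc h
  have := h.isMonHom
  have := h'.isMonHom
  have := h.epi
  have := h'.epi
  refine ⟨⟨θ, θ', ?_, ?_⟩, hθ, isMonHom_of_points _ fun S x y ↦ ?_⟩
  · rw [← cancel_epi π, reassoc_of% hθ, hθ', Category.comp_id]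
  · rw [← cancel_epi π', reassoc_of% hθ', hθ, Category.comp_id]
  · obtain ⟨S₁, e₁, _, x₁, hx₁⟩ := h.exists_lift x
    obtain ⟨S₂, e₂, _, y₂, hy₂⟩ := h.exists_lift (e₁ ≫ y)
    have hx₂ : (e₂ ≫ x₁) ≫ π = e₂ ≫ e₁ ≫ x := by rw [Category.assoc, hx₁]
    rw [← cancel_epi e₁, ← cancel_epi e₂]
    simp only [comp_mul, ← Category.assoc] at hx₂ hy₂ ⊢
    rw [← hx₂, ← hy₂, ← mul_comp, Category.assoc, Category.assoc _ π, Category.assoc _ π, hθ,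
        mul_comp]

/-- Closed subschemes that represent the same functor are isomorphic over the ambient scheme. -/
lemma IsStabilizer.exists_iso {G Y St St' : Over (Spec (.of k))} [GrpObj G] {i : Y ⟶ G}
    {s : St ⟶ G} {s' : St' ⟶ G} (h : IsStabilizer i s) (h' : IsStabilizer i s') :
    ∃ e : St ≅ St', e.hom ≫ s' = s := by
  have := h.isClosedImmersion
  have := h'.isClosedImmersion
  have := mono_of_isClosedImmersion_left s
  have := mono_of_isClosedImmersion_left s'
  obtain ⟨a, ha⟩ := (h'.factors_iff St s).2 ((h.factors_iff St s).1 ⟨𝟙 _, Category.id_comp _⟩)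
  obtain ⟨b, hb⟩ := (h.factors_iff St' s').2 ((h'.factors_iff St' s').1 ⟨𝟙 _, Category.id_comp _⟩)
  refine ⟨⟨a, b, ?_, ?_⟩, ha⟩
  · rw [← cancel_mono s, Category.assoc, hb, ha, Category.id_comp]
  · rw [← cancel_mono s', Category.assoc, ha, hb, Category.id_comp]

/-- The scheme-theoretic image of a reduced scheme is reduced, hence determined by its support. -/
lemma ker_eq_vanishingIdeal {X Z : Scheme.{u}} (f : X ⟶ Z) [QuasiCompact f] [IsReduced X] :
    f.ker = .vanishingIdeal f.ker.support := by
  rw [Scheme.IdealSheafData.vanishingIdeal_support]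
  refine le_antisymm (Scheme.IdealSheafData.le_radical _) fun U x hx ↦ ?_
  obtain ⟨n, hn⟩ := hx
  rw [Scheme.Hom.ker_apply, RingHom.mem_ker, map_pow] at hn
  rw [Scheme.Hom.ker_apply, RingHom.mem_ker]
  exact eq_zero_of_pow_eq_zero hn

lemma ker_le_ker_of_isReduced {C X Z : Scheme.{u}} (c : C ⟶ X) [QuasiCompact c]
    (f : Z ⟶ X) [QuasiCompact f] [IsReduced Z] (h : Set.range f ⊆ closure (Set.range c)) :
    c.ker ≤ f.ker := by
  rw [ker_eq_vanishingIdeal f, ← Scheme.IdealSheafData.le_support_iff_le_vanishingIdeal]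
  rw [← SetLike.coe_subset_coe, Scheme.Hom.support_ker, Scheme.Hom.support_ker]
  exact closure_minimal h isClosed_closure

/-- A morphism from a reduced scheme factors through a closed subscheme that contains its image. -/
lemma exists_lift_of_isReduced {C X Z : Over (Spec (.of k))} (c : C ⟶ X) [IsClosedImmersion c.left]
    (f : Z ⟶ X) [QuasiCompact f.left] [IsReduced Z.left]
    (h : Set.range f.left ⊆ closure (Set.range c.left)) :
    ∃ g : Z ⟶ C, g ≫ c = f := by
  have hl := IsClosedImmersion.lift_fac c.left f.left (ker_le_ker_of_isReduced _ _ h)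
  refine ⟨Over.homMk (IsClosedImmersion.lift c.left f.left (ker_le_ker_of_isReduced _ _ h)) ?_, ?_⟩
  · rw [← Over.w c, reassoc_of% hl, Over.w]
  · ext1
    exact hl

lemma IsReduction.exists_iso {C C' X : Over (Spec (.of k))} {r : C ⟶ X} {r' : C' ⟶ X}
    (h : IsReduction r) (h' : IsReduction r') : ∃ e : C ≅ C', e.hom ≫ r' = r := by
  have := h.isClosedImmersion
  have := h'.isClosedImmersion
  have := h.isReduced
  have := h'.isReduced
  have := mono_of_isClosedImmersion_left r
  have := mono_of_isClosedImmersion_left r'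
  obtain ⟨a, ha⟩ := exists_lift_of_isReduced r' r (by simp [h'.surjective.1.range_eq])
  obtain ⟨b, hb⟩ := exists_lift_of_isReduced r r' (by simp [h.surjective.1.range_eq])
  refine ⟨⟨a, b, ?_, ?_⟩, ha⟩
  · rw [← cancel_mono r, Category.assoc, hb, ha, Category.id_comp]
  · rw [← cancel_mono r', Category.assoc, ha, hb, Category.id_comp]

lemma IsQuotient.of_iso {H H' G Q : Over (Spec (.of k))} [GrpObj G] [GrpObj Q]
    {j : H ⟶ G} {j' : H' ⟶ G} {π : G ⟶ Q} (h : IsQuotient j π) (e : H' ≅ H)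
    (he : e.hom ≫ j = j') : IsQuotient j' π where
  isMonHom := h.isMonHom
  flat := h.flat
  surjective := h.surjective
  locallyOfFinitePresentation := h.locallyOfFinitePresentation
  isKernel := h.isKernel.of_iso e.symm (Iso.refl _) (Iso.refl _) (Iso.refl _) (by simp [← he])
    (toUnit_unique _ _) (by simp) (by simp)

/-- The quotient by the reduced stabilizer is unique up to isomorphism. -/
lemma IsQuotientByStabilizer.exists_iso {G Y Q Q' : Over (Spec (.of k))} [GrpObj G] [GrpObj Q]
    [GrpObj Q'] {i : Y ⟶ G} {π : G ⟶ Q} {π' : G ⟶ Q'} (h : IsQuotientByStabilizer i π)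
    (h' : IsQuotientByStabilizer i π') : ∃ θ : Q ≅ Q', π ≫ θ.hom = π' ∧ IsMonHom θ.hom := by
  obtain ⟨St, C, s, r, hs, hr, hq⟩ := h
  obtain ⟨St', C', s', r', hs', hr', hq'⟩ := h'
  obtain ⟨e, he⟩ := hs.exists_iso hs'
  have : IsReduction (r ≫ e.hom) := by
    have := hr.isClosedImmersion
    have := hr.surjective
    have he' : IsIso e.hom.left := inferInstanceAs (IsIso ((Over.forget _).map e.hom))
    refine ⟨?_, ?_, hr.isReduced⟩
    · rw [Over.comp_left]
      infer_instance
    · rw [Over.comp_left]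
      infer_instance
  obtain ⟨d, hd⟩ := this.exists_iso hr'
  refine hq.exists_iso (hq'.of_iso d ?_)
  rw [reassoc_of% hd, he]

end

/-! ### Homomorphisms with finite kernel and translations -/

section

variable {k K : Type u} [Field k] [Field K] [Algebra k K]

/-- Having a finite kernel can be tested on any model `H` of the kernel, as a scheme over `k`. -/
lemma hasFiniteKernel_iff {H G Q : Over (Spec (.of k))} [GrpObj Q] {j : H ⟶ G} {f : G ⟶ Q}
    (h : IsPullback j (toUnit H) f η[Q]) : HasFiniteKernel f ↔ IsFinite H.hom := by
  have h' : IsPullback j.left (toUnit H).left f.left η[Q].left := h.map (Over.forget _)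
  have ht : (toUnit H).left = H.hom := by
    have := Over.w (toUnit H)
    exact (Category.comp_id _).symm.trans this
  unfold HasFiniteKernel
  rw [← ht, ← h'.isoPullback_hom_snd]
  have := MorphismProperty.IsStableUnderBaseChange.respectsIso
    (P := (@IsFinite : MorphismProperty Scheme.{u}))
  exact (MorphismProperty.cancel_left_of_respectsIso (P := (@IsFinite : MorphismProperty
      Scheme.{u}))
    _ _).symm

lemma exists_kernel {G Q : Over (Spec (.of k))} [GrpObj Q] (f : G ⟶ Q) :
    ∃ (H : Over (Spec (.of k))) (j : H ⟶ G), IsPullback j (toUnit H) f η[Q] := by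
  refine ⟨pullback f η[Q], pullback.fst _ _, ?_⟩
  rw [toUnit_unique (toUnit _) (pullback.snd f η[Q])]
  exact IsPullback.of_hasPullback _ _

lemma HasFiniteKernel.comp_iso {G G' Q : Over (Spec (.of k))} [GrpObj Q] {f : G ⟶ Q}
    (hf : HasFiniteKernel f) (e : G' ≅ G) : HasFiniteKernel (e.hom ≫ f) := by
  obtain ⟨H, j, h⟩ := exists_kernel f
  refine (hasFiniteKernel_iff (j := j ≫ e.inv) ?_).2 ((hasFiniteKernel_iff h).1 hf)
  exact h.of_iso (Iso.refl _) e.symm (Iso.refl _) (Iso.refl _) (by simp) (by simp) (by simp)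
      (by simp)

lemma HasFiniteKernel.iso_comp {G Q Q' : Over (Spec (.of k))} [GrpObj Q] [GrpObj Q'] {f : G ⟶ Q}
    (hf : HasFiniteKernel f) (e : Q ≅ Q') [IsMonHom e.hom] : HasFiniteKernel (f ≫ e.hom) := by
  obtain ⟨H, j, h⟩ := exists_kernel f
  refine (hasFiniteKernel_iff (j := j) ?_).2 ((hasFiniteKernel_iff h).1 hf)
  exact h.of_iso (Iso.refl _) (Iso.refl _) (Iso.refl _) e (by simp) (by simp) (by simp) (by simp)

lemma HasFiniteKernel.baseChange {G Q : Over (Spec (.of k))} [GrpObj G] [GrpObj Q] {f : G ⟶ Q}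
    (hf : HasFiniteKernel f) : HasFiniteKernel ((MordellLang.baseChange k K).map f) := by
  obtain ⟨H, j, h⟩ := exists_kernel f
  refine (hasFiniteKernel_iff (isPullback_one_baseChange h)).2 ?_
  exact MorphismProperty.of_isPullback (IsPullback.of_hasPullback H.hom
    (Spec.map (CommRingCat.ofHom (algebraMap k K)))) ((hasFiniteKernel_iff h).1 hf)

lemma translationBy_comp {G H : Over (Spec (.of k))} [GrpObj G] [GrpObj H]
    (b : 𝟙_ (Over (Spec (.of k))) ⟶ G) (f : G ⟶ H) [IsMonHom f] :
    translationBy b ≫ f = f ≫ translationBy (b ≫ f) := by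
  rw [translationBy, translationBy, mul_comp, comp_mul]
  simp

lemma comp_translationBy {S G : Over (Spec (.of k))} [GrpObj G] (x : S ⟶ G)
    (b : 𝟙_ (Over (Spec (.of k))) ⟶ G) : x ≫ translationBy b = (toUnit S ≫ b) * x := by
  rw [translationBy, comp_mul]
  simp

lemma baseChange_map_translationBy {G : Over (Spec (.of k))} [GrpObj G]
    (b : 𝟙_ (Over (Spec (.of k))) ⟶ G) :
    (baseChange k K).map (translationBy b) = translationBy (pointsBaseChange k K G b) := by
  have h : (baseChange k K).map (toUnit G) = toUnit _ ≫ Functor.LaxMonoidal.ε (baseChange k K) := by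
    rw [← cancel_mono (Functor.OplaxMonoidal.η (baseChange k K))]
    exact toUnit_unique _ _
  rw [translationBy, translationBy, Functor.map_mul, Functor.map_comp,
      CategoryTheory.Functor.map_id, h,
    Category.assoc]
  rfl

/-! ### Topology of the base change -/

lemma range_fst_of_isPullback {P X Y Z : Scheme.{u}} {a : P ⟶ X} {b : P ⟶ Y} {f : X ⟶ Z} {g : Y ⟶ Z}
    (h : IsPullback a b f g) : Set.range a = f ⁻¹' Set.range g := by
  rw [← Scheme.Pullback.range_fst f g, ← h.isoPullback_hom_fst, Scheme.Hom.comp_base,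
    TopCat.coe_comp, Set.range_comp, h.isoPullback.hom.surjective.range_eq, Set.image_univ]

lemma isOpenMap_baseChange_fst (X : Over (Spec (.of k))) :
    IsOpenMap (pullback.fst X.hom (Spec.map (CommRingCat.ofHom (algebraMap k K)))) :=
  Scheme.Hom.isOpenMap _

lemma range_baseChange_map {X Y : Over (Spec (.of k))} (f : X ⟶ Y) :
    Set.range ((baseChange k K).map f).left = pullback.fst Y.hom _ ⁻¹' Set.range f.left := by
  exact range_fst_of_isPullback (isPullback_baseChange_map_left (K := K) f)

lemma closure_range_baseChange_map {X Y : Over (Spec (.of k))} (f : X ⟶ Y) :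
    closure (Set.range ((baseChange k K).map f).left) =
      pullback.fst Y.hom _ ⁻¹' closure (Set.range f.left) := by
  rw [range_baseChange_map]
  exact ((isOpenMap_baseChange_fst Y).preimage_closure_eq_closure_preimage
    (Scheme.Hom.continuous _) _).symm

end

/-! ### The conclusion in terms of closed subsets -/

section

variable {K : Type u} [Field K]

/-- The set `Z` of points of the group scheme `Q` is the closure of a translate of the image of
`W_K`, for a homomorphism with finite kernel from `M_K` to `Q`, a semiabelian variety `M` over a
finite field `κ` mapping to `K` and an integral closed subscheme `W` of `M`. -/
def IsIsotrivial (Q : Over (Spec (.of K))) [GrpObj Q] (Z : Set Q.left) : Prop :=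
  ∃ (κ : Type u) (_ : Field κ) (_ : Finite κ) (_ : Algebra κ K) (M : Over (Spec (.of κ)))
    (_ : GrpObj M) (_ : IsSemiabelian M) (W : Over (Spec (.of κ))) (m : W ⟶ M)
    (h : (baseChange κ K).obj M ⟶ Q) (b : 𝟙_ (Over (Spec (.of K))) ⟶ Q),
    IsIntegral W.left ∧ IsClosedImmersion m.left ∧ IsMonHom h ∧ HasFiniteKernel h ∧
      closure (Set.range ((baseChange κ K).map m ≫ h ≫ translationBy b).left) = Z

lemma quasiCompact_left {X Q : Over (Spec (.of K))} [GrpObj Q] [CompactSpace X.left]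
    (f : X ⟶ Q) : QuasiCompact f.left := by
  have := isSeparated_of_grpObj Q
  have : QuasiCompact (f.left ≫ Q.hom) := by
    rw [Over.w]
    exact (quasiCompact_iff_compactSpace _).2 ‹_›
  exact QuasiCompact.of_comp f.left Q.hom

lemma compactSpace_of_isClosedImmersion {X Y : Over (Spec (.of K))} (f : X ⟶ Y)
    [IsClosedImmersion f.left] [CompactSpace Y.left] : CompactSpace X.left :=
  QuasiCompact.compactSpace_of_compactSpace f.left

/-- For reduced sources, scheme-theoretic images are equal if and only if their supports are. -/
lemma ker_eq_ker_iff {X X' Z : Scheme.{u}} (f : X ⟶ Z) (f' : X' ⟶ Z) [QuasiCompact f]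
    [QuasiCompact f'] [IsReduced X] [IsReduced X'] :
    f.ker = f'.ker ↔ closure (Set.range f) = closure (Set.range f') := by
  rw [← Scheme.Hom.support_ker, ← Scheme.Hom.support_ker, SetLike.coe_set_eq]
  refine ⟨fun h ↦ by rw [h], fun h ↦ ?_⟩
  rw [ker_eq_vanishingIdeal f, ker_eq_vanishingIdeal f', h]

lemma range_iso_comp_left {X X' Z : Over (Spec (.of K))} (e : X ≅ X') (f : X' ⟶ Z) :
    Set.range (e.hom ≫ f).left = Set.range f.left := by
  have : IsIso e.hom.left := inferInstanceAs (IsIso ((Over.forget _).map e.hom))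
  rw [Over.comp_left, Scheme.Hom.comp_base, TopCat.coe_comp, Set.range_comp,
    e.hom.left.surjective.range_eq, Set.image_univ]

lemma translationBy_image_eq {X Y Q : Over (Spec (.of K))} [GrpObj Q] (f : X ⟶ Q)
    (f' : Y ⟶ Q) (b : 𝟙_ (Over (Spec (.of K))) ⟶ Q) [CompactSpace X.left] [CompactSpace Y.left]
    [IsReduced X.left] [IsReduced Y.left] :
    schemeImage f = (schemeImage f').map (translationBy b).left ↔
      closure (Set.range (f' ≫ translationBy b).left) = closure (Set.range f.left) := by
  have := quasiCompact_left f
  have := quasiCompact_left f'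
  have := quasiCompact_left (f' ≫ translationBy b)
  rw [schemeImage, schemeImage, Scheme.IdealSheafData.map_ker, ← Over.comp_left,
    ker_eq_ker_iff, eq_comm]

/-- All schemes involved are reduced, so that the equality of scheme-theoretic images is an equality
of closed sets. The abstract finite field in `IsIsotrivial` is identified with its image in `K`. -/
lemma conclusion_iff (p : ℕ) [Fact p.Prime] [CharP K p] {B Y Q : Over (Spec (.of K))}
    [GrpObj B] [GrpObj Q] [IsSemiabelian B] [IsReduced Y.left] (i : Y ⟶ B)
    [IsClosedImmersion i.left] (π : B ⟶ Q) :
    Conclusion i π ↔ IsIsotrivial Q (closure (Set.range (i ≫ π).left)) := by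
  have := IsSemiabelian.compactSpace B
  have := compactSpace_of_isClosedImmersion i
  have hW {κ : Type u} [Field κ] [Finite κ] [Algebra κ K] {M W : Over (Spec (.of κ))} [GrpObj M]
      [IsSemiabelian M] (m : W ⟶ M) [IsIntegral W.left] [IsClosedImmersion m.left] :
      CompactSpace ((baseChange κ K).obj W).left ∧ IsReduced ((baseChange κ K).obj W).left := by
    have := IsSemiabelian.compactSpace ((baseChange κ K).obj M)
    have := isClosedImmersion_baseChange_map (K := K) m
    have : CharP κ p := (algebraMap κ K).charP (algebraMap κ K).injective p
    exact ⟨compactSpace_of_isClosedImmersion ((baseChange κ K).map m), isReduced_baseChange p W⟩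
  constructor
  · rintro ⟨B', _, h, κ, M, _, e, W, m, b, hB', hh, hk, hκ, hM, he, hWi, hm, heq⟩
    obtain ⟨_, _⟩ := hW m
    refine ⟨κ, inferInstance, hκ, inferInstance, M, _, hM, W, m, e.hom ≫ h, b, hWi, hm,
      inferInstance, hk.comp_iso e, ?_⟩
    rw [translationBy_image_eq] at heq
    simpa only [Category.assoc] using heq
  · rintro ⟨κ, _, hκ, _, M, _, hM, W, m, h, b, hWi, hm, hh, hk, heq⟩
    let κ' := (algebraMap κ K).fieldRange
    let : Algebra κ κ' := (algebraMap κ K).rangeRestrictField.toAlgebra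
    have : IsScalarTower κ κ' K := .of_algebraMap_eq fun x ↦ rfl
    have hbij : Function.Bijective (algebraMap κ κ') :=
      ⟨(algebraMap κ κ').injective, fun ⟨y, x, hx⟩ ↦ ⟨x, Subtype.ext hx⟩⟩
    have : Finite κ' := Finite.of_surjective _ hbij.2
    have hiso : IsIso (Spec.map (CommRingCat.ofHom (algebraMap κ κ'))) := by
      have : IsIso (CommRingCat.ofHom (algebraMap κ κ')) :=
        (ConcreteCategory.isIso_iff_bijective _).2 hbij
      infer_instance
    have : Nonempty ((baseChange κ κ').obj W).left :=
      ⟨inv (pullback.fst W.hom (Spec.map (CommRingCat.ofHom (algebraMap κ κ'))))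
        (genericPoint W.left)⟩
    have hWi' : IsIntegral ((baseChange κ κ').obj W).left :=
      isIntegral_of_isOpenImmersion
        (pullback.fst W.hom (Spec.map (CommRingCat.ofHom (algebraMap κ κ'))))
    have hm' := isClosedImmersion_baseChange_map (K := κ') m
    obtain ⟨_, _⟩ := hW ((baseChange κ κ').map m)
    refine ⟨(baseChange κ' K).obj ((baseChange κ κ').obj M), inferInstance,
      (baseChangeTower κ κ' K M).hom ≫ h, κ', (baseChange κ κ').obj M, inferInstance, Iso.refl _,
      (baseChange κ κ').obj W, (baseChange κ κ').map m, b, inferInstance, inferInstance,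
      hk.comp_iso _, inferInstance, inferInstance, ?_, hWi', hm', ?_⟩
    · exact inferInstanceAs (IsMonHom (𝟙 ((baseChange κ' K).obj ((baseChange κ κ').obj M))))
    rw [translationBy_image_eq, ← heq]
    simp only [Iso.refl_hom, Category.id_comp, Category.assoc]
    rw [reassoc_of% baseChangeTower_hom_naturality κ κ' K m, range_iso_comp_left]

lemma IsIsotrivial.of_iso {Q Q' : Over (Spec (.of K))} [GrpObj Q] [GrpObj Q'] {Z : Set Q.left}
    (hZ : IsIsotrivial Q Z) (θ : Q ≅ Q') [IsMonHom θ.hom] : IsIsotrivial Q' (θ.hom.left '' Z) := by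
  obtain ⟨κ, _, hκ, _, M, _, hM, W, m, h, b, hWi, hm, hh, hk, rfl⟩ := hZ
  refine ⟨κ, inferInstance, hκ, inferInstance, M, _, hM, W, m, h ≫ θ.hom, b ≫ θ.hom, hWi, hm,
      inferInstance, hk.iso_comp θ, ?_⟩
  have : IsIso θ.hom.left := inferInstanceAs (IsIso ((Over.forget _).map θ.hom))
  rw [Category.assoc, ← translationBy_comp]
  simp only [← Category.assoc]
  rw [Over.comp_left _ _ _ _ θ.hom, Scheme.Hom.comp_base, TopCat.coe_comp, Set.range_comp]
  exact (θ.hom.left.homeomorph.image_closure _).symm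

lemma IsIsotrivial.baseChange {F : Type u} [Field F] [Algebra F K] {Q : Over (Spec (.of F))}
    [GrpObj Q] {Z : Set Q.left} (hZ : IsIsotrivial Q Z) :
    IsIsotrivial ((MordellLang.baseChange F K).obj Q) (pullback.fst Q.hom _ ⁻¹' Z) := by
  obtain ⟨κ, _, hκ, _, M, _, hM, W, m, h, b, hWi, hm, hh, hk, rfl⟩ := hZ
  let : Algebra κ K := ((algebraMap F K).comp (algebraMap κ F)).toAlgebra
  have : IsScalarTower κ F K := .of_algebraMap_eq fun x ↦ rfl
  refine ⟨κ, inferInstance, hκ, inferInstance, M, _, hM, W, m,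
    (baseChangeTower κ F K M).inv ≫ (MordellLang.baseChange F K).map h,
    pointsBaseChange F K Q b, hWi, hm, inferInstance,
    hk.baseChange.comp_iso (baseChangeTower κ F K M).symm, ?_⟩
  rw [← closure_range_baseChange_map, ← baseChange_map_translationBy]
  have : (MordellLang.baseChange κ K).map m ≫ (baseChangeTower κ F K M).inv =
      (baseChangeTower κ F K W).inv ≫
        (MordellLang.baseChange F K).map ((MordellLang.baseChange κ F).map m) := by
    rw [Iso.eq_inv_comp, ← reassoc_of% baseChangeTower_hom_naturality κ F K m, Iso.hom_inv_id,
      Category.comp_id]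
  rw [Category.assoc, reassoc_of% this]
  refine congrArg closure ((range_iso_comp_left (baseChangeTower κ F K W).symm _).trans ?_)
  simp only [Functor.map_comp]

end

/-! ### Density of the rational points of `Λ` -/

section

variable {F F' : Type u} [Field F] [Field F'] [Algebra F F']

lemma range_unit_left {X : Over (Spec (.of F))} (x : 𝟙_ (Over (Spec (.of F))) ⟶ X) :
    Set.range x.left = {x.left (IsLocalRing.closedPoint F)} := by
  ext z
  constructor
  · rintro ⟨s, rfl⟩
    have : s = IsLocalRing.closedPoint F := Subsingleton.elim (α := PrimeSpectrum F) _ _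
    rw [this]
    rfl
  · rintro rfl
    exact ⟨_, rfl⟩

/-- The point of `G_{F'}` given by a point in `G(F)` lies over the latter. -/
lemma pointsBaseChange_left_apply {G : Over (Spec (.of F))} [GrpObj G]
    (x : 𝟙_ (Over (Spec (.of F))) ⟶ G) :
    pullback.fst G.hom (Spec.map (CommRingCat.ofHom (algebraMap F F')))
      ((pointsBaseChange F F' G x).left (IsLocalRing.closedPoint F')) =
      x.left (IsLocalRing.closedPoint F) := by
  have h : (pointsBaseChange F F' G x).left ≫
      pullback.fst G.hom (Spec.map (CommRingCat.ofHom (algebraMap F F'))) =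
      (Functor.LaxMonoidal.ε (baseChange F F')).left ≫ pullback.fst _ _ ≫ x.left := by
    rw [← baseChange_map_left_fst, ← Category.assoc]
    rfl
  have h2 := congrArg (fun g : Spec (.of F') ⟶ G.left ↦ g (IsLocalRing.closedPoint F')) h
  refine h2.trans ?_
  have := range_unit_left x
  exact this.le ⟨_, rfl⟩

/-- The set of `F'`-points of `Y_{F'}` in the image of `Λ` is the preimage of the set of points of
`Y` in `Λ`, and density is preserved and reflected by the projection `Y_{F'} ⟶ Y`, which is open and
surjective. -/
lemma denseIntersection_baseChange_iff {B Y : Over (Spec (.of F))} [GrpObj B] (i : Y ⟶ B)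
    [IsClosedImmersion i.left] (Λ : Subgroup (𝟙_ (Over (Spec (.of F))) ⟶ B)) :
    DenseIntersection ((baseChange F F').map i) (Λ.map (pointsBaseChange F F' B)) ↔
      DenseIntersection i Λ := by
  let q := pullback.fst Y.hom (Spec.map (CommRingCat.ofHom (algebraMap F F')))
  have key : {z : ((baseChange F F').obj Y).left | ∃ y : 𝟙_ (Over (Spec (.of F'))) ⟶ _,
      y ≫ (baseChange F F').map i ∈ Λ.map (pointsBaseChange F F' B) ∧ z ∈ Set.range y.left} =
      q ⁻¹' {z : Y.left | ∃ y : 𝟙_ (Over (Spec (.of F))) ⟶ Y, y ≫ i ∈ Λ ∧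
        z ∈ Set.range y.left} := by
    ext z
    constructor
    · rintro ⟨y, ⟨l, hl, hly⟩, hz⟩
      have hy : i.left (q (y.left (IsLocalRing.closedPoint F'))) =
          l.left (IsLocalRing.closedPoint F) := by
        rw [← pointsBaseChange_left_apply (F' := F') l, hly]
        exact (congrArg (fun g ↦ g (y.left (IsLocalRing.closedPoint F')))
          (baseChange_map_left_fst i)).symm
      have : IsReduced (𝟙_ (Over (Spec (.of F)))).left :=
        inferInstanceAs (IsReduced (Spec (.of F)))
      have : CompactSpace (𝟙_ (Over (Spec (.of F)))).left :=
        inferInstanceAs (CompactSpace (Spec (.of F)))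
      have := quasiCompact_left l
      obtain ⟨y', hy'⟩ := exists_lift_of_isReduced i l (by
        rw [range_unit_left, ← hy, Set.singleton_subset_iff]
        exact subset_closure ⟨_, rfl⟩)
      refine ⟨y', by rwa [hy'], ?_⟩
      rw [range_unit_left] at hz ⊢
      obtain rfl := hz
      apply i.left.isClosedEmbedding.injective
      refine hy.trans ?_
      rw [← hy']
      rfl
    · rintro ⟨y, hy, hz⟩
      refine ⟨Functor.LaxMonoidal.ε (baseChange F F') ≫ (baseChange F F').map y,
        ⟨y ≫ i, hy, ?_⟩, ?_⟩
      · rw [Category.assoc, ← Functor.map_comp]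
        rfl
      · refine (range_iso_comp_left (Functor.Monoidal.εIso (baseChange F F')) _).ge ?_
        rw [range_baseChange_map]
        exact hz
  have hq : Function.Surjective q := Scheme.Hom.surjective _
  unfold DenseIntersection
  rw [key]
  constructor
  · intro h
    exact (hq.denseRange.dense_image q.continuous h).mono (Set.image_preimage_subset _ _)
  · intro h
    exact h.preimage (isOpenMap_baseChange_fst Y)

end

/-! ### Faithfully flat descent of finite type, generically -/

/-- The Artin-Tate lemma for `k ⊆ A[1/z] ⊆ A[1/z][S]`, where `S` is finite, integral over `A[1/z]`,
and generates a `k`-algebra containing `A`. -/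
lemma finiteType_of_adjoin {k A Az L : Type*} [Field k] [CommRing A] [Field L] [CommRing Az]
    [Algebra k A] [Algebra A L] [Algebra k L] [IsScalarTower k A L] [Algebra k Az] [Algebra A Az]
    [Algebra Az L] [IsScalarTower A Az L] [IsScalarTower k Az L]
    (hinj : Function.Injective (algebraMap A L)) (S : Finset L)
    (hS : ∀ a, algebraMap A L a ∈ Algebra.adjoin k (S : Set L)) (z : A) (hz : algebraMap A L z ≠ 0)
    [IsLocalization.Away z Az] (hint : ∀ s ∈ (S : Set L), IsIntegral Az s) :
    Algebra.FiniteType k Az := by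
  have hinv (x : Az) (n : ℕ) (a : A) (h : x * algebraMap A Az z ^ n = algebraMap A Az a) :
      algebraMap Az L x = algebraMap A L a * (algebraMap A L z)⁻¹ ^ n := by
    have h' := congrArg (algebraMap Az L) h
    rw [map_mul, map_pow, ← IsScalarTower.algebraMap_apply, ← IsScalarTower.algebraMap_apply] at h'
    rw [← h', inv_pow, mul_inv_cancel_right₀ (pow_ne_zero _ hz)]
  have hφ : Function.Injective (algebraMap Az L) := by
    rw [injective_iff_map_eq_zero]
    intro x hx
    obtain ⟨n, a, h⟩ := IsLocalization.Away.surj z x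
    have h' := hinv x n a h
    rw [hx, eq_comm, mul_eq_zero, or_iff_left (pow_ne_zero _ (inv_ne_zero hz))] at h'
    rw [hinj (h'.trans (map_zero _).symm), map_zero] at h
    exact ((IsLocalization.Away.algebraMap_pow_isUnit z n).mul_left_eq_zero).1 h
  let C := Algebra.adjoin Az (S : Set L)
  have hBC : (Subalgebra.toSubmodule C).FG := fg_adjoin_of_finite S.finite_toSet hint
  let E := Algebra.adjoin k ((S : Set L) ∪ {(algebraMap A L z)⁻¹})
  have h1 (a : A) : algebraMap A L a ∈ E :=
    SetLike.le_def.1 (Algebra.adjoin_mono Set.subset_union_left) (hS a)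
  have h2 : (algebraMap A L z)⁻¹ ∈ E := Algebra.subset_adjoin (.inr (Set.mem_singleton _))
  have hle : ∀ x, algebraMap Az L x ∈ E := by
    intro x
    obtain ⟨n, a, h⟩ := IsLocalization.Away.surj z x
    rw [hinv x n a h]
    exact E.mul_mem (h1 a) (E.pow_mem h2 n)
  have hC : C.restrictScalars k = E := by
    apply le_antisymm
    · let D : Subalgebra Az L := { E with algebraMap_mem' := hle }
      have hSD : (S : Set L) ⊆ D := fun x hx ↦ (Algebra.subset_adjoin (.inl hx) : x ∈ E)
      intro x hx
      exact (Algebra.adjoin_le hSD hx : x ∈ D)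
    · refine Algebra.adjoin_le (Set.union_subset Algebra.subset_adjoin ?_)
      rintro _ rfl
      have : (algebraMap A L z)⁻¹ = algebraMap Az L (IsLocalization.Away.invSelf z) := by
        rw [hinv _ 1 1 (by rw [mul_comm, pow_one, IsLocalization.Away.mul_invSelf, map_one]),
          map_one, _root_.one_mul, pow_one]
      rw [this]
      exact C.algebraMap_mem _
  have hkC : (C.restrictScalars k).FG := by
    rw [hC]
    exact Subalgebra.fg_def.2 ⟨_, S.finite_toSet.union (Set.finite_singleton _), rfl⟩
  refine ⟨fg_of_fg_of_fg k Az C ?_ ?_ ?_⟩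
  · exact (Subalgebra.fg_top _).2 hkC
  · exact (Submodule.fg_top _).2 hBC
  · exact fun x y h ↦ hφ (congrArg Subtype.val h)

lemma exists_finiteType_away_of_adjoin {k A L : Type*} [Field k] [CommRing A] [Field L]
    [Algebra k A] [Algebra A L] [Algebra k L] [IsScalarTower k A L]
    (hinj : Function.Injective (algebraMap A L)) [Algebra.IsAlgebraic A L] (S : Finset L)
    (hS : ∀ a, algebraMap A L a ∈ Algebra.adjoin k (S : Set L)) :
    ∃ y : A, y ≠ 0 ∧ ∀ f : A, f ≠ 0 → Algebra.FiniteType k (Localization.Away (y * f)) := by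
  have : IsDomain A := hinj.isDomain
  obtain ⟨y, hy, hy'⟩ := Algebra.IsAlgebraic.exists_integral_multiples A S
  refine ⟨y, hy, fun f hf ↦ ?_⟩
  have hz : y * f ≠ 0 := mul_ne_zero hy hf
  have hzL : algebraMap A L (y * f) ≠ 0 := fun h ↦ hz (hinj (by rw [h, map_zero]))
  let φ : Localization.Away (y * f) →+* L :=
    Localization.awayLift (algebraMap A L) (y * f) (.mk0 _ hzL)
  let : Algebra (Localization.Away (y * f)) L := φ.toAlgebra
  have : IsScalarTower A (Localization.Away (y * f)) L := .of_algebraMap_eq fun x ↦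
    (IsLocalization.Away.lift_eq (y * f) (IsUnit.mk0 _ hzL) x).symm
  have : IsScalarTower k (Localization.Away (y * f)) L := .of_algebraMap_eq fun x ↦ by
    rw [IsScalarTower.algebraMap_apply k A (Localization.Away (y * f)),
      ← IsScalarTower.algebraMap_apply A (Localization.Away (y * f)) L,
      ← IsScalarTower.algebraMap_apply]
  refine finiteType_of_adjoin (k := k) hinj S hS (y * f) hzL fun s hs ↦ ?_
  have h1 : IsIntegral (Localization.Away (y * f)) (y • s) := (hy' s hs).tower_top
  have hu : IsUnit (algebraMap A (Localization.Away (y * f)) y) :=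
    isUnit_of_dvd_unit (map_dvd _ (Dvd.intro f rfl)) (IsLocalization.Away.algebraMap_isUnit (y * f))
  obtain ⟨v, hv⟩ := hu
  have h2 : s = (↑v⁻¹ : Localization.Away (y * f)) • (y • s) := by
    rw [← IsScalarTower.algebraMap_smul (Localization.Away (y * f)) y s, ← hv, smul_smul]
    simp
  rw [h2]
  exact h1.smul _

/-- A finite field extension `L` of the fraction field of `A` with an `A`-morphism `B → L`: the
residue field at a closed point of the generic fibre. -/
lemma exists_field_of_injective (k A B K : Type u) [Field k] [CommRing A] [IsDomain A]
    [CommRing B] [Algebra k A] [Algebra A B] [Algebra k B] [IsScalarTower k A B]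
    [Algebra.FiniteType k B] (hinj : Function.Injective (algebraMap A B)) [Field K] [Algebra A K]
    [IsFractionRing A K] :
    ∃ (L : Type u) (_ : Field L) (_ : Algebra K L) (_ : Algebra A L) (_ : B →ₐ[A] L),
      IsScalarTower A K L ∧ Module.Finite K L := by
  have : Module.Flat A K := IsLocalization.flat K (nonZeroDivisors A)
  have h1 := Module.Flat.lTensor_preserves_injective_linearMap (M := K) (Algebra.linearMap A B) hinj
  have : Nontrivial (K ⊗[A] B) := (h1.comp (TensorProduct.rid A K).symm.injective).nontrivial
  have : Algebra.FiniteType A B := .of_restrictScalars_finiteType k A B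
  obtain ⟨m, hm⟩ := Ideal.exists_maximal (K ⊗[A] B)
  let : Field ((K ⊗[A] B) ⧸ m) := Ideal.Quotient.field m
  have : Algebra.FiniteType K ((K ⊗[A] B) ⧸ m) :=
    .of_surjective (Ideal.Quotient.mkₐ K m) Ideal.Quotient.mk_surjective
  exact ⟨(K ⊗[A] B) ⧸ m, inferInstance, inferInstance, inferInstance,
    (Ideal.Quotient.mkₐ A m).comp Algebra.TensorProduct.includeRight, inferInstance,
    finite_of_finite_type_of_isJacobsonRing K _⟩

/-- A domain contained in a `k`-algebra of finite type is of finite type after inverting an element,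
and it remains so after inverting more elements. -/
lemma exists_finiteType_away_of_injective {k A B : Type u} [Field k] [CommRing A] [IsDomain A]
    [CommRing B] [Algebra k A] [Algebra A B] [Algebra k B] [IsScalarTower k A B]
    [Algebra.FiniteType k B] (hinj : Function.Injective (algebraMap A B)) :
    ∃ y : A, y ≠ 0 ∧ ∀ f : A, f ≠ 0 → Algebra.FiniteType k (Localization.Away (y * f)) := by
  obtain ⟨L, _, _, _, ψ, _, _⟩ := exists_field_of_injective k A B (FractionRing A) hinj
  have : Algebra.IsAlgebraic (FractionRing A) L := Algebra.IsAlgebraic.of_finite _ _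
  have : Algebra.IsAlgebraic A L :=
    (IsFractionRing.comap_isAlgebraic_iff (K := FractionRing A)).2 inferInstance
  let : Algebra k L := ((algebraMap A L).comp (algebraMap k A)).toAlgebra
  have : IsScalarTower k A L := .of_algebraMap_eq fun x ↦ rfl
  obtain ⟨S, hS⟩ := (inferInstance : Algebra.FiniteType k B).out
  classical
  refine exists_finiteType_away_of_adjoin (k := k) (L := L) ?_ (S.image ψ) fun a ↦ ?_
  · rw [IsScalarTower.algebraMap_eq A (FractionRing A) L]
    exact (algebraMap (FractionRing A) L).injective.comp (IsFractionRing.injective A _)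
  · rw [← ψ.commutes, Finset.coe_image, ← AlgHom.coe_restrictScalars' k ψ, ← AlgHom.map_adjoin, hS]
    exact ⟨_, trivial, rfl⟩

/-- A Noetherian algebra is of finite type if its quotient by a nilpotent ideal is. -/
lemma finiteType_of_ker_le_nilradical {k C D : Type*} [Field k] [CommRing C] [CommRing D]
    [Algebra k C] [Algebra k D] [IsNoetherianRing C] [Algebra.FiniteType k D] (g : C →ₐ[k] D)
    (hg : Function.Surjective g) (hker : RingHom.ker g ≤ nilradical C) :
    Algebra.FiniteType k C := by
  obtain ⟨n, φ, hφ⟩ := Algebra.FiniteType.iff_quotient_mvPolynomial''.1 ‹Algebra.FiniteType k D›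
  choose c hc using hg
  let ψ : MvPolynomial (Fin n) k →ₐ[k] C := MvPolynomial.aeval fun i ↦ c (φ (.X i))
  have hψ : g.comp ψ = φ := by
    ext i
    simp [ψ, hc]
  let : Algebra (MvPolynomial (Fin n) k) C := ψ.toAlgebra
  let : Algebra (MvPolynomial (Fin n) k) D := φ.toAlgebra
  have : Module.Finite (MvPolynomial (Fin n) k) D :=
    Module.Finite.of_surjective (Algebra.linearMap _ _) hφ
  let g' : C →ₐ[MvPolynomial (Fin n) k] D :=
    { g with commutes' := fun x ↦ DFunLike.congr_fun hψ x }
  have : Module.Finite (MvPolynomial (Fin n) k) C :=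
    Module.finite_of_surjective_of_ker_le_nilradical g' (fun x ↦ ⟨c x, hc x⟩) hker
      (IsNoetherian.noetherian _)
  have : IsScalarTower k (MvPolynomial (Fin n) k) C := .of_algebraMap_eq fun x ↦
    (ψ.commutes x).symm
  exact .trans (S := MvPolynomial (Fin n) k) inferInstance inferInstance

/-- A `k`-algebra with a faithfully flat algebra of finite type over `k` is itself of finite type,
at least over a nonempty open subset of its spectrum: the part of one irreducible component which
does not meet the others is, up to nilpotents, the spectrum of a domain contained in a `k`-algebra
of finite type. -/
lemma exists_finiteType_away_of_faithfullyFlat {k A B : Type u} [Field k] [CommRing A]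
    [Nontrivial A]
    [CommRing B] [Algebra k A] [Algebra A B] [Algebra k B] [IsScalarTower k A B]
    [Algebra.FiniteType k B] [Module.FaithfullyFlat A B] :
    ∃ s : A, ¬ IsNilpotent s ∧ Algebra.FiniteType k (Localization.Away s) := by
  have : IsNoetherianRing B := Algebra.FiniteType.isNoetherianRing k B
  have : IsNoetherianRing A := by
    rw [isNoetherianRing_iff, isNoetherian_iff']
    have h : StrictMono (Ideal.map (algebraMap A B)) :=
      Monotone.strictMono_of_injective (fun _ _ ↦ Ideal.map_mono)
        Ideal.map_injective_of_faithfullyFlat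
    exact h.wellFoundedGT
  have hfin := minimalPrimes.finite_of_isNoetherianRing A
  obtain ⟨P, hP⟩ : (minimalPrimes A).Nonempty :=
    Set.nonempty_coe_sort.1 (Ideal.nonempty_minimalPrimes bot_ne_top)
  have : P.IsPrime := hP.1.1
  -- an element of all the minimal primes other than `P`, but not of `P`
  obtain ⟨f, hf, hfP⟩ : ∃ f, (∀ P' ∈ minimalPrimes A, P' ≠ P → f ∈ P') ∧ f ∉ P := by
    by_contra! h
    have hfin' : (minimalPrimes A \ {P}).Finite := hfin.subset Set.sdiff_subset
    have h1 : hfin'.toFinset.inf id ≤ P := by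
      intro x hx
      refine h x fun P' hP' hne ↦ ?_
      have hP'' : P' ∈ hfin'.toFinset := (Set.Finite.mem_toFinset _).2 ⟨hP', hne⟩
      exact Finset.inf_le (f := id) hP'' hx
    obtain ⟨P', hP', hle⟩ := (Ideal.IsPrime.inf_le' ‹_›).1 h1
    rw [Set.Finite.mem_toFinset] at hP'
    exact hP'.2 (le_antisymm hle (hP.2 hP'.1.1 hle))
  have hinj : Function.Injective (algebraMap (A ⧸ P) (B ⧸ P.map (algebraMap A B))) := by
    rw [injective_iff_map_eq_zero]
    intro x hx
    obtain ⟨a, rfl⟩ := Ideal.Quotient.mk_surjective x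
    have ha : Ideal.Quotient.mk (P.map (algebraMap A B)) (algebraMap A B a) = 0 := hx
    rw [Ideal.Quotient.eq_zero_iff_mem, ← Ideal.mem_comap,
      Ideal.comap_map_eq_self_of_faithfullyFlat] at ha
    exact Ideal.Quotient.eq_zero_iff_mem.2 ha
  have : IsScalarTower k (A ⧸ P) (B ⧸ P.map (algebraMap A B)) := .of_algebraMap_eq fun x ↦ by
    exact congrArg (Ideal.Quotient.mk _) (IsScalarTower.algebraMap_apply k A B x)
  obtain ⟨y, hy, hy'⟩ := exists_finiteType_away_of_injective (k := k) hinj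
  obtain ⟨a, rfl⟩ := Ideal.Quotient.mk_surjective y
  have := hy' (Ideal.Quotient.mk P f) (by rwa [Ne, Ideal.Quotient.eq_zero_iff_mem])
  rw [← map_mul] at this
  have hs : a * f ∉ P := fun h ↦ ((inferInstance : P.IsPrime).mem_or_mem h).elim
    (fun h ↦ hy (Ideal.Quotient.eq_zero_iff_mem.2 h)) hfP
  refine ⟨a * f, fun h ↦ hs (nilpotent_iff_mem_prime.1 h P ‹_›), ?_⟩
  have : Algebra.FiniteType k (Localization.Away (Ideal.Quotient.mkₐ k P (a * f))) := this
  have : IsNoetherianRing (Localization.Away (a * f)) :=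
    IsLocalization.isNoetherianRing (.powers (a * f)) _ ‹_›
  refine finiteType_of_ker_le_nilradical (Localization.awayMapₐ (Ideal.Quotient.mkₐ k P) (a * f))
      ?_ ?_
  · exact IsLocalization.Away.mapₐ_surjective_of_surjective _ Ideal.Quotient.mk_surjective
  · intro x hx
    obtain ⟨n, c, hc⟩ := IsLocalization.Away.surj (a * f) x
    have hcP : c ∈ P := by
      have h1 := (_root_.map_mul (Localization.awayMapₐ (Ideal.Quotient.mkₐ k P) (a * f)) x
          _).symm.trans
        (congrArg (Localization.awayMapₐ (Ideal.Quotient.mkₐ k P) (a * f)) hc)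
      rw [RingHom.mem_ker.1 hx, zero_mul] at h1
      have h2 : Localization.awayMapₐ (Ideal.Quotient.mkₐ k P) (a * f) (algebraMap A _ c) =
          algebraMap _ _ (Ideal.Quotient.mk P c) :=
        IsLocalization.map_eq (M := .powers (a * f))
          (T := .powers (Ideal.Quotient.mkₐ k P (a * f)))
          (Submonoid.powers_le.2 (Submonoid.mem_powers _)) _
      rw [h2, eq_comm, IsLocalization.map_eq_zero_iff
        (Submonoid.powers (Ideal.Quotient.mkₐ k P (a * f)))] at h1
      obtain ⟨⟨_, m, rfl⟩, hm⟩ := h1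
      have h3 : Ideal.Quotient.mk P ((a * f) ^ m * c) = 0 := by
        rw [map_mul, map_pow]
        exact hm
      rw [Ideal.Quotient.eq_zero_iff_mem] at h3
      exact ((inferInstance : P.IsPrime).mem_or_mem h3).resolve_left
        fun h ↦ hs ((inferInstance : P.IsPrime).mem_of_pow_mem m h)
    have hnil : IsNilpotent (c * (a * f)) := by
      rw [← mem_nilradical, nilradical, ← Ideal.sInf_minimalPrimes, Ideal.mem_sInf]
      intro P' hP'
      by_cases h : P' = P
      · exact h ▸ P.mul_mem_right _ hcP
      · exact P'.mul_mem_left _ (P'.mul_mem_left _ (hf P' hP' h))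
    have h4 := hnil.map (algebraMap A (Localization.Away (a * f)))
    rw [map_mul, ← hc, _root_.mul_assoc, ← pow_succ] at h4
    have h5 := IsLocalization.Away.algebraMap_pow_isUnit (S := Localization.Away (a * f)) (a * f)
        (n + 1)
    rw [mem_nilradical]
    obtain ⟨v, hv⟩ := h5
    rw [← hv] at h4
    have h6 := (Commute.all (x * v) (↑v⁻¹ : Localization.Away (a * f))).isNilpotent_mul_right h4
    rwa [_root_.mul_assoc, Units.mul_inv, _root_.mul_one] at h6

/-! ### The quotient is locally of finite type -/

/-- Locally on source and target, a universally open morphism is a surjective morphism of affine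
schemes. -/
lemma exists_affine_surjective {X Y : Scheme.{u}} (f : X ⟶ Y) [UniversallyOpen f] [Nonempty X] :
    ∃ (A B : CommRingCat.{u}) (φ : A ⟶ B) (u' : Spec A ⟶ Y) (v : Spec B ⟶ X),
      IsOpenImmersion u' ∧ IsOpenImmersion v ∧ Spec.map φ ≫ u' = v ≫ f ∧
      Surjective (Spec.map φ) ∧ Nonempty (Spec A) := by
  obtain ⟨x⟩ := ‹Nonempty X›
  obtain ⟨R, u₀, _, ⟨y, hy⟩, -⟩ :=
    Scheme.exists_affine_mem_range_and_range_subset (x := f x) (U := ⊤) trivial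
  obtain ⟨z, hz, hz'⟩ := Scheme.Pullback.exists_preimage_pullback x y hy.symm
  obtain ⟨S, v₀, _, ⟨s, hs⟩, -⟩ :=
    Scheme.exists_affine_mem_range_and_range_subset (x := z) (U := ⊤) trivial
  let g := v₀ ≫ pullback.snd f u₀
  have hopen : IsOpen (Set.range g) := g.isOpenMap.isOpen_range
  obtain ⟨_, ⟨r, rfl⟩, hyr, hr⟩ :=
      PrimeSpectrum.isTopologicalBasis_basic_opens.exists_subset_of_mem_open
    (show y ∈ Set.range g from ⟨s, by simp [g, hs, hz']⟩) hopen
  let loc : Spec (.of (Localization.Away r)) ⟶ Spec R :=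
    Spec.map (CommRingCat.ofHom (algebraMap R (Localization.Away r)))
  have hloc : IsOpenImmersion loc := IsOpenImmersion.of_isLocalization r
  have hrange : Set.range loc = (PrimeSpectrum.basicOpen r : Set (PrimeSpectrum R)) :=
    PrimeSpectrum.localization_away_comap_range (Localization.Away r) r
  let P := pullback g loc
  let ψ : Spec Γ(P, ⊤) ⟶ Spec (.of (Localization.Away r)) := P.isoSpec.inv ≫ pullback.snd g loc
  have hψ : Surjective ψ := by
    have : Surjective (pullback.snd g loc) := by
      refine ⟨fun a ↦ ?_⟩
      obtain ⟨b, hb⟩ := hr (hrange.le (Set.mem_range_self a))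
      obtain ⟨c, -, hc⟩ := Scheme.Pullback.exists_preimage_pullback b a hb
      exact ⟨c, hc⟩
    infer_instance
  refine ⟨_, _, Spec.preimage ψ, loc ≫ u₀, P.isoSpec.inv ≫ pullback.fst g loc ≫ v₀ ≫ pullback.fst f
      u₀,
    inferInstance, inferInstance, ?_, ?_, ?_⟩
  · rw [Spec.map_preimage]
    simp only [ψ, Category.assoc]
    rw [pullback.condition, ← pullback.condition_assoc]
    simp [g]
  · rwa [Spec.map_preimage]
  · obtain ⟨a, -⟩ := (hrange ▸ hyr : y ∈ Set.range loc)
    exact ⟨a⟩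

lemma exists_locallyOfFiniteType_openImmersion {k : Type u} [Field k] {X Y : Scheme.{u}} (f : X ⟶ Y)
    (g : Y ⟶ Spec (.of k)) [UniversallyOpen f] [Flat f] [Nonempty X] [LocallyOfFiniteType (f ≫ g)] :
    ∃ U : Y.Opens, (U : Set Y).Nonempty ∧ LocallyOfFiniteType (U.ι ≫ g) := by
  obtain ⟨A, B, φ, u', v, _, _, hcomm, _, _⟩ := exists_affine_surjective f
  let a := Spec.preimage (u' ≫ g)
  have ha : Spec.map a = u' ≫ g := Spec.map_preimage _
  have hφ : φ.hom.FaithfullyFlat := by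
    rw [← flat_and_surjective_SpecMap_iff]
    refine ⟨?_, inferInstance⟩
    have : Flat (Spec.map φ ≫ u') := by
      rw [hcomm]
      infer_instance
    exact (MorphismProperty.IsStableUnderBaseChange.hasOfPostcompProperty_monomorphisms
      (P := (@Flat : MorphismProperty Scheme.{u}))).of_postcomp _ u' (inferInstanceAs
          (Mono u')) this
  let : Algebra k A := a.hom.toAlgebra
  let : Algebra A B := φ.hom.toAlgebra
  let : Algebra k B := (φ.hom.comp a.hom).toAlgebra
  have : IsScalarTower k A B := .of_algebraMap_eq fun x ↦ rfl
  have : Module.FaithfullyFlat A B := hφ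
  have : Algebra.FiniteType k B := by
    have : LocallyOfFiniteType (Spec.map (a ≫ φ)) := by
      rw [Spec.map_comp, ha, reassoc_of% hcomm]
      infer_instance
    exact HasRingHomProperty.Spec_iff.1 this
  have : Nontrivial A := PrimeSpectrum.nonempty_iff_nontrivial.1 ‹_›
  obtain ⟨s, hs, hft⟩ := exists_finiteType_away_of_faithfullyFlat (k := k) (A := A) (B := B)
  let loc : Spec (.of (Localization.Away s)) ⟶ Spec A :=
    Spec.map (CommRingCat.ofHom (algebraMap A (Localization.Away s)))
  have hloc : IsOpenImmersion loc := IsOpenImmersion.of_isLocalization s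
  have : Nontrivial (Localization.Away s) :=
    not_subsingleton_iff_nontrivial.1 fun h ↦
      hs ((IsLocalization.subsingleton_iff (M := .powers s)).1 h)
  have hne : Nonempty (Spec (.of (Localization.Away s))) :=
    PrimeSpectrum.nonempty_iff_nontrivial.2 this
  refine ⟨(loc ≫ u').opensRange, ?_, ?_⟩
  · exact Set.range_nonempty _
  · have h1 : LocallyOfFiniteType ((loc ≫ u') ≫ g) := by
      rw [Category.assoc, ← ha, ← Spec.map_comp,
        HasRingHomProperty.Spec_iff (P := @LocallyOfFiniteType)]
      have : IsScalarTower k A (Localization.Away s) := inferInstance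
      exact (RingHom.finiteType_algebraMap.2 hft : (algebraMap k (Localization.Away s)).FiniteType)
    rw [← Scheme.Hom.isoOpensRange_inv_comp (loc ≫ u'), Category.assoc]
    infer_instance

section

variable {k : Type u} [Field k]

lemma translationBy_mul {G : Over (Spec (.of k))} [GrpObj G] (a b : 𝟙_ (Over (Spec (.of k))) ⟶ G) :
    translationBy a ≫ translationBy b = translationBy (b * a) := by
  rw [comp_translationBy, translationBy, translationBy, comp_mul, _root_.mul_assoc]

lemma translationBy_one {G : Over (Spec (.of k))} [GrpObj G] :
    translationBy (1 : 𝟙_ (Over (Spec (.of k))) ⟶ G) = 𝟙 G := by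
  rw [translationBy, comp_one, _root_.one_mul]

instance {G : Over (Spec (.of k))} [GrpObj G] (b : 𝟙_ (Over (Spec (.of k))) ⟶ G) :
    IsIso (translationBy b) :=
  ⟨translationBy b⁻¹, by rw [translationBy_mul, inv_mul_cancel, translationBy_one],
    by rw [translationBy_mul, mul_inv_cancel, translationBy_one]⟩

instance {G : Over (Spec (.of k))} [GrpObj G] (b : 𝟙_ (Over (Spec (.of k))) ⟶ G) :
    IsIso (translationBy b).left :=
  inferInstanceAs (IsIso ((Over.forget _).map (translationBy b)))

/-- Over an algebraically closed field, a nonempty locally closed set contains a rational point. -/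
lemma exists_point_mem [IsAlgClosed k] {X : Over (Spec (.of k))} [LocallyOfFiniteType X.hom]
    {Z : Set X.left} (hZ : Z.Nonempty) (hZ' : IsLocallyClosed Z) :
    ∃ x : 𝟙_ (Over (Spec (.of k))) ⟶ X, ∀ t, x.left t ∈ Z := by
  have : JacobsonSpace X.left := LocallyOfFiniteType.jacobsonSpace X.hom
  obtain ⟨x, hx, hx'⟩ := nonempty_inter_closedPoints hZ hZ'
  refine ⟨Over.homMk (pointOfClosedPoint X.hom x hx') (pointOfClosedPoint_comp X.hom x hx'),
    fun t ↦ ?_⟩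
  exact (pointOfClosedPoint_apply X.hom x hx' t).symm ▸ hx

/-- A quotient of a group scheme locally of finite type is locally of finite type: it has a nonempty
open subscheme with that property, and the translates of it by rational points cover the quotient.
-/
lemma IsQuotient.locallyOfFiniteType [IsAlgClosed k] {H G Q : Over (Spec (.of k))} [GrpObj G]
    [GrpObj Q] {j : H ⟶ G} {π : G ⟶ Q} (h : IsQuotient j π) [LocallyOfFiniteType G.hom] :
    LocallyOfFiniteType Q.hom := by
  have := h.flat
  have := h.surjective
  have := h.locallyOfFinitePresentation
  have := h.isMonHom
  have : LocallyOfFiniteType (π.left ≫ Q.hom) := by rwa [Over.w]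
  let t₀ : (𝟙_ (Over (Spec (.of k)))).left := IsLocalRing.closedPoint k
  have : Nonempty G.left := ⟨η[G].left t₀⟩
  obtain ⟨U, hU, hU'⟩ := exists_locallyOfFiniteType_openImmersion π.left Q.hom
  have hU2 : ((π.left ⁻¹ᵁ U : G.left.Opens) : Set G.left).Nonempty := by
    obtain ⟨q, hq⟩ := hU
    obtain ⟨g, rfl⟩ := π.left.surjective q
    exact ⟨g, hq⟩
  obtain ⟨v, hv⟩ := exists_point_mem hU2 (π.left ⁻¹ᵁ U).2.isLocallyClosed
  have hcov : (⨆ b : 𝟙_ (Over (Spec (.of k))) ⟶ Q, (translationBy b).left ⁻¹ᵁ U) = ⊤ := by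
    by_contra hne
    set V := ⨆ b : 𝟙_ (Over (Spec (.of k))) ⟶ Q, (translationBy b).left ⁻¹ᵁ U with hV
    have h1 : (((π.left ⁻¹ᵁ V : G.left.Opens) : Set G.left)ᶜ).Nonempty := by
      rw [Set.nonempty_compl]
      intro h2
      apply hne
      ext q
      obtain ⟨g, rfl⟩ := π.left.surjective q
      exact ⟨fun _ ↦ trivial, fun _ ↦
        (h2 ▸ Set.mem_univ g : g ∈ ((π.left ⁻¹ᵁ V : G.left.Opens) : Set G.left))⟩
    obtain ⟨y, hy⟩ := exists_point_mem h1 (π.left ⁻¹ᵁ V).2.isClosed_compl.isLocallyClosed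
    refine hy t₀ ?_
    show π.left (y.left t₀) ∈ V
    rw [hV, TopologicalSpace.Opens.mem_iSup]
    refine ⟨(v * y⁻¹) ≫ π, ?_⟩
    have h3 : (y ≫ π) ≫ translationBy ((v * y⁻¹) ≫ π) = v ≫ π := by
      rw [comp_translationBy, toUnit_unique (toUnit _) (𝟙 _), Category.id_comp, ← mul_comp,
        inv_mul_cancel_right]
    have h4 := congrArg (fun g ↦ g.left t₀) h3
    show (translationBy ((v * y⁻¹) ≫ π)).left (π.left (y.left t₀)) ∈ U
    refine (h4.trans ?_ : _ = π.left (v.left t₀)) ▸ hv t₀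
    rfl
  rw [(HasRingHomProperty.instIsZariskiLocalAtSource
    (P := @LocallyOfFiniteType)).iff_of_iSup_eq_top _ hcov]
  intro b
  have : ((translationBy b).left ⁻¹ᵁ U).ι ≫ Q.hom =
      ((translationBy b).left ∣_ U) ≫ U.ι ≫ Q.hom := by
    rw [← Category.assoc, morphismRestrict_ι, Category.assoc, Over.w]
  rw [this]
  infer_instance

end

/-! ### Spreading out along finitely generated subalgebras -/

/-- The spectrum of a `k`-algebra, as a scheme over `k`. -/
def specOver (k R : Type u) [Field k] [CommRing R] [Algebra k R] : Over (Spec (.of k)) :=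
  Over.mk (Spec.map (CommRingCat.ofHom (algebraMap k R)))

/-- The morphism of spectra over `k` given by a homomorphism of `k`-algebras. -/
def specOverMap {k R S : Type u} [Field k] [CommRing R] [Algebra k R] [CommRing S] [Algebra k S]
    (f : R →ₐ[k] S) : specOver k S ⟶ specOver k R :=
  Over.homMk (Spec.map (CommRingCat.ofHom f.toRingHom)) (by
    refine (Spec.map_comp _ _).symm.trans (congrArg Spec.map ?_)
    ext x
    exact f.commutes x)

lemma isPullback_whiskerLeft {C : Type*} [Category C] [CartesianMonoidalCategory C] (X : C)
    {S T : C}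
    (f : S ⟶ T) : IsPullback (X ◁ f) (snd X S) (snd X T) f := by
  refine ⟨⟨by simp⟩, ⟨PullbackCone.IsLimit.mk _ (fun s ↦ lift (s.fst ≫ fst X T) s.snd) ?_ ?_ ?_⟩⟩
  · intro s
    ext
    · simp
    · simpa using s.condition.symm
  · intro s
    simp
  · intro s m h1 h2
    ext
    · simp [← h1]
    · simpa using h2

section

variable {k : Type u} [Field k]

lemma specOverMap_comp {R S T : Type u} [CommRing R] [Algebra k R] [CommRing S] [Algebra k S]
    [CommRing T] [Algebra k T] (f : R →ₐ[k] S) (g : S →ₐ[k] T) :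
    specOverMap g ≫ specOverMap f = specOverMap (g.comp f) := by
  ext1
  exact (Spec.map_comp _ _).symm

lemma specOverMap_id {R : Type u} [CommRing R] [Algebra k R] :
    specOverMap (AlgHom.id k R) = 𝟙 (specOver k R) := by
  ext1
  exact Spec.map_id _

instance {R S : Type u} [CommRing R] [Algebra k R] [CommRing S] [Algebra k S] (f : R →ₐ[k] S) :
    IsAffineHom (specOverMap f).left :=
  inferInstanceAs (IsAffineHom (Spec.map (CommRingCat.ofHom f.toRingHom)))

instance {R S : Type u} [CommRing R] [Algebra k R] [CommRing S] [Algebra k S] (f : R →ₐ[k] S)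
    (X : Over (Spec (.of k))) : IsAffineHom (X ◁ specOverMap f).left :=
  MorphismProperty.of_isPullback ((isPullback_whiskerLeft X (specOverMap f)).map (Over.forget
      _)).flip
    (inferInstanceAs (IsAffineHom (specOverMap f).left))

variable (k) in
/-- The finitely generated subalgebras of a `k`-algebra. -/
abbrev FGSubalgebra (R : Type u) [CommRing R] [Algebra k R] : Type u :=
  {A : Subalgebra k R // A.FG}

variable {R : Type u} [CommRing R] [Algebra k R]

instance : Bot (FGSubalgebra k R) := ⟨⟨⊥, Subalgebra.fg_bot⟩⟩

instance : IsDirectedOrder (FGSubalgebra k R) :=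
  ⟨fun A B ↦ ⟨⟨A.1 ⊔ B.1, A.2.sup B.2⟩, (le_sup_left : A.1 ≤ A.1 ⊔ B.1),
    (le_sup_right : B.1 ≤ A.1 ⊔ B.1)⟩⟩

instance : Nonempty (FGSubalgebra k R) := ⟨⊥⟩

instance (A : FGSubalgebra k R) : Algebra.FiniteType k A.1 := A.1.fg_iff_finiteType.1 A.2

/-- The diagram of the finitely generated subalgebras of `R`. -/
def fgDiagram (R : Type u) [CommRing R] [Algebra k R] : FGSubalgebra k R ⥤ CommRingCat.{u} where
  obj A := .of A.1
  map {A B} f := CommRingCat.ofHom (Subalgebra.inclusion (leOfHom f : A.1 ≤ B.1)).toRingHom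
  map_id _ := rfl
  map_comp _ _ := rfl

/-- The finitely generated subalgebras of `R` map to `R`. -/
def fgCocone (R : Type u) [CommRing R] [Algebra k R] : Cocone (fgDiagram (k := k) R) :=
  ⟨.of R, { app A := CommRingCat.ofHom A.1.val.toRingHom, naturality _ _ _ := rfl }⟩

/-- An algebra is the colimit of its finitely generated subalgebras. -/
def fgCoconeIsColimit (R : Type u) [CommRing R] [Algebra k R] :
    IsColimit (fgCocone (k := k) R) := by
  have : ReflectsColimit (fgDiagram (k := k) R) (forget CommRingCat) :=
    reflectsColimit_of_reflectsIsomorphisms _ _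
  refine isColimitOfReflects (forget CommRingCat)
    (Types.FilteredColimit.isColimitOf' _ _ ?_ ?_)
  · intro (x : R)
    exact ⟨⟨Algebra.adjoin k {x}, Subalgebra.fg_def.2 ⟨{x}, Set.finite_singleton x, rfl⟩⟩,
      (⟨x, Algebra.subset_adjoin rfl⟩ : Algebra.adjoin k {x}), rfl⟩
  · intro A x y h
    exact ⟨A, 𝟙 A, congrArg _ (Subtype.ext h : (x : A.1) = y)⟩

/-- The schemes `X × Spec A`, for the finitely generated subalgebras `A` of `R`. -/
def prodDiagram (X : Over (Spec (.of k))) (R : Type u) [CommRing R] [Algebra k R] :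
    (FGSubalgebra k R)ᵒᵖ ⥤ Over (Spec (.of k)) where
  obj A := X ⊗ specOver k A.unop.1
  map {A B} f := X ◁ specOverMap (Subalgebra.inclusion (leOfHom f.unop : B.unop.1 ≤ A.unop.1))
  map_id A := by
    rw [← MonoidalCategory.whiskerLeft_id, ← specOverMap_id]
    rfl
  map_comp f g := by
    rw [← MonoidalCategory.whiskerLeft_comp, specOverMap_comp]
    rfl

/-- The projections of `X × Spec R` to the schemes `X × Spec A`. -/
def prodCone (X : Over (Spec (.of k))) (R : Type u) [CommRing R] [Algebra k R] :
    Cone (prodDiagram X R) :=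
  ⟨X ⊗ specOver k R,
    { app A := X ◁ specOverMap A.unop.1.val
      naturality A B f := by
        refine (Category.id_comp _).trans ?_
        refine Eq.trans ?_ (MonoidalCategory.whiskerLeft_comp _ _ _)
        rw [specOverMap_comp]
        rfl }⟩

/-- The scheme `Spec R` is the limit of the `Spec A`. -/
def specConeIsLimit (R : Type u) [CommRing R] [Algebra k R] :
    IsLimit (Scheme.Spec.mapCone (fgCocone (k := k) R).op) :=
  isLimitOfPreserves Scheme.Spec (fgCoconeIsColimit R).op

lemma isPullback_prod (X : Over (Spec (.of k))) {R S : Type u} [CommRing R] [Algebra k R]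
    [CommRing S] [Algebra k S] (f : R →ₐ[k] S) :
    IsPullback (X ◁ specOverMap f).left (snd X (specOver k S)).left (snd X (specOver k R)).left
      (Spec.map (CommRingCat.ofHom f.toRingHom)) :=
  (isPullback_whiskerLeft X (specOverMap f)).map (Over.forget _)

/-- A cone over `D` is a limit if it is cartesian over a limit cone of `E`, for a transformation
`p : D ⟶ E` which is cartesian over the morphisms to a weakly terminal object. -/
def isLimitOfIsPullback {I C : Type*} [Category I] [Category C] {D E : I ⥤ C} (p : D ⟶ E) (i₀ : I)
    (t : ∀ i, i ⟶ i₀)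
    (hp : ∀ i, IsPullback (D.map (t i)) (p.app i) (p.app i₀) (E.map (t i)))
    (cD : Cone D) (cE : Cone E) (hE : IsLimit cE) (q : cD.pt ⟶ cE.pt)
    (hq : ∀ i, cD.π.app i ≫ p.app i = q ≫ cE.π.app i)
    (h₀ : IsPullback (cD.π.app i₀) q (p.app i₀) (cE.π.app i₀)) : IsLimit cD where
  lift s := h₀.lift (s.π.app i₀) (hE.lift ((Cone.postcompose p).obj s)) (by simp)
  fac s i := by
    refine (hp i).hom_ext ?_ ?_
    · rw [Category.assoc, cD.w, IsPullback.lift_fst, s.w]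
    · rw [Category.assoc, hq, IsPullback.lift_snd_assoc, hE.fac]
      rfl
  uniq s m hm := by
    refine h₀.hom_ext ?_ ?_
    · rw [hm, IsPullback.lift_fst]
    · refine hE.hom_ext fun i ↦ ?_
      rw [Category.assoc, ← hq, reassoc_of% hm, IsPullback.lift_snd, hE.fac]
      rfl

/-- The projections `X × Spec A ⟶ Spec A`. -/
def prodDiagramSnd (X : Over (Spec (.of k))) (R : Type u) [CommRing R] [Algebra k R] :
    prodDiagram X R ⋙ Over.forget _ ⟶ (fgDiagram (k := k) R).op ⋙ Scheme.Spec where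
  app A := (snd X (specOver k A.unop.1)).left
  naturality A B f := (isPullback_prod X
    (Subalgebra.inclusion (leOfHom f.unop : B.unop.1 ≤ A.unop.1))).w

/-- The projections `X × Spec A ⟶ Spec k`. -/
def prodDiagramHom (X : Over (Spec (.of k))) (R : Type u) [CommRing R] [Algebra k R] :
    prodDiagram X R ⋙ Over.forget _ ⟶ (Functor.const _).obj (Spec (.of k)) where
  app A := ((prodDiagram X R).obj A).hom
  naturality _ _ f := (Over.w ((prodDiagram X R).map f)).trans (Category.comp_id _).symm

/-- The scheme `X × Spec R` is the limit of the `X × Spec A`. -/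
def prodConeIsLimit (X : Over (Spec (.of k))) (R : Type u) [CommRing R] [Algebra k R] :
    IsLimit ((Over.forget _).mapCone (prodCone X R)) :=
  isLimitOfIsPullback (E := (fgDiagram (k := k) R).op ⋙ Scheme.Spec)
    (prodDiagramSnd X R) (.op ⊥)
    (fun A ↦ (homOfLE (bot_le : (⊥ : Subalgebra k R) ≤ A.unop.1) :
      (⊥ : FGSubalgebra k R) ⟶ A.unop).op)
    (fun A ↦ isPullback_prod X (Subalgebra.inclusion (bot_le : (⊥ : Subalgebra k R) ≤ A.unop.1)))
    _ _ (specConeIsLimit R) (snd X (specOver k R)).left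
    (fun A ↦ (isPullback_prod X A.unop.1.val).w) (isPullback_prod X _)

lemma isAffineHom_fst_specOver (X : Over (Spec (.of k))) (A : Type u) [CommRing A] [Algebra k A] :
    IsAffineHom (fst X (specOver k A)).left :=
  MorphismProperty.of_isPullback (isPullback_tensor_left X (specOver k A)).flip
    (inferInstanceAs (IsAffineHom (Spec.map (CommRingCat.ofHom (algebraMap k A)))))

instance (X : Over (Spec (.of k))) (A : Type u) [CommRing A] [Algebra k A] [CompactSpace X.left] :
    CompactSpace (X ⊗ specOver k A).left :=
  have := isAffineHom_fst_specOver X A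
  QuasiCompact.compactSpace_of_compactSpace (fst X (specOver k A)).left

instance (X : Over (Spec (.of k))) (A : Type u) [CommRing A] [Algebra k A]
    [QuasiSeparatedSpace X.left] : QuasiSeparatedSpace (X ⊗ specOver k A).left :=
  have := isAffineHom_fst_specOver X A
  quasiSeparatedSpace_of_quasiSeparated (fst X (specOver k A)).left

instance (X : Over (Spec (.of k))) (A : (FGSubalgebra k R)ᵒᵖ) [CompactSpace X.left] :
    CompactSpace ((prodDiagram X R ⋙ Over.forget _).obj A) :=
  inferInstanceAs (CompactSpace (X ⊗ specOver k A.unop.1).left)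

instance (X : Over (Spec (.of k))) (A : (FGSubalgebra k R)ᵒᵖ) [QuasiSeparatedSpace X.left] :
    QuasiSeparatedSpace ((prodDiagram X R ⋙ Over.forget _).obj A) :=
  inferInstanceAs (QuasiSeparatedSpace (X ⊗ specOver k A.unop.1).left)

instance (X : Over (Spec (.of k))) {A B : (FGSubalgebra k R)ᵒᵖ} (f : A ⟶ B) :
    IsAffineHom ((prodDiagram X R ⋙ Over.forget _).map f) :=
  inferInstanceAs (IsAffineHom (X ◁ specOverMap
    (Subalgebra.inclusion (leOfHom f.unop : B.unop.1 ≤ A.unop.1))).left)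

lemma isLocallyNoetherian_specOver (A : Type u) [CommRing A] [Algebra k A]
    [Algebra.FiniteType k A] :
    IsLocallyNoetherian (specOver k A).left := by
  have : IsNoetherianRing (CommRingCat.of A) := Algebra.FiniteType.isNoetherianRing k A
  exact inferInstanceAs (IsLocallyNoetherian (Spec (.of A)))

/-- A morphism `X × Spec R ⟶ Q` is defined over a finitely generated subalgebra of `R`. -/
lemma exists_prod_hom_eq {X Q : Over (Spec (.of k))} [CompactSpace X.left]
    [QuasiSeparatedSpace X.left] [LocallyOfFiniteType Q.hom] (f : X ⊗ specOver k R ⟶ Q) :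
    ∃ (A : FGSubalgebra k R) (g : X ⊗ specOver k A.1 ⟶ Q), X ◁ specOverMap A.1.val ≫ g = f := by
  have : IsLocallyNoetherian (Spec (.of k)) := isLocallyNoetherian_specOver (k := k) k
  have : LocallyOfFinitePresentation Q.hom := inferInstance
  obtain ⟨A, g, h1, h2⟩ := Scheme.exists_π_app_comp_eq_of_locallyOfFinitePresentation
    (prodDiagram X R ⋙ Over.forget _) (prodDiagramHom X R) Q.hom _ (prodConeIsLimit X R) f.left (by
      ext A
      refine (Over.w ((prodCone X R).π.app A)).trans ?_
      exact (Over.w f).symm)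
  exact ⟨A.unop, Over.homMk g h2, Over.OverMorphism.ext h1⟩

/-- Two morphisms `X × Spec A ⟶ Q` which agree on `X × Spec R` agree on `X × Spec B` for some
finitely generated subalgebra `B` of `R` containing `A`. -/
lemma exists_prod_hom_eq_hom {X Q : Over (Spec (.of k))} [CompactSpace X.left]
    [LocallyOfFiniteType Q.hom] {A : FGSubalgebra k R}
    (f g : X ⊗ specOver k A.1 ⟶ Q)
    (h : X ◁ specOverMap A.1.val ≫ f = X ◁ specOverMap A.1.val ≫ g) :
    ∃ (B : FGSubalgebra k R) (hAB : A.1 ≤ B.1), X ◁ specOverMap (Subalgebra.inclusion hAB) ≫ f =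
      X ◁ specOverMap (Subalgebra.inclusion hAB) ≫ g := by
  obtain ⟨B, hAB, h'⟩ := Scheme.exists_hom_comp_eq_comp_of_locallyOfFiniteType
    (prodDiagram X R ⋙ Over.forget _) (prodDiagramHom X R) Q.hom _ (prodConeIsLimit X R)
        (i := .op A)
    f.left g.left (Over.w f).symm (Over.w g).symm
    (congrArg (fun (x : X ⊗ specOver k R ⟶ Q) ↦ x.left) h)
  exact ⟨B.unop, leOfHom hAB.unop, Over.OverMorphism.ext h'⟩

end

/-! ### Specialization of finite fibres -/

/-- If `x` were transcendental over `A`, then `L ⊗ D` would contain `L ⊗ A[x] = L[x]`, by flatness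
of `L`. -/
lemma isAlgebraic_of_finite_tensorProduct {A D L : Type*} [CommRing A] [IsDomain A] [CommRing D]
    [Algebra A D] [Field L] [Algebra A L] [FaithfulSMul A L] [Module.Finite L (L ⊗[A] D)] (x : D) :
    IsAlgebraic A x := by
  by_contra h
  have hinj : Function.Injective (Polynomial.aeval x : Polynomial A →ₐ[A] D) :=
    transcendental_iff_injective.1 h
  let := FractionRing.liftAlgebra A L
  have := FractionRing.isScalarTower_liftAlgebra A L
  have : Module.Flat A (FractionRing A) := IsLocalization.flat _ (nonZeroDivisors A)
  have : Module.Flat A L := Module.Flat.trans A (FractionRing A) L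
  have hinj' : Function.Injective
      ((Polynomial.aeval x : Polynomial A →ₐ[A] D).toLinearMap.baseChange L) :=
    Module.Flat.lTensor_preserves_injective_linearMap (M := L) _ hinj
  have : Module.Finite L (L ⊗[A] Polynomial A) := Module.Finite.of_injective _ hinj'
  have := Module.Finite.finite_basis ((Polynomial.basisMonomials A).baseChange L)
  exact not_finite ℕ

/-- If the generic fibre of `Spec D` over `Spec A` is finite, then so are the fibres over the points
where the leading coefficients of the equations satisfied by generators of `D` do not vanish. -/
lemma exists_ne_zero_forall_finite_tensorProduct {A D L : Type*} [CommRing A] [IsDomain A]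
    [CommRing D] [Algebra A D] [Algebra.FiniteType A D] [Field L] [Algebra A L] [FaithfulSMul A L]
    [Module.Finite L (L ⊗[A] D)] :
    ∃ s : A, s ≠ 0 ∧ ∀ (E : Type u) [Field E] [Algebra A E], algebraMap A E s ≠ 0 →
      Module.Finite E (E ⊗[A] D) := by
  obtain ⟨S, hS⟩ := (inferInstance : Algebra.FiniteType A D).out
  choose P hP hP' using isAlgebraic_of_finite_tensorProduct (A := A) (D := D) (L := L)
  refine ⟨∏ x ∈ S, (P x).leadingCoeff, ?_, fun E _ _ hs ↦ ?_⟩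
  · exact Finset.prod_ne_zero_iff.2 fun x _ ↦ Polynomial.leadingCoeff_ne_zero.2 (hP x)
  have hx : ∀ x ∈ S, IsIntegral E (1 ⊗ₜ[A] x : E ⊗[A] D) := by
    intro x hx
    have h1 := (isIntegral_leadingCoeff_smul (P x) x (hP' x)).map
      (Algebra.TensorProduct.includeRight : D →ₐ[A] E ⊗[A] D)
    have h2 : algebraMap A E (P x).leadingCoeff ≠ 0 := by
      rw [map_prod, Finset.prod_ne_zero_iff] at hs
      exact hs x hx
    have h3 : IsIntegral E (algebraMap A E (P x).leadingCoeff • (1 ⊗ₜ[A] x : E ⊗[A] D)) := by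
      rw [algebraMap_smul]
      rw [map_smul] at h1
      exact h1.tower_top
    have h4 := h3.smul (algebraMap A E (P x).leadingCoeff)⁻¹
    rwa [smul_smul, inv_mul_cancel₀ h2, one_smul] at h4
  have hD : ∀ d : D, IsIntegral E (1 ⊗ₜ[A] d : E ⊗[A] D) := by
    intro d
    have hle : Algebra.adjoin A (S : Set D) ≤ ((integralClosure E (E ⊗[A] D)).restrictScalars
        A).comap
        (Algebra.TensorProduct.includeRight : D →ₐ[A] E ⊗[A] D) :=
      Algebra.adjoin_le hx
    exact hle (hS ▸ Algebra.mem_top)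
  have : Algebra.IsIntegral E (E ⊗[A] D) := by
    refine ⟨fun z ↦ ?_⟩
    induction z with
    | zero => exact isIntegral_zero
    | tmul e d =>
      have := (hD d).smul e
      rwa [TensorProduct.smul_tmul', smul_eq_mul, _root_.mul_one] at this
    | add x y hx hy => exact hx.add hy
  exact Algebra.IsIntegral.finite

lemma iff_of_isPullback (W : MorphismProperty Scheme.{u}) [W.IsStableUnderBaseChange]
    {P P' X T S : Scheme.{u}} {a : P ⟶ X} {b : P ⟶ T} {a' : P' ⟶ X} {b' : P' ⟶ T} {f : X ⟶ S}
    {g : T ⟶ S} (h : IsPullback a b f g) (h' : IsPullback a' b' f g) : W b ↔ W b' := by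
  have := MorphismProperty.IsStableUnderBaseChange.respectsIso (P := W)
  rw [← h.isoIsPullback_hom_snd _ _ h', W.cancel_left_of_respectsIso]

lemma isFinite_iff_of_isPullback {A D L : Type u} [CommRing A] [CommRing D] [Algebra A D]
    [CommRing L]
    [Algebra A L] {P : Scheme.{u}} {a : P ⟶ Spec (.of D)} {b : P ⟶ Spec (.of L)}
    (h : IsPullback a b (Spec.map (CommRingCat.ofHom (algebraMap A D)))
      (Spec.map (CommRingCat.ofHom (algebraMap A L)))) :
    IsFinite b ↔ Module.Finite L (L ⊗[A] D) := by
  have h2 := (isPullback_SpecMap_of_isPushout _ _ _ _ (CommRingCat.isPushout_tensorProduct A L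
      D)).flip
  exact (iff_of_isPullback (@IsFinite) h h2).trans
    ((IsFinite.SpecMap_iff _).trans RingHom.finite_algebraMap)

/-- Over a field, finiteness of a quasi-compact morphism is local on the source, since it amounts to
local quasi-finiteness. -/
lemma isFinite_iff_openCover {K S T : Scheme.{u}} [IsLocallyArtinian T] (g : K ⟶ S) (ρ : T ⟶ S)
    [QuasiCompact g] (𝒰 : K.OpenCover) [∀ i, QuasiCompact (𝒰.f i ≫ g)] :
    IsFinite (pullback.snd g ρ) ↔ ∀ i, IsFinite (pullback.snd (𝒰.f i ≫ g) ρ) := by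
  have h1 {X Y : Scheme.{u}} (f : X ⟶ Y) [QuasiCompact f] [IsLocallyArtinian Y] :
      IsFinite f ↔ LocallyQuasiFinite f :=
    ⟨fun _ ↦ inferInstance, fun _ ↦ .of_locallyQuasiFinite f⟩
  simp only [h1]
  rw [(HasRingHomProperty.instIsZariskiLocalAtSource (P := @LocallyQuasiFinite)).iff_of_openCover
    (𝒰.pullback₁ (pullback.fst g ρ))]
  refine forall_congr' fun i ↦ ?_
  have h2 := (IsPullback.of_hasPullback (pullback.fst g ρ) (𝒰.f i)).flip.paste_vert
    (IsPullback.of_hasPullback g ρ)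
  exact iff_of_isPullback (@LocallyQuasiFinite) h2 (IsPullback.of_hasPullback (𝒰.f i ≫ g) ρ)

/-- If the generic fibre of a scheme of finite type over `Spec A` is finite, then so are the fibres
over a nonempty principal open subset. -/
lemma exists_isFinite_pullback {A L : Type u} [CommRing A] [IsDomain A] [Field L] [Algebra A L]
    [FaithfulSMul A L] {K : Scheme.{u}} (g : K ⟶ Spec (.of A)) [LocallyOfFiniteType g]
    [CompactSpace K] (h : IsFinite (pullback.snd g (Spec.map (CommRingCat.ofHom (algebraMap A
        L))))) :
    ∃ s : A, s ≠ 0 ∧ ∀ (E : Type u) [Field E] (r : A →+* E), r s ≠ 0 →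
      IsFinite (pullback.snd g (Spec.map (CommRingCat.ofHom r))) := by
  let 𝒰 := K.affineCover.finiteSubcover
  have hg : QuasiCompact g := inferInstance
  have hgi (i : 𝒰.I₀) : QuasiCompact (𝒰.f i ≫ g) := inferInstance
  have hart (E : Type u) [Field E] : IsLocallyArtinian (Spec (.of E)) := by
    have : IsArtinianRing (CommRingCat.of E) := inferInstanceAs (IsArtinianRing E)
    infer_instance
  have := hart L
  rw [isFinite_iff_openCover g _ 𝒰] at h
  have hex (i : 𝒰.I₀) : ∃ (D : Type u) (_ : CommRing D) (_ : Algebra A D)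
      (e : 𝒰.X i ≅ Spec (.of D)),
      e.inv ≫ 𝒰.f i ≫ g = Spec.map (CommRingCat.ofHom (algebraMap A D)) := by
    let φ : CommRingCat.of A ⟶ Γ(𝒰.X i, ⊤) := Spec.preimage ((𝒰.X i).isoSpec.inv ≫ 𝒰.f i ≫ g)
    exact ⟨Γ(𝒰.X i, ⊤), inferInstance, φ.hom.toAlgebra, (𝒰.X i).isoSpec, (Spec.map_preimage _).symm⟩
  choose D _ _ e he using hex
  have hft (i : 𝒰.I₀) : Algebra.FiniteType A (D i) := by
    have : LocallyOfFiniteType (Spec.map (CommRingCat.ofHom (algebraMap A (D i)))) := by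
      rw [← he]
      infer_instance
    exact RingHom.finiteType_algebraMap.1 (HasRingHomProperty.Spec_iff.1 this)
  have key (i : 𝒰.I₀) (E : Type u) [Field E] [Algebra A E] :
      IsFinite (pullback.snd (𝒰.f i ≫ g) (Spec.map (CommRingCat.ofHom (algebraMap A E)))) ↔
        Module.Finite E (E ⊗[A] D i) := by
    refine isFinite_iff_of_isPullback (a := pullback.fst _ _ ≫ (e i).hom) ?_
    exact (IsPullback.of_hasPullback (𝒰.f i ≫ g) _).of_iso (Iso.refl _) (e i) (Iso.refl _)
      (Iso.refl _) (by simp) (by simp) (by simp [← he]) (by simp)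
  have hs (i : 𝒰.I₀) : ∃ s : A, s ≠ 0 ∧ ∀ (E : Type u) [Field E] [Algebra A E],
      algebraMap A E s ≠ 0 → Module.Finite E (E ⊗[A] D i) := by
    have := (key i L).1 (h i)
    exact exists_ne_zero_forall_finite_tensorProduct (L := L)
  choose s hs hs' using hs
  refine ⟨∏ i, s i, Finset.prod_ne_zero_iff.2 fun i _ ↦ hs i, fun E _ r hr ↦ ?_⟩
  let := r.toAlgebra
  have := hart E
  rw [map_prod, Finset.prod_ne_zero_iff] at hr
  rw [isFinite_iff_openCover g _ 𝒰]
  exact fun i ↦ (key i E).2 (hs' i E (hr i (Finset.mem_univ i)))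

/-! ### Specialization of dense images -/

/-- A nonempty set `N` has a nonempty relatively open subset contained in the constructible set `E`
or disjoint from it. -/
lemma exists_isOpen_inter_subset_or {X : Type*} [TopologicalSpace X] {E : Set X}
    (hE : Topology.IsConstructible E) : ∀ N : Set X, N.Nonempty →
      ∃ O : Set X, IsOpen O ∧ (O ∩ N).Nonempty ∧ (O ∩ N ⊆ E ∨ O ∩ N ⊆ Eᶜ) := by
  induction hE using Topology.IsConstructible.empty_union_induction with
  | open_retrocompact U hU _ =>
    intro N hN
    by_cases h : (U ∩ N).Nonempty
    · exact ⟨U, hU, h, .inl Set.inter_subset_left⟩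
    · refine ⟨Set.univ, isOpen_univ, by simpa using hN, .inr fun x hx hxU ↦ h ⟨x, hxU, hx.2⟩⟩
  | union s _ t _ hs ht =>
    intro N hN
    obtain ⟨O, hO, hne, h | h⟩ := hs N hN
    · exact ⟨O, hO, hne, .inl (h.trans Set.subset_union_left)⟩
    obtain ⟨O', hO', hne', h'⟩ := ht _ hne
    rw [← Set.inter_assoc] at hne' h'
    refine ⟨O' ∩ O, hO'.inter hO, hne', h'.imp (·.trans Set.subset_union_right) fun h' ↦ ?_⟩
    rw [Set.compl_union]
    exact Set.subset_inter (fun x hx ↦ h ⟨hx.1.2, hx.2⟩) h'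
  | compl s _ hs =>
    intro N hN
    obtain ⟨O, hO, hne, h⟩ := hs N hN
    exact ⟨O, hO, hne, by rwa [compl_compl, or_comm]⟩

/-- A constructible set contains a nonempty open subset of its closure. -/
lemma exists_isOpen_inter_closure_subset {X : Type*} [TopologicalSpace X] {E : Set X}
    (hE : Topology.IsConstructible E) (hne : E.Nonempty) :
    ∃ O : Set X, IsOpen O ∧ (O ∩ closure E).Nonempty ∧ O ∩ closure E ⊆ E := by
  obtain ⟨O, hO, ⟨x, hx, hx'⟩, h | h⟩ := exists_isOpen_inter_subset_or hE _ hne.closure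
  · exact ⟨O, hO, ⟨x, hx, hx'⟩, h⟩
  · obtain ⟨y, hy, hyE⟩ := mem_closure_iff.1 hx' O hO hx
    exact absurd hyE (h ⟨hy, subset_closure hyE⟩)

lemma isPullback_whiskerRight {C : Type*} [Category C] [CartesianMonoidalCategory C] {X Y : C}
    (f : X ⟶ Y) (S : C) : IsPullback (f ▷ S) (fst X S) (fst Y S) f := by
  refine ⟨⟨by simp⟩, ⟨PullbackCone.IsLimit.mk _ (fun s ↦ lift s.snd (s.fst ≫ snd Y S)) ?_ ?_ ?_⟩⟩
  · intro s
    ext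
    · simpa using s.condition.symm
    · simp
  · intro s
    simp
  · intro s m h1 h2
    ext
    · simpa using h2
    · simp [← h1]

/-- The fibre of a family `w` of morphisms `W ⟶ Q` parametrized by `S`, over a point of `S`. -/
lemma isPullback_lift_point {C : Type*} [Category C] [CartesianMonoidalCategory C] {W S Q : C}
    (w : W ⊗ S ⟶ Q) (r : 𝟙_ C ⟶ S) :
    IsPullback (lift (𝟙 W) (toUnit W ≫ r) ≫ w) (lift (𝟙 W) (toUnit W ≫ r))
      (lift (𝟙 Q) (toUnit Q ≫ r)) (lift w (snd W S)) := by
  refine ⟨⟨?_⟩, ⟨PullbackCone.IsLimit.mk _ (fun s ↦ s.snd ≫ fst W S) ?_ ?_ ?_⟩⟩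
  · ext <;> simp
  · intro s
    have h1 := congrArg (· ≫ fst Q S) s.condition
    have h2 := congrArg (· ≫ snd Q S) s.condition
    have h3 : (s.snd ≫ fst W S) ≫ lift (𝟙 W) (toUnit W ≫ r) = s.snd := by
      ext
      · simp
      · simpa using h2
    simp only [Category.assoc, lift_fst, Category.comp_id] at h1
    rw [← Category.assoc, h3, ← h1]
  · intro s
    have h2 := congrArg (· ≫ snd Q S) s.condition
    ext
    · simp
    · simpa using h2
  · intro s m h1 h2
    simp [← h2]

section

variable {k : Type u} [Field k]

lemma denseRange_whiskerLeft (X : Over (Spec (.of k))) {A L : Type u} [CommRing A] [CommRing L]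
    [Algebra k A] [Algebra k L] (f : A →ₐ[k] L) (hf : Function.Injective f) :
    DenseRange (X ◁ specOverMap f).left := by
  have h : DenseRange (Spec.map (CommRingCat.ofHom f.toRingHom)) := by
    refine (PrimeSpectrum.denseRange_comap_iff_ker_le_nilRadical f.toRingHom).2 ?_
    exact ((RingHom.injective_iff_ker_eq_bot f.toRingHom).1 hf).trans_le bot_le
  have h2 : UniversallyOpen (snd X (specOver k A)).left :=
    MorphismProperty.of_isPullback (isPullback_tensor_left X (specOver k A))
      (inferInstance : UniversallyOpen X.hom)
  rw [DenseRange, range_fst_of_isPullback (isPullback_prod X f)]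
  exact h.preimage (snd X (specOver k A)).left.isOpenMap

lemma isOpenMap_fst_left (X S : Over (Spec (.of k))) : IsOpenMap (fst X S).left := by
  have : UniversallyOpen (fst X S).left :=
    MorphismProperty.of_isPullback (isPullback_tensor_left X S).flip
      (inferInstance : UniversallyOpen S.hom)
  exact (fst X S).left.isOpenMap

lemma comp_left_apply {X Y Z : Over (Spec (.of k))} (f : X ⟶ Y) (g : Y ⟶ Z) (x : X.left) :
    (f ≫ g).left x = g.left (f.left x) := rfl

/-- Let `L` be a ring containing `A`. If the closure of the image of the family `w` over `L` is the
constant family with fibre the closure of the image of `y`, then so is the closure of the image of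
`w` over `A`. -/
lemma closure_range_lift {W Y Q : Over (Spec (.of k))} (y : Y ⟶ Q) {A L : Type u}
    [CommRing A] [CommRing L] [Algebra k A] [Algebra k L] (f : A →ₐ[k] L)
    (hf : Function.Injective f) (w : W ⊗ specOver k A ⟶ Q)
    (hw : closure (Set.range (lift (W ◁ specOverMap f ≫ w) (snd W (specOver k L))).left) =
      (fst Q (specOver k L)).left ⁻¹' closure (Set.range y.left)) :
    closure (Set.range (lift w (snd W (specOver k A))).left) =
      (fst Q (specOver k A)).left ⁻¹' closure (Set.range y.left) := by
  set Ψ := lift (W ◁ specOverMap f ≫ w) (snd W (specOver k L)) with hΨ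
  set Φ := lift w (snd W (specOver k A)) with hΦ
  have hΨΦ : Ψ ≫ Q ◁ specOverMap f = W ◁ specOverMap f ≫ Φ := by
    ext1 <;> simp [hΨ, hΦ]
  apply subset_antisymm
  · refine closure_minimal ?_ (isClosed_closure.preimage (fst Q (specOver k A)).left.continuous)
    rintro _ ⟨a, rfl⟩
    show a ∈ (Φ ≫ fst Q (specOver k A)).left ⁻¹' closure (Set.range y.left)
    rw [lift_fst]
    have hcl : IsClosed (w.left ⁻¹' closure (Set.range y.left)) :=
      isClosed_closure.preimage w.left.continuous
    refine hcl.closure_subset_iff.2 ?_ (denseRange_whiskerLeft W f hf a)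
    rintro _ ⟨c, rfl⟩
    have h := hw.le (subset_closure (Set.mem_range_self c))
    have h' : Ψ ≫ fst Q (specOver k L) = W ◁ specOverMap f ≫ w := lift_fst _ _
    rw [Set.mem_preimage, ← comp_left_apply, h'] at h
    exact h
  · rw [(isOpenMap_fst_left Q (specOver k A)).preimage_closure_eq_closure_preimage
      (fst Q (specOver k A)).left.continuous]
    refine closure_minimal ?_ isClosed_closure
    have h1 : Set.range (y ▷ specOver k A).left =
        (fst Q (specOver k A)).left ⁻¹' Set.range y.left :=
      range_fst_of_isPullback ((isPullback_whiskerRight y (specOver k A)).map (Over.forget _))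
    rw [← h1]
    rintro _ ⟨a, rfl⟩
    have hcl : IsClosed ((y ▷ specOver k A).left ⁻¹' closure (Set.range Φ.left)) :=
      isClosed_closure.preimage (y ▷ specOver k A).left.continuous
    refine hcl.closure_subset_iff.2 ?_ (denseRange_whiskerLeft Y f hf a)
    rintro _ ⟨c, rfl⟩
    rw [Set.mem_preimage, ← comp_left_apply, whisker_exchange, comp_left_apply]
    have h2 : (y ▷ specOver k L).left c ∈ closure (Set.range Ψ.left) := by
      rw [hw, Set.mem_preimage, ← comp_left_apply, whiskerRight_fst]
      exact subset_closure ⟨(fst Y (specOver k L)).left c, rfl⟩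
    have h3 := image_closure_subset_closure_image (Q ◁ specOverMap f).left.continuous
      (Set.mem_image_of_mem _ h2)
    refine closure_mono ?_ h3
    rintro _ ⟨_, ⟨e, rfl⟩, rfl⟩
    rw [← comp_left_apply, hΨΦ]
    exact ⟨(W ◁ specOverMap f).left e, rfl⟩

/-- If the closure of the image of the generic member of the family `w` is the closure of the image
of `y`, then so is the closure of the image of some member over a rational point `r`. By Chevalley,
the image of the family is constructible, so it contains a nonempty open subset of its closure
`closure (range y) × Spec A`, and `r` is chosen below a rational point of that subset. -/
lemma exists_point_closure_range_eq [IsAlgClosed k] {W Y Q : Over (Spec (.of k))}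
    [CompactSpace W.left]
    [Nonempty W.left] [LocallyOfFiniteType W.hom] [LocallyOfFiniteType Q.hom]
    [QuasiSeparatedSpace Q.left] [CompactSpace Q.left] (y : Y ⟶ Q)
    (hy : IsPreirreducible (Set.range y.left)) {A L : Type u}
    [CommRing A] [CommRing L] [Nontrivial L] [Algebra k A] [Algebra k L] [Algebra.FiniteType k A]
    (f : A →ₐ[k] L) (hf : Function.Injective f) (w : W ⊗ specOver k A ⟶ Q)
    (hw : closure (Set.range (lift (W ◁ specOverMap f ≫ w) (snd W (specOver k L))).left) =
      (fst Q (specOver k L)).left ⁻¹' closure (Set.range y.left)) :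
    ∃ r : 𝟙_ (Over (Spec (.of k))) ⟶ specOver k A,
      closure (Set.range (lift (𝟙 W) (toUnit W ≫ r) ≫ w).left) = closure (Set.range y.left) := by
  have hE := closure_range_lift y f hf w hw
  set Φ := lift w (snd W (specOver k A)) with hΦ
  have hft : LocallyOfFiniteType (specOver k A).hom :=
    HasRingHomProperty.Spec_iff.2 (RingHom.finiteType_algebraMap.2 ‹_›)
  have hft' (X : Over (Spec (.of k))) [LocallyOfFiniteType X.hom] :
      LocallyOfFiniteType (X ⊗ specOver k A).hom := by
    rw [← Over.w (fst X (specOver k A))]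
    have : LocallyOfFiniteType (fst X (specOver k A)).left :=
      MorphismProperty.of_isPullback (isPullback_tensor_left X (specOver k A)).flip hft
    infer_instance
  have := hft' Q
  have hcon : Topology.IsConstructible (Set.range Φ.left) := by
    have : IsLocallyNoetherian (Spec (.of k)) := isLocallyNoetherian_specOver (k := k) k
    have : IsLocallyNoetherian (Q ⊗ specOver k A).left :=
      LocallyOfFiniteType.isLocallyNoetherian (Q ⊗ specOver k A).hom
    have : LocallyOfFiniteType (Φ.left ≫ (Q ⊗ specOver k A).hom) := by
      rw [Over.w]
      exact hft' W
    have : LocallyOfFiniteType Φ.left := locallyOfFiniteType_of_comp _ (Q ⊗ specOver k A).hom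
    have : LocallyOfFinitePresentation Φ.left := inferInstance
    rw [← Set.image_univ]
    exact Φ.left.isConstructible_image .univ
  have hne : (Set.range Φ.left).Nonempty := by
    obtain ⟨a⟩ := ‹Nonempty W.left›
    have : Nontrivial A := f.toRingHom.domain_nontrivial
    obtain ⟨s⟩ := PrimeSpectrum.nonempty_iff_nontrivial.2 ‹Nontrivial A›
    obtain ⟨c, -⟩ := Scheme.Pullback.exists_preimage_pullback (f := W.hom) (g := (specOver k A).hom)
      a s (Subsingleton.elim (α := PrimeSpectrum k) _ _)
    exact ⟨_, c, rfl⟩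
  obtain ⟨O, hO, hO1, hO2⟩ := exists_isOpen_inter_closure_subset hcon hne
  rw [hE] at hO1 hO2
  have hcl : IsClosed ((fst Q (specOver k A)).left ⁻¹' closure (Set.range y.left)) :=
    isClosed_closure.preimage (fst Q (specOver k A)).left.continuous
  obtain ⟨x, hx⟩ := exists_point_mem hO1 (hO.isLocallyClosed.inter hcl.isLocallyClosed)
  let r := x ≫ snd Q (specOver k A)
  refine ⟨r, ?_⟩
  let σ := lift (𝟙 Q) (toUnit Q ≫ r)
  have hr : Set.range (lift (𝟙 W) (toUnit W ≫ r) ≫ w).left = σ.left ⁻¹' Set.range Φ.left :=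
    range_fst_of_isPullback ((isPullback_lift_point w r).map (Over.forget _))
  have hσ (q : Q.left) : (fst Q (specOver k A)).left (σ.left q) = q := by
    rw [← comp_left_apply, lift_fst]
    rfl
  rw [hr]
  refine subset_antisymm ?_ ?_
  · refine closure_minimal ?_ isClosed_closure
    rintro q hq
    have := hE.le (subset_closure hq)
    rwa [Set.mem_preimage, hσ] at this
  · let t₀ : (𝟙_ (Over (Spec (.of k)))).left := IsLocalRing.closedPoint k
    have h1 : (closure (Set.range y.left) ∩ σ.left ⁻¹' O).Nonempty := by
      refine ⟨(x ≫ fst Q (specOver k A)).left t₀, (hx t₀).2, ?_⟩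
      have : (x ≫ fst Q (specOver k A)) ≫ σ = x := by
        ext1 <;> simp [σ, r]
      rw [Set.mem_preimage, ← comp_left_apply, this]
      exact (hx t₀).1
    refine (subset_closure_inter_of_isPreirreducible_of_isOpen hy.closure
      (hO.preimage σ.left.continuous) h1).trans (closure_mono ?_)
    rintro q ⟨hq, hq'⟩
    exact hO2 ⟨hq', by rwa [Set.mem_preimage, hσ]⟩

end

/-! ### Specialization of homomorphisms -/

/-- For a family `H` of morphisms `M ⟶ Q` parametrized by `S`, and a morphism `t : T ⟶ S`, the
kernel of the family over `T` is the base change along `t` of the kernel of `H`. -/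
lemma exists_isPullback_whiskerLeft {C : Type*} [Category C] [CartesianMonoidalCategory C]
    {M S T Q K P : C} {H : M ⊗ S ⟶ Q} {e : 𝟙_ C ⟶ Q} {j : K ⟶ M ⊗ S}
    (h : IsPullback j (toUnit K) H e) (t : T ⟶ S) {a : P ⟶ K} {b : P ⟶ T}
    (hP : IsPullback a b (j ≫ snd M S) t) :
    ∃ c : P ⟶ M ⊗ T, c ≫ snd M T = b ∧ IsPullback c (toUnit P) (M ◁ t ≫ H) e := by
  have hw := isPullback_whiskerLeft M t
  refine ⟨hw.lift (a ≫ j) b (by simpa using hP.w), hw.lift_snd _ _ _, ?_⟩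
  have h1 : IsPullback a (hw.lift (a ≫ j) b (by simpa using hP.w)) j (M ◁ t) := by
    refine IsPullback.of_bot ?_ (hw.lift_fst _ _ _).symm hw
    rwa [hw.lift_snd]
  have h2 := h1.flip.paste_vert h
  rwa [toUnit_unique (a ≫ toUnit K) (toUnit P)] at h2

lemma isFinite_snd_iff {X T Q Q' S P : Scheme.{u}} {f : X ⟶ Q'} {e : T ⟶ Q'} {a : T ⟶ S}
    {q : Q' ⟶ Q} {e₀ : S ⟶ Q} (h : IsPullback e a q e₀) {c : P ⟶ X} {d : P ⟶ S}
    (hc : IsPullback c d (f ≫ q) e₀) (s : X ⟶ T) (hs : pullback.snd f e = pullback.fst f e ≫ s) :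
    IsFinite (pullback.snd f e) ↔ IsFinite (c ≫ s) := by
  have h2 := (IsPullback.of_hasPullback f e).paste_vert h
  have := MorphismProperty.IsStableUnderBaseChange.respectsIso
    (P := (@IsFinite : MorphismProperty Scheme.{u}))
  rw [hs, ← h2.isoIsPullback_hom_fst _ _ hc, Category.assoc]
  exact MorphismProperty.cancel_left_of_respectsIso (P := (@IsFinite : MorphismProperty
      Scheme.{u})) _ _

section

variable {k : Type u} [Field k]

/-- The scheme `X_K`, regarded as a scheme over `k`, is `X × Spec K`. -/
def restrictScalarsBaseChange (K : Type u) [Field K] [Algebra k K] (X : Over (Spec (.of k))) :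
    (restrictScalars k K).obj ((baseChange k K).obj X) ≅ X ⊗ specOver k K :=
  Over.isoMk (Iso.refl _) ((Category.id_comp _).trans pullback.condition)

variable {K : Type u} [Field K] [Algebra k K]

lemma restrictScalarsBaseChange_hom_fst (X : Over (Spec (.of k))) :
    ((restrictScalarsBaseChange K X).hom ≫ fst X _).left = pullback.fst X.hom _ :=
  Category.id_comp _

lemma restrictScalarsBaseChange_hom_snd (X : Over (Spec (.of k))) :
    ((restrictScalarsBaseChange K X).hom ≫ snd X (specOver k K)).left =
      ((baseChange k K).obj X).hom :=
  Category.id_comp _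

lemma restrictScalarsBaseChange_naturality {X Y : Over (Spec (.of k))} (x : X ⟶ Y) :
    (restrictScalars k K).map ((baseChange k K).map x) ≫ (restrictScalarsBaseChange K Y).hom =
      (restrictScalarsBaseChange K X).hom ≫ x ▷ specOver k K := by
  ext1
  · rw [Category.assoc, Category.assoc, whiskerRight_fst, ← Category.assoc _ _ x]
    ext1
    rw [Over.comp_left, restrictScalarsBaseChange_hom_fst, Over.comp_left _ _ _ _ x,
      restrictScalarsBaseChange_hom_fst]
    exact baseChange_map_left_fst x
  · rw [Category.assoc, Category.assoc, whiskerRight_snd]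
    ext1
    rw [Over.comp_left, restrictScalarsBaseChange_hom_snd, restrictScalarsBaseChange_hom_snd]
    exact Over.w ((baseChange k K).map x)

/-- A morphism `X_K ⟶ Q_K` as a family of morphisms `X ⟶ Q` parametrized by `Spec K`. -/
def toProd {X Q : Over (Spec (.of k))} [GrpObj Q]
    (f : (baseChange k K).obj X ⟶ (baseChange k K).obj Q) :
    X ⊗ specOver k K ⟶ Q :=
  (restrictScalarsBaseChange K X).inv ≫ (pointsEquiv _ Q).symm f

section

variable {X Y Q : Over (Spec (.of k))} [GrpObj Q]

lemma restrictScalarsBaseChange_hom_toProd_left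
    (f : (baseChange k K).obj X ⟶ (baseChange k K).obj Q) :
    ((restrictScalarsBaseChange K X).hom ≫ toProd f).left = f.left ≫ pullback.fst _ _ := by
  rw [toProd, Iso.hom_inv_id_assoc, ← pointsEquiv_left_fst, MulEquiv.apply_symm_apply]

lemma toProd_mul (f g : (baseChange k K).obj X ⟶ (baseChange k K).obj Q) :
    toProd (f * g) = toProd f * toProd g := by
  rw [toProd, _root_.map_mul, comp_mul]
  rfl

lemma toProd_map_comp (x : X ⟶ Y) (f : (baseChange k K).obj Y ⟶ (baseChange k K).obj Q) :
    toProd ((baseChange k K).map x ≫ f) = x ▷ specOver k K ≫ toProd f := by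
  rw [← cancel_epi (restrictScalarsBaseChange K X).hom, ← Category.assoc _ (x ▷ _),
    ← restrictScalarsBaseChange_naturality, Category.assoc]
  ext1
  rw [restrictScalarsBaseChange_hom_toProd_left, Over.comp_left _ _ _ ((restrictScalars k K).map _),
    restrictScalarsBaseChange_hom_toProd_left]
  exact Category.assoc _ _ _

lemma restrictScalarsBaseChange_hom_lift_toProd
    (f : (baseChange k K).obj X ⟶ (baseChange k K).obj Q) :
    (restrictScalarsBaseChange K X).hom ≫ lift (toProd f) (snd X _) =
      (restrictScalars k K).map f ≫ (restrictScalarsBaseChange K Q).hom := by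
  ext1
  · ext1
    rw [Category.assoc, lift_fst, restrictScalarsBaseChange_hom_toProd_left, Category.assoc,
      Over.comp_left, restrictScalarsBaseChange_hom_fst]
    rfl
  · ext1
    rw [Category.assoc, lift_snd, restrictScalarsBaseChange_hom_snd, Category.assoc,
      Over.comp_left, restrictScalarsBaseChange_hom_snd]
    exact (Over.w f).symm

lemma closure_range_lift_toProd (f : (baseChange k K).obj X ⟶ (baseChange k K).obj Q)
    {Z : Set Q.left} (hZ : closure (Set.range f.left) = pullback.fst Q.hom _ ⁻¹' Z) :
    closure (Set.range (lift (toProd f) (snd X (specOver k K))).left) =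
      (fst Q (specOver k K)).left ⁻¹' Z := by
  have h1 : (lift (toProd f) (snd X (specOver k K))).left = f.left := by
    have := congrArg (fun g ↦ g.left) (restrictScalarsBaseChange_hom_lift_toProd f)
    exact ((Category.id_comp _).symm.trans this).trans (Category.comp_id _)
  rw [h1]
  exact hZ

/-- A homomorphism over `K`, as a family parametrized by `Spec K`, is multiplicative. -/
lemma toProd_comp_mul [GrpObj Y] (h : (baseChange k K).obj Y ⟶ (baseChange k K).obj Q) [IsMonHom h]
    (x y : X ⟶ Y) : (x * y) ▷ specOver k K ≫ toProd h =
      (x ▷ specOver k K ≫ toProd h) * (y ▷ specOver k K ≫ toProd h) := by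
  rw [← toProd_map_comp, ← toProd_map_comp, ← toProd_map_comp, Functor.map_mul, mul_comp,
      toProd_mul]

/-- The kernel of `h : X_K ⟶ Q_K` is the fibre over the unit section of the family of morphisms
`X ⟶ Q` parametrized by `Spec K`. -/
lemma hasFiniteKernel_iff_toProd {h : (baseChange k K).obj X ⟶ (baseChange k K).obj Q}
    {P : Over (Spec (.of k))} {c : P ⟶ X ⊗ specOver k K}
    (hc : IsPullback c (toUnit P) (toProd h) η[Q]) :
    HasFiniteKernel h ↔ IsFinite (c ≫ snd X (specOver k K)).left := by
  have h1 : IsPullback η[(baseChange k K).obj Q].left (Spec.map (CommRingCat.ofHom (algebraMap k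
      K)))
      (pullback.fst Q.hom _) η[Q].left := by
    have h := isPullback_baseChange_map_left (K := K) η[Q]
    let ε := (Functor.Monoidal.εIso (baseChange k K)).hom
    have hε : IsIso ε.left := inferInstanceAs (IsIso ((Over.forget (Spec (.of K))).map ε))
    refine h.of_iso (asIso ε.left).symm (Iso.refl _) (Iso.refl _) (Iso.refl _) ?_ ?_ ?_ ?_
    · rw [Iso.symm_hom, asIso_inv, IsIso.eq_inv_comp]
      refine (congrArg (ε.left ≫ ·) (Category.comp_id _)).trans ?_
      rfl
    · rw [Iso.symm_hom, asIso_inv, IsIso.eq_inv_comp, Iso.refl_hom, Category.comp_id]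
      have h2 := Over.w ε
      have h3 := pullback.condition (f := (𝟙_ (Over (Spec (.of k)))).hom)
        (g := Spec.map (CommRingCat.ofHom (algebraMap k K)))
      refine (congrArg (ε.left ≫ ·) ((Category.comp_id _).symm.trans h3)).trans ?_
      refine (Category.assoc _ _ _).symm.trans ?_
      refine (congrArg (· ≫ _) h2).trans ?_
      exact Category.id_comp _
    · simp
    · simp
  have h3 : IsPullback c.left (toUnit P).left (h.left ≫ pullback.fst Q.hom _) η[Q].left := by
    have h4 : (toProd h).left = h.left ≫ pullback.fst Q.hom _ :=
      (Category.id_comp _).symm.trans (restrictScalarsBaseChange_hom_toProd_left h)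
    exact h4 ▸ hc.map (Over.forget _)
  have h5 : η[(baseChange k K).obj Q].left ≫ ((baseChange k K).obj Q).hom = 𝟙 _ :=
    Over.w η[(baseChange k K).obj Q]
  have h6 : pullback.snd h.left η[(baseChange k K).obj Q].left =
      pullback.fst h.left η[(baseChange k K).obj Q].left ≫ ((baseChange k K).obj X).hom := by
    refine .trans (Category.comp_id _).symm ((congrArg _ h5).symm.trans ?_)
    refine (pullback.condition_assoc _).symm.trans (congrArg _ ?_)
    exact Over.w h
  exact isFinite_snd_iff h1 h3 ((baseChange k K).obj X).hom h6

end

end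

section

variable {k : Type u} [Field k]

/-- The ring homomorphism `A → k` given by a rational point of the spectrum of a `k`-algebra `A`. -/
def pointRingHom {A : Type u} [CommRing A] [Algebra k A]
    (r : 𝟙_ (Over (Spec (.of k))) ⟶ specOver k A) : A →+* k :=
  (Spec.preimage r.left).hom

lemma left_eq_specMap_pointRingHom {A : Type u} [CommRing A] [Algebra k A]
    (r : 𝟙_ (Over (Spec (.of k))) ⟶ specOver k A) :
    r.left = Spec.map (CommRingCat.ofHom (pointRingHom r)) :=
  (Spec.map_preimage r.left).symm

lemma pointRingHom_comp {A B : Type u} [CommRing A] [Algebra k A] [CommRing B] [Algebra k B]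
    (r : 𝟙_ (Over (Spec (.of k))) ⟶ specOver k B) (f : A →ₐ[k] B) :
    pointRingHom (r ≫ specOverMap f) = (pointRingHom r).comp f.toRingHom := by
  have h : Spec.map (CommRingCat.ofHom (pointRingHom (r ≫ specOverMap f))) =
      Spec.map (CommRingCat.ofHom ((pointRingHom r).comp f.toRingHom)) := by
    rw [← left_eq_specMap_pointRingHom, Over.comp_left, left_eq_specMap_pointRingHom r,
      CommRingCat.ofHom_comp, Spec.map_comp]
    rfl
  exact congrArg CommRingCat.Hom.hom (Spec.map_injective h)

variable {K : Type u} [Field K] [Algebra k K]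

/-- A homomorphism over an extension `K` of `k` extends to a family of homomorphisms, parametrized
by the spectrum of a finitely generated subalgebra of `K`. -/
lemma exists_family {M Q : Over (Spec (.of k))} [GrpObj M] [GrpObj Q] [CompactSpace M.left]
    [LocallyOfFiniteType Q.hom] (h : (baseChange k K).obj M ⟶ (baseChange k K).obj Q) [IsMonHom h] :
    ∃ (A : FGSubalgebra k K) (H : M ⊗ specOver k A.1 ⟶ Q),
      M ◁ specOverMap A.1.val ≫ H = toProd h ∧
      ∀ (X : Over (Spec (.of k))) (x y : X ⟶ M), (x * y) ▷ specOver k A.1 ≫ H =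
        (x ▷ specOver k A.1 ≫ H) * (y ▷ specOver k A.1 ≫ H) := by
  have := isSeparated_of_grpObj M
  have : QuasiSeparatedSpace M.left := (quasiSeparated_iff_quasiSeparatedSpace M.hom).1
      inferInstance
  have := compactSpace_tensor M M
  obtain ⟨A, H, hH⟩ := exists_prod_hom_eq (toProd h)
  obtain ⟨B, hAB, hB⟩ := exists_prod_hom_eq_hom ((fst M M * snd M M) ▷ specOver k A.1 ≫ H)
    ((fst M M ▷ specOver k A.1 ≫ H) * (snd M M ▷ specOver k A.1 ≫ H)) (by
      rw [comp_mul, whisker_exchange_assoc, whisker_exchange_assoc, whisker_exchange_assoc,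
        hH, toProd_comp_mul])
  rw [comp_mul, whisker_exchange_assoc, whisker_exchange_assoc, whisker_exchange_assoc] at hB
  refine ⟨B, M ◁ specOverMap (Subalgebra.inclusion hAB) ≫ H, ?_, fun X x y ↦ ?_⟩
  · rw [← Category.assoc, ← MonoidalCategory.whiskerLeft_comp, specOverMap_comp]
    exact hH
  · have hx (z : M ⊗ M ⟶ M) : (lift x y ≫ z) ▷ specOver k B.1 ≫ M ◁ specOverMap
        (Subalgebra.inclusion hAB) ≫ H = lift x y ▷ specOver k B.1 ≫ z ▷ specOver k B.1 ≫
          M ◁ specOverMap (Subalgebra.inclusion hAB) ≫ H := by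
      rw [comp_whiskerRight, Category.assoc]
    have h1 := hx (fst M M * snd M M)
    rw [hB, comp_mul, comp_mul, ← hx, ← hx, lift_fst, lift_snd] at h1
    exact h1

/-- If the homomorphism given by the generic member of a family of homomorphisms has a finite
kernel, then so do those outside of the zeros of a nonzero function on the base. -/
lemma exists_hasFiniteKernel {M Q : Over (Spec (.of k))} [GrpObj Q] [CompactSpace M.left]
    [LocallyOfFiniteType M.hom] {h : (baseChange k K).obj M ⟶ (baseChange k K).obj Q}
    (hh : HasFiniteKernel h) (A : Subalgebra k K) (H : M ⊗ specOver k A ⟶ Q)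
    (hH : M ◁ specOverMap A.val ≫ H = toProd h) :
    ∃ s : A, s ≠ 0 ∧ ∀ r : 𝟙_ (Over (Spec (.of k))) ⟶ specOver k A, pointRingHom r s ≠ 0 →
      HasFiniteKernel (lift (𝟙 M) (toUnit M ≫ r) ≫ H) := by
  obtain ⟨N, j, hj⟩ := exists_kernel H
  let g : N ⟶ specOver k A := j ≫ snd M _
  have hpb {T : Over (Spec (.of k))} (t : T ⟶ specOver k A) :
      IsPullback (pullback.fst g t).left (pullback.snd g t).left g.left t.left :=
    (IsPullback.of_hasPullback g t).map (Over.forget _)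
  have hj' : IsClosedImmersion j.left := by
    have := isSeparated_of_grpObj Q
    have h1 : IsClosedImmersion (η[Q].left ≫ Q.hom) := by
      rw [Over.w]
      exact inferInstanceAs (IsClosedImmersion (𝟙 _))
    exact MorphismProperty.of_isPullback (hj.map (Over.forget _)).flip
      (IsClosedImmersion.of_comp η[Q].left Q.hom)
  have hN : CompactSpace N.left := compactSpace_of_isClosedImmersion j
  let g' : N.left ⟶ Spec (.of A) := g.left
  have hg : LocallyOfFiniteType g' := by
    have : LocallyOfFiniteType (snd M (specOver k A)).left :=
      MorphismProperty.of_isPullback (isPullback_tensor_left M (specOver k A)) ‹_›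
    exact inferInstanceAs (LocallyOfFiniteType (j.left ≫ (snd M (specOver k A)).left))
  obtain ⟨s, hs, hsr⟩ := exists_isFinite_pullback (A := A) (L := K) g' (by
    obtain ⟨c, hc, hc'⟩ := exists_isPullback_whiskerLeft hj (specOverMap A.val)
      (IsPullback.of_hasPullback g (specOverMap A.val))
    rw [hH] at hc'
    rw [hasFiniteKernel_iff_toProd hc', hc] at hh
    exact (iff_of_isPullback (@IsFinite) (hpb (specOverMap A.val)) (IsPullback.of_hasPullback _
        _)).1 hh)
  refine ⟨s, hs, fun r hr ↦ ?_⟩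
  obtain ⟨c, hc, hc'⟩ := exists_isPullback_whiskerLeft hj r (IsPullback.of_hasPullback g r)
  have h1 : IsFinite (pullback.snd g r).left := by
    refine (iff_of_isPullback (@IsFinite) (hpb r) (IsPullback.of_hasPullback _ _)).2 ?_
    rw [left_eq_specMap_pointRingHom]
    exact hsr k (pointRingHom r) hr
  have h2 : HasFiniteKernel (M ◁ r ≫ H) := by
    refine (hasFiniteKernel_iff hc').2 ?_
    rw [← Over.w (pullback.snd g r)]
    exact inferInstanceAs (IsFinite ((pullback.snd g r).left ≫ 𝟙 _))
  have h3 : lift (𝟙 M) (toUnit M ≫ r) ≫ H = (ρ_ M).inv ≫ M ◁ r ≫ H := by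
    rw [← Category.assoc]
    congr 1
    ext1 <;> simp
  rw [h3]
  exact h2.comp_iso (ρ_ M).symm

/-- A homomorphism `h` over `K` and a point `b` spread out to families over a finitely generated
subalgebra of `K`. Their members at a suitable rational point are a homomorphism and a point over
`k` with the same properties. -/
lemma exists_specialization [IsAlgClosed k] {M W Q Y : Over (Spec (.of k))} [GrpObj M] [GrpObj Q]
    [CompactSpace M.left] [LocallyOfFiniteType M.hom] [CompactSpace W.left] [Nonempty W.left]
    [LocallyOfFiniteType W.hom] [LocallyOfFiniteType Q.hom] [CompactSpace Q.left] (m : W ⟶ M)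
    (y : Y ⟶ Q) (hy : IsPreirreducible (Set.range y.left))
    (h : (baseChange k K).obj M ⟶ (baseChange k K).obj Q) [IsMonHom h] (hh : HasFiniteKernel h)
    (b : 𝟙_ (Over (Spec (.of K))) ⟶ (baseChange k K).obj Q)
    (hcl : closure (Set.range ((baseChange k K).map m ≫ h ≫ translationBy b).left) =
      pullback.fst Q.hom _ ⁻¹' closure (Set.range y.left)) :
    ∃ (h' : M ⟶ Q) (b' : 𝟙_ (Over (Spec (.of k))) ⟶ Q), IsMonHom h' ∧ HasFiniteKernel h' ∧
      closure (Set.range (m ≫ h' ≫ translationBy b').left) = closure (Set.range y.left) := by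
  have := isSeparated_of_grpObj Q
  have : QuasiSeparatedSpace Q.left := (quasiSeparated_iff_quasiSeparatedSpace Q.hom).1
      inferInstance
  obtain ⟨A, H, hH, hmul⟩ := exists_family h
  obtain ⟨s, hs, hsr⟩ := exists_hasFiniteKernel hh A.1 H hH
  have : CompactSpace (𝟙_ (Over (Spec (.of k)))).left := inferInstanceAs
      (CompactSpace (Spec (.of k)))
  have : QuasiSeparatedSpace (𝟙_ (Over (Spec (.of k)))).left :=
    inferInstanceAs (QuasiSeparatedSpace (Spec (.of k)))
  obtain ⟨A', β, hβ⟩ := exists_prod_hom_eq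
    (toProd (X := 𝟙_ _) (toUnit ((baseChange k K).obj (𝟙_ _)) ≫ b))
  -- `s` is invertible on `D`, hence does not vanish at the rational points of `Spec D`
  obtain ⟨D, hA, hA', hmem⟩ : ∃ D : FGSubalgebra k K, A.1 ≤ D.1 ∧ A'.1 ≤ D.1 ∧ (s : K)⁻¹ ∈ D.1 :=
    ⟨⟨A.1 ⊔ A'.1 ⊔ Algebra.adjoin k {(s : K)⁻¹},
      (A.2.sup A'.2).sup (Subalgebra.fg_def.2 ⟨_, Set.finite_singleton _, rfl⟩)⟩,
      le_sup_left.trans le_sup_left, le_sup_right.trans le_sup_left,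
      (le_sup_right : _ ≤ A.1 ⊔ A'.1 ⊔ _) (Algebra.subset_adjoin (Set.mem_singleton _))⟩
  let ψ := specOverMap (Subalgebra.inclusion hA)
  let ψ' := specOverMap (Subalgebra.inclusion hA')
  let w : W ⊗ specOver k D.1 ⟶ Q :=
    (toUnit W ▷ specOver k D.1 ≫ 𝟙_ _ ◁ ψ' ≫ β) * (m ▷ specOver k D.1 ≫ M ◁ ψ ≫ H)
  have hw : W ◁ specOverMap D.1.val ≫ w =
      toProd ((baseChange k K).map m ≫ h ≫ translationBy b) := by
    have h1 : 𝟙_ _ ◁ specOverMap D.1.val ≫ 𝟙_ _ ◁ ψ' ≫ β =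
        toProd (X := 𝟙_ _) (toUnit ((baseChange k K).obj (𝟙_ _)) ≫ b) := by
      rw [← Category.assoc, ← MonoidalCategory.whiskerLeft_comp, specOverMap_comp]
      exact hβ
    have h2 : M ◁ specOverMap D.1.val ≫ M ◁ ψ ≫ H = toProd h := by
      rw [← Category.assoc, ← MonoidalCategory.whiskerLeft_comp, specOverMap_comp]
      exact hH
    have h3 : toUnit ((baseChange k K).obj W) ≫ b =
        (baseChange k K).map (toUnit W) ≫ toUnit ((baseChange k K).obj (𝟙_ _)) ≫ b := by
      rw [← Category.assoc]
      exact congrArg (· ≫ b) (toUnit_unique _ _)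
    rw [comp_mul, whisker_exchange_assoc, whisker_exchange_assoc, h1, h2, ← toProd_map_comp,
      ← toProd_map_comp, ← h3, ← toProd_mul, ← Category.assoc _ h, comp_translationBy]
  obtain ⟨r, hr⟩ := exists_point_closure_range_eq y hy D.1.val Subtype.val_injective w (by
    rw [hw]
    exact closure_range_lift_toProd _ hcl)
  refine ⟨lift (𝟙 M) (toUnit M ≫ r ≫ ψ) ≫ H, lift (𝟙 _) (r ≫ ψ') ≫ β, ?_, ?_, ?_⟩
  · refine isMonHom_of_points _ fun S x y ↦ ?_
    have h1 (z : S ⟶ M) : z ≫ lift (𝟙 M) (toUnit M ≫ r ≫ ψ) ≫ H =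
        lift (𝟙 S) (toUnit S ≫ r ≫ ψ) ≫ z ▷ specOver k A.1 ≫ H := by
      have h2 : z ≫ lift (𝟙 M) (toUnit M ≫ r ≫ ψ) =
          lift (𝟙 S) (toUnit S ≫ r ≫ ψ) ≫ z ▷ specOver k A.1 := by
        ext1 <;> simp
      rw [← Category.assoc, h2, Category.assoc]
    rw [h1, h1, h1, hmul, comp_mul]
  · refine hsr (r ≫ ψ) ?_
    rw [pointRingHom_comp]
    have hs' : (s : K) ≠ 0 := fun h ↦ hs (Subtype.ext h)
    have h1 : Subalgebra.inclusion hA s * ⟨(s : K)⁻¹, hmem⟩ = 1 := Subtype.ext (mul_inv_cancel₀ hs')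
    have h2 := congrArg (pointRingHom r) h1
    rw [_root_.map_mul, map_one] at h2
    exact left_ne_zero_of_mul_eq_one h2
  · have h1 : toUnit W ≫ lift (𝟙 _) (r ≫ ψ') =
        lift (𝟙 W) (toUnit W ≫ r) ≫ toUnit W ▷ specOver k D.1 ≫ 𝟙_ _ ◁ ψ' := by
      ext1 <;> simp
    have h2 : m ≫ lift (𝟙 M) (toUnit M ≫ r ≫ ψ) =
        lift (𝟙 W) (toUnit W ≫ r) ≫ m ▷ specOver k D.1 ≫ M ◁ ψ := by
      ext1 <;> simp
    rw [← hr, ← Category.assoc m, comp_translationBy, comp_mul, ← Category.assoc m, h2,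
      ← Category.assoc (toUnit W) (lift _ _), h1]
    simp only [Category.assoc]

end

/-! ### Descent of isotriviality to the smaller field -/

/-- A finite field in an extension of an algebraically closed field `F` is contained in `F`. -/
lemma exists_algebra_isScalarTower (κ F K : Type u) [Field κ] [Finite κ] [Field F] [IsAlgClosed F]
    [Field K] [Algebra F K] [Algebra κ K] : ∃ _ : Algebra κ F, IsScalarTower κ F K := by
  have h (x : κ) : algebraMap κ K x ∈ (algebraMap F K).range := by
    have := Fintype.ofFinite κ
    have hx : IsIntegral F (algebraMap κ K x) := by
      refine ⟨.X ^ Fintype.card κ - .X, ?_, ?_⟩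
      · exact Polynomial.monic_X_pow_sub (by
          rw [Polynomial.degree_X]; exact_mod_cast Fintype.one_lt_card)
      · simp [← map_pow, FiniteField.pow_card]
    exact minpoly.mem_range_of_degree_eq_one F _
      (IsAlgClosed.degree_eq_one_of_irreducible F (minpoly.irreducible hx))
  let e : F ≃+* (algebraMap F K).range :=
    .ofBijective (algebraMap F K).rangeRestrict
      ⟨fun a b hab ↦ (algebraMap F K).injective (congrArg Subtype.val hab),
        (algebraMap F K).rangeRestrict_surjective⟩
  let f : κ →+* F := e.symm.toRingHom.comp ((algebraMap κ K).codRestrict _ h)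
  refine ⟨f.toAlgebra, ?_⟩
  let := f.toAlgebra
  refine .of_algebraMap_eq fun x ↦ ?_
  exact (congrArg Subtype.val (e.apply_symm_apply ⟨algebraMap κ K x, h x⟩)).symm

section

variable {F K : Type u} [Field F] [Field K] [Algebra F K]

/-- The semiabelian variety and its subscheme over `κ` are already defined over `F`; only the
homomorphism and the point, which need not be, are specialized. -/
lemma IsIsotrivial.of_baseChange [IsAlgClosed F] {Q Y : Over (Spec (.of F))} [GrpObj Q]
    [LocallyOfFiniteType Q.hom] [CompactSpace Q.left] (y : Y ⟶ Q)
    (hy : IsPreirreducible (Set.range y.left))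
    (h : IsIsotrivial ((MordellLang.baseChange F K).obj Q)
      (pullback.fst Q.hom _ ⁻¹' closure (Set.range y.left))) :
    IsIsotrivial Q (closure (Set.range y.left)) := by
  obtain ⟨κ, _, hκ, _, M, _, hM, W, m, h, b, hWi, hm, hh, hk, hcl⟩ := h
  obtain ⟨_, _⟩ := exists_algebra_isScalarTower κ F K
  have := isClosedImmersion_baseChange_map (K := F) m
  have := IsSemiabelian.compactSpace ((MordellLang.baseChange κ F).obj M)
  have := IsSemiabelian.locallyOfFiniteType ((MordellLang.baseChange κ F).obj M)
  have := compactSpace_of_isClosedImmersion ((MordellLang.baseChange κ F).map m)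
  have : LocallyOfFiniteType ((MordellLang.baseChange κ F).obj W).hom := by
    rw [← Over.w ((MordellLang.baseChange κ F).map m)]
    infer_instance
  have : Nonempty ((MordellLang.baseChange κ F).obj W).left := by
    obtain ⟨c, -⟩ := Scheme.Pullback.exists_preimage_pullback (f := W.hom)
      (g := Spec.map (CommRingCat.ofHom (algebraMap κ F))) (genericPoint W.left)
      (IsLocalRing.closedPoint F) (Subsingleton.elim (α := PrimeSpectrum κ) _ _)
    exact ⟨c⟩
  have hcl' : closure (Set.range ((MordellLang.baseChange F K).map ((MordellLang.baseChange κ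
      F).map m) ≫
      ((baseChangeTower κ F K M).hom ≫ h) ≫ translationBy b).left) =
      pullback.fst Q.hom _ ⁻¹' closure (Set.range y.left) := by
    rw [Category.assoc, reassoc_of% baseChangeTower_hom_naturality κ F K m, range_iso_comp_left,
        hcl]
  obtain ⟨h', b', hh', hk', hcl'⟩ := exists_specialization ((MordellLang.baseChange κ F).map m) y hy
    ((baseChangeTower κ F K M).hom ≫ h) (hk.comp_iso (baseChangeTower κ F K M)) b hcl'
  exact ⟨κ, inferInstance, hκ, inferInstance, M, inferInstance, hM, W, m, h', b', hWi, hm, hh', hk',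
    hcl'⟩

/-- The quotients `Q_K` and `Q'` are identified, and the image of `Y_K` in `Q_K` is the preimage of
the image of `Y` in `Q`. -/
lemma conclusion_baseChange_iff (p : ℕ) [Fact p.Prime] [IsAlgClosed F] [CharP F p]
    {B Y Q : Over (Spec (.of F))} {Q' : Over (Spec (.of K))} [GrpObj B] [IsSemiabelian B]
    [IsIntegral Y.left] (i : Y ⟶ B) [IsClosedImmersion i.left] [GrpObj Q] [GrpObj Q'] {π : B ⟶ Q}
    (hπ : IsQuotientByStabilizer i π) {π' : (baseChange F K).obj B ⟶ Q'}
    (hπ' : IsQuotientByStabilizer ((baseChange F K).map i) π') :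
    Conclusion i π ↔ Conclusion ((baseChange F K).map i) π' := by
  have : CharP K p := charP_of_injective_algebraMap (algebraMap F K).injective p
  have := isReduced_baseChange (K := K) p Y
  have := isClosedImmersion_baseChange_map (K := K) i
  have := mono_of_isClosedImmersion_left i
  have := IsSemiabelian.compactSpace B
  have := IsSemiabelian.locallyOfFiniteType B
  obtain ⟨θ, hθ, _⟩ := (hπ.baseChange (K := K) p).exists_iso hπ'
  obtain ⟨_, _, s, r, -, -, hq⟩ := hπ
  have := hq.locallyOfFiniteType
  have := hq.surjective
  have : CompactSpace Q.left := by
    rw [← isCompact_univ_iff, ← π.left.surjective.range_eq]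
    exact isCompact_range π.left.continuous
  have hy : IsPreirreducible (Set.range (i ≫ π).left) := by
    rw [← Set.image_univ]
    exact (PreirreducibleSpace.isPreirreducible_univ).image _ (i ≫ π).left.continuous.continuousOn
  have : IsIso θ.hom.left := inferInstanceAs (IsIso ((Over.forget _).map θ.hom))
  have hcl : closure (Set.range ((baseChange F K).map i ≫ π').left) =
      θ.hom.left '' (pullback.fst Q.hom _ ⁻¹' closure (Set.range (i ≫ π).left)) := by
    rw [← closure_range_baseChange_map, ← hθ, ← Category.assoc, ← Functor.map_comp,
      Over.comp_left _ _ _ _ θ.hom, Scheme.Hom.comp_base, TopCat.coe_comp, Set.range_comp]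
    exact (θ.hom.left.homeomorph.image_closure _).symm
  rw [conclusion_iff p, conclusion_iff p, hcl]
  refine ⟨fun h ↦ h.baseChange.of_iso θ, fun h ↦ .of_baseChange (K := K) _ hy ?_⟩
  have hinv : θ.inv.left '' (θ.hom.left '' (pullback.fst Q.hom _ ⁻¹' closure (Set.range (i ≫
      π).left))) =
      pullback.fst Q.hom _ ⁻¹' closure (Set.range (i ≫ π).left) := by
    rw [← Set.image_comp, ← TopCat.coe_comp, ← Scheme.Hom.comp_base, ← Over.comp_left, θ.hom_inv_id]
    exact Set.image_id _
  have : IsMonHom θ.symm.hom := inferInstanceAs (IsMonHom θ.inv)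
  rw [← hinv]
  exact h.of_iso θ.symm

end

end

end MordellLang

theorem lemma3p4 (p : ℕ) [Fact p.Prime]
    (F F' : Type u) [Field F] [IsAlgClosed F] [CharP F p] [Field F'] [IsAlgClosed F'] [Algebra F F']
    (B : Over (Spec (.of F))) [GrpObj B] [MordellLang.IsSemiabelian B]
    (Y : Over (Spec (.of F))) [IsIntegral Y.left] (i : Y ⟶ B) [IsClosedImmersion i.left]
    (Λ : Subgroup (𝟙_ (Over (Spec (.of F))) ⟶ B)) (hΛ : MordellLang.IsFGAt p Λ)
    -- the quotient of `B` by the reduced stabilizer of `Y`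
    (Q : Over (Spec (.of F))) [GrpObj Q] (π : B ⟶ Q)
    (hπ : MordellLang.IsQuotientByStabilizer i π)
    -- the quotient of `B_{F'}` by the reduced stabilizer of `Y_{F'}`
    (Q' : Over (Spec (.of F'))) [GrpObj Q'] (π' : (MordellLang.baseChange F F').obj B ⟶ Q')
    (hπ' : MordellLang.IsQuotientByStabilizer ((MordellLang.baseChange F F').map i) π') :
    ((MordellLang.DenseIntersection i Λ → MordellLang.Conclusion i π) ↔
      (MordellLang.DenseIntersection ((MordellLang.baseChange F F').map i)
          (Λ.map (MordellLang.pointsBaseChange F F' B)) →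
        MordellLang.Conclusion ((MordellLang.baseChange F F').map i) π')) ∧
    (MordellLang.Conclusion i π ↔
      MordellLang.Conclusion ((MordellLang.baseChange F F').map i) π') := by

  have h := MordellLang.conclusion_baseChange_iff p i hπ hπ'
  exact ⟨imp_congr (MordellLang.denseIntersection_baseChange_iff i Λ).symm h, h⟩
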